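/- Let $q_1,\dots,q_n\in\mathbb Z$ be such that the pretzel link $K=P(q_1,\dots,q_n)$ ($n$ vertical twisted bands joined cyclically, the $i$-th one with $|q_i|$ half-twists in the direction given by the sign of $q_i$) is a knot, with either orientation (orientations exist). Let $\Delta_K(t)\in\mathbb Z[t,t^{-1}]$ be its Alexander polynomial, i.e. the greatest common divisor of the first (codimension one) minors of the Alexander matrix of the standard diagram, which is determined up to multiplication by $\pm t^k$, $k\in\mathbb Z$. Write $f\doteq g$ if $f=\pm t^k g$ for some $k\in\mathbb Z$, let $\deg f$ be the difference between the highest and the lowest exponent of the nonzero terms of $f\neq 0$, and let $\sigma_k(q_1,\dots,q_n)$ be the $k$-th elementary symmetric polynomial of the $q_i$. (I) Suppose that all $q_i$ are odd. Then: (1) $\deg\Delta_K(t)=n-1$ if and only if $\displaystyle\sum_{k=0}^{(n-1)/2}\sigma_{2k}(q_1,\dots,q_n)\neq 0$. (2) $\Delta_K(t)\doteq 1$ if and only if $\displaystyle\sigma_{2k}(q_1,\dots,q_n)=(-1)^k\binom{\frac{n-1}{2}}{k}$ for every $0\le k\le\frac{n-1}{2}$. (II) Suppose that some $q_e$ is even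 (then all other $q_i$ are odd). Then $\Delta_K(t)$ is not trivial, apart from degenerate parameters. Precisely, let $u$ be the sum of those $q_i$ that are equal to $\pm1$. Then $\Delta_K(t)\doteq 1$ if and only if one of the following holds: (a) all $q_i$ with $i\ne e$ are $\pm1$, and $q_e u\in\{0,-2\}$; (b) exactly one $q_r$ with $r\neq e$ is different from $\pm1$, and either $u=0$ and $q_e+q_r=\pm1$, or $|u|=1$, $q_e=-2u$ and $q_r=-3u$. In particular, $\Delta_K(t)\not\doteq 1$ if at least two of the odd parameters are different from $\pm1$, for instance if $n\ge 3$ and no $q_i$ is $\pm1$. Together, (I)(2) and (II) characterize the pretzel knots with trivial Alexander polynomial. -/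

import Mathlib

open scoped LaurentPolynomial

/-! ## Laurent polynomials -/

/-- `f ≐ g`: equality up to multiplication by `± t ^ k` with `k : ℤ`. -/
def EqUpToUnit (f g : ℤ[T;T⁻¹]) : Prop :=
  ∃ k : ℤ, f = LaurentPolynomial.T k * g ∨ f = -(LaurentPolynomial.T k * g)

/-- The degree (span) of a Laurent polynomial: the highest exponent minus the lowest exponent among
its nonzero terms, and `⊥` for the zero polynomial. It is invariant under multiplication by
`± t ^ k`. -/
noncomputable def spanDegree (f : ℤ[T;T⁻¹]) : WithBot ℤ :=
  if h : f.coeff.support.Nonempty then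
    ((f.coeff.support.max' h - f.coeff.support.min' h : ℤ) : WithBot ℤ)
  else ⊥

/-- In `ℤ[t, t⁻¹]`, a unique factorization domain, finite families have a greatest common
divisor. -/
theorem exists_gcd_laurent {ι : Type*} [Finite ι] (f : ι → ℤ[T;T⁻¹]) :
    ∃ g : ℤ[T;T⁻¹], ∀ d : ℤ[T;T⁻¹], d ∣ g ↔ ∀ i, d ∣ f i := by
  classical
  have hU : UniqueFactorizationMonoid ℤ[T;T⁻¹] :=
    UniqueFactorizationMonoid.of_isLocalization
      (Submonoid.powers (Polynomial.X : Polynomial ℤ)) ℤ[T;T⁻¹]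
  let _ := Fintype.ofFinite ι
  let _ : StrongNormalizationMonoid ℤ[T;T⁻¹] :=
    UniqueFactorizationMonoid.strongNormalizationMonoid
  let _ : NormalizedGCDMonoid ℤ[T;T⁻¹] := UniqueFactorizationMonoid.toNormalizedGCDMonoid _
  exact ⟨Finset.univ.gcd f, fun d => by simp [Finset.dvd_gcd_iff]⟩

/-! ## Link diagrams -/

/-- A link diagram in combinatorial form. The diagram is cut into finitely many strand segments
(edges), and each edge `e` has two ends `(e, false)` and `(e, true)`. The four edge ends at a
crossing `c` are, in counterclockwise order, `corner c 0`, `corner c 1`, `corner c 2`, `corner c 3`;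
the strand through the corners `1` and `3` runs over the strand through the corners `0` and `2`.
At a joint, two edge ends are simply connected to each other. Every edge end lies at exactly one
crossing corner or on exactly one side of a joint. -/
structure LinkDiagram where
  Edge : Type
  Crossing : Type
  Joint : Type
  [fintypeEdge : Fintype Edge]
  [fintypeCrossing : Fintype Crossing]
  [fintypeJoint : Fintype Joint]
  corner : Crossing → Fin 4 → Edge × Bool
  tie : Joint → Bool → Edge × Bool
  bijective_ends : Function.Bijective
    (Sum.elim (fun x : Crossing × Fin 4 => corner x.1 x.2) (fun x : Joint × Bool => tie x.1 x.2))

namespace LinkDiagram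

attribute [instance] fintypeEdge fintypeCrossing fintypeJoint

variable (D : LinkDiagram)

/-- Two edges that follow each other on a component of the link: opposite edges at a crossing,
or the two edges at a joint. -/
inductive Follows : D.Edge → D.Edge → Prop
  | crossing (c : D.Crossing) (k : Fin 4) : Follows (D.corner c k).1 (D.corner c (k + 2)).1
  | joint (j : D.Joint) : Follows (D.tie j false).1 (D.tie j true).1

/-- The components of the link. -/
def Component : Type := Quot D.Follows

/-- The link is a knot: it has exactly one component. -/
def IsKnot : Prop := Nat.card D.Component = 1

/-- An orientation of the link: the edge `e` is directed towards its end `(e, head e)`, and the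
directions fit together along each strand through a crossing and at each joint. The edge end `d`
points into its crossing or joint exactly if `head d.1 = d.2`. -/
structure Orientation where
  head : D.Edge → Bool
  lower : ∀ c, head (D.corner c 0).1 = (D.corner c 0).2 ↔ head (D.corner c 2).1 ≠ (D.corner c 2).2
  upper : ∀ c, head (D.corner c 1).1 = (D.corner c 1).2 ↔ head (D.corner c 3).1 ≠ (D.corner c 3).2
  joint : ∀ j, head (D.tie j false).1 = (D.tie j false).2 ↔ head (D.tie j true).1 ≠ (D.tie j true).2

variable {D}

namespace Orientation

variable (o : D.Orientation)

/-- The edge under the overstrand of `c` that lies to the left of the directed overstrand. -/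
def left (c : D.Crossing) : D.Edge :=
  if o.head (D.corner c 3).1 = (D.corner c 3).2 then (D.corner c 2).1 else (D.corner c 0).1

/-- The edge under the overstrand of `c` that lies to the right of the directed overstrand. -/
def right (c : D.Crossing) : D.Edge :=
  if o.head (D.corner c 3).1 = (D.corner c 3).2 then (D.corner c 0).1 else (D.corner c 2).1

open Classical in
/-- The Alexander matrix. There is one generator `x_e` for each edge. At each crossing, the two
parts of the overstrand have the same generator `x`, and `(1 - t) x + t y - z = 0` where `y` and `z`
belong to the edges to the left and to the right of the overstrand. At a joint, the two edges have
the same generator. -/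
noncomputable def alexanderMatrix :
    Matrix (D.Crossing ⊕ D.Crossing ⊕ D.Joint) D.Edge ℤ[T;T⁻¹] :=
  Matrix.of <| Sum.elim
    (fun c => Pi.single (D.corner c 1).1 1 - Pi.single (D.corner c 3).1 1) <| Sum.elim
    (fun c => Pi.single (D.corner c 1).1 (1 - LaurentPolynomial.T 1)
      + Pi.single (o.left c) (LaurentPolynomial.T 1) - Pi.single (o.right c) 1)
    (fun j => Pi.single (D.tie j false).1 1 - Pi.single (D.tie j true).1 1)

/-- `Δ` is a greatest common divisor of the minors of the Alexander matrix whose size is one less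
than the number of generators, i.e. a generator of the smallest principal ideal that contains the
first elementary ideal. -/
def IsAlexanderPolynomial (Δ : ℤ[T;T⁻¹]) : Prop :=
  ∀ d : ℤ[T;T⁻¹], d ∣ Δ ↔
    ∀ (r : Fin (Fintype.card D.Edge - 1) → D.Crossing ⊕ D.Crossing ⊕ D.Joint)
      (s : Fin (Fintype.card D.Edge - 1) → D.Edge), d ∣ (o.alexanderMatrix.submatrix r s).det

theorem exists_isAlexanderPolynomial : ∃ Δ, o.IsAlexanderPolynomial Δ := by
  obtain ⟨g, hg⟩ := exists_gcd_laurent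
    (fun x : (Fin (Fintype.card D.Edge - 1) → D.Crossing ⊕ D.Crossing ⊕ D.Joint) ×
      (Fin (Fintype.card D.Edge - 1) → D.Edge) => (o.alexanderMatrix.submatrix x.1 x.2).det)
  exact ⟨g, fun d => (hg d).trans Prod.forall⟩

/-- The Alexander polynomial of an oriented link diagram, which is determined up to multiplication
by units `± t ^ k` of `ℤ[t, t⁻¹]`. -/
noncomputable def alexanderPolynomial : ℤ[T;T⁻¹] :=
  o.exists_isAlexanderPolynomial.choose

end Orientation

end LinkDiagram

/-! ## Pretzel links -/

section Pretzel

variable {n : ℕ} (q : Fin n → ℤ)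

/-- The strand segments of the standard diagram of `P(q_1, ..., q_n)`. The `i`-th vertical band has
`|q_i|` crossings, one below the other, and `⟨i, j, s⟩` is the segment of the band that lies
between its crossings number `j - 1` and `j`, on the left if `s = false`, on the right if
`s = true`. The end `false` of such a segment is its upper end, the end `true` its lower end. -/
abbrev PretzelEdge : Type := (i : Fin n) × Fin ((q i).natAbs + 1) × Bool

/-- The segment ends at the `j`-th crossing of the `i`-th band, in counterclockwise order: upper
right, upper left, lower left, lower right. -/
def pretzelCorner (i : Fin n) (j : Fin (q i).natAbs) : Fin 4 → PretzelEdge q × Bool :=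
  ![(⟨i, j.castSucc, true⟩, true), (⟨i, j.castSucc, false⟩, true),
    (⟨i, j.succ, false⟩, false), (⟨i, j.succ, true⟩, false)]

/-- The arcs that connect each band to the next one in cyclic order: `(i, false)` is the upper arc
from the upper right end of the `i`-th band to the upper left end of the next band, and `(i, true)`
is the lower arc from the lower right end of the `i`-th band to the lower left end of the next
band. -/
def pretzelTie (x : Fin n × Bool) (right : Bool) : PretzelEdge q × Bool :=
  let i := if right then finRotate n x.1 else x.1
  (⟨i, if x.2 then Fin.last _ else 0, !right⟩, x.2)

theorem pretzelCorner_band (i : Fin n) (j : Fin (q i).natAbs) (k : Fin 4) :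
    (pretzelCorner q i j k).1.1 = i := by
  fin_cases k <;> rfl

theorem pretzelCorner_inj (i : Fin n) {j j' : Fin (q i).natAbs} {k k' : Fin 4}
    (h : pretzelCorner q i j k = pretzelCorner q i j' k') : j = j' ∧ k = k' := by
  fin_cases k <;> fin_cases k' <;> simp_all [pretzelCorner]

theorem pretzelCorner_ne_end (i i' : Fin n) (j : Fin (q i).natAbs) (k : Fin 4) (s b : Bool) :
    pretzelCorner q i j k ≠ (⟨i', if b then Fin.last _ else 0, s⟩, b) := by
  intro h
  obtain rfl : i = i' := by
    rw [← pretzelCorner_band q i j k, h]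
  fin_cases k <;> cases b <;> simp [pretzelCorner, Fin.ext_iff] at h <;> omega

theorem pretzelCorner_ne_pretzelTie (i : Fin n) (j : Fin (q i).natAbs) (k : Fin 4)
    (x : Fin n × Bool) (r : Bool) : pretzelCorner q i j k ≠ pretzelTie q x r :=
  pretzelCorner_ne_end q _ _ _ _ _ _

/-- The standard diagram of the pretzel link `P(q_1, ..., q_n)`. In a band with `q_i > 0`, at each
crossing the strand from the upper left to the lower right runs over the other one; in a band with
`q_i < 0`, at each crossing the strand from the upper right to the lower left does. -/
def pretzelDiagram : LinkDiagram where
  Edge := PretzelEdge q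
  Crossing := (i : Fin n) × Fin (q i).natAbs
  Joint := Fin n × Bool
  corner c k := pretzelCorner q c.1 c.2 (if 0 < q c.1 then k else k + 1)
  tie := pretzelTie q
  bijective_ends := by
    constructor
    · rintro (⟨⟨i, j⟩, k⟩ | ⟨⟨i, b⟩, r⟩) (⟨⟨i', j'⟩, k'⟩ | ⟨⟨i', b'⟩, r'⟩) h
      · have hi : i = i' := by
          have := pretzelCorner_band q i j (if 0 < q i then k else k + 1)
          have h2 := pretzelCorner_band q i' j' (if 0 < q i' then k' else k' + 1)
          simp only [Sum.elim_inl] at h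
          rw [← this, ← h2, h]
        subst hi
        simp only [Sum.elim_inl] at h
        obtain ⟨rfl, h2⟩ := pretzelCorner_inj q i h
        split_ifs at h2 <;> simp_all
      · exact (pretzelCorner_ne_pretzelTie q _ _ _ _ _ h).elim
      · exact (pretzelCorner_ne_pretzelTie q _ _ _ _ _ h.symm).elim
      · simp only [Sum.elim_inr] at h
        have hb : b = b' := congrArg (fun d => d.2) h
        have hr : (!r) = !r' := congrArg (fun d => d.1.2.2) h
        have hi : (if r then finRotate n i else i) = if r' then finRotate n i' else i' :=
          congrArg (fun d => d.1.1) h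
        obtain rfl : r = r' := by simpa using hr
        subst hb
        have : i = i' := by
          cases r
          · exact hi
          · exact (finRotate n).injective hi
        rw [this]
    · rintro ⟨⟨i, j, s⟩, e⟩
      have key : (∃ j' k, pretzelCorner q i j' k = (⟨i, j, s⟩, e)) ∨
          ∃ x r, pretzelTie q x r = (⟨i, j, s⟩, e) := by
        cases e
        · induction j using Fin.cases with
          | zero =>
            right
            cases s
            · obtain ⟨i, rfl⟩ := (finRotate n).surjective i
              exact ⟨(i, false), true, rfl⟩
            · exact ⟨(i, false), false, rfl⟩
          | succ j =>
            left
            cases s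
            · exact ⟨j, 2, rfl⟩
            · exact ⟨j, 3, rfl⟩
        · induction j using Fin.lastCases with
          | last =>
            right
            cases s
            · obtain ⟨i, rfl⟩ := (finRotate n).surjective i
              exact ⟨(i, true), true, rfl⟩
            · exact ⟨(i, true), false, rfl⟩
          | cast j =>
            left
            cases s
            · exact ⟨j, 1, rfl⟩
            · exact ⟨j, 0, rfl⟩
      rcases key with ⟨j', k, h⟩ | ⟨x, r, h⟩
      · refine ⟨Sum.inl (⟨i, j'⟩, if 0 < q i then k else k - 1), ?_⟩
        simp only [Sum.elim_inl]
        rw [← h]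
        split_ifs <;> simp
      · exact ⟨Sum.inr (x, r), h⟩

end Pretzel

/-- The elementary symmetric polynomial `σ_k(q_1, ..., q_n)`. -/
def sigmaSymm {n : ℕ} (q : Fin n → ℤ) (k : ℕ) : ℤ :=
  ∑ s ∈ Finset.powersetCard k (Finset.univ : Finset (Fin n)), ∏ i ∈ s, q i

/-- The sum of those parameters that are equal to `1` or `-1`. -/
def unitSum {n : ℕ} (q : Fin n → ℤ) : ℤ :=
  ∑ i with |q i| = 1, q i

/-- The degenerate parameters `(q_1, ..., q_n)` with the even parameter `q_e`. If pairs `1, -1` are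
deleted, then, up to order and a common sign, there remain `(q_e)`, or `(0, 1, ..., 1)`, or
`(q_e, r)` with `q_e + r = 1`, or `(2, -1, 3)`. -/
def IsDegenerateEven {n : ℕ} (q : Fin n → ℤ) (e : Fin n) : Prop :=
  ((∀ i, i ≠ e → |q i| = 1) ∧ (q e * unitSum q = 0 ∨ q e * unitSum q = -2)) ∨
  ∃ r, r ≠ e ∧ |q r| ≠ 1 ∧ (∀ i, i ≠ e → i ≠ r → |q i| = 1) ∧
    ((unitSum q = 0 ∧ |q e + q r| = 1) ∨
      (|unitSum q| = 1 ∧ q e = -2 * unitSum q ∧ q r = -3 * unitSum q))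

/-! ### Minors of corank one and cyclic determinants. -/

section Minors

variable {R : Type*} [CommRing R]

/-! Let δ_i be the difference of the generators at the upper right and the upper left end of the
i-th band. The crossing relations determine all generators of a band from the two upper ones;
between top and bottom the left and the right generator are displaced by a_i δ_i and b_i δ_i. Hence
only the relations Σ δ_i = 0 (upper arcs) and b_i δ_i = a_{i+1} δ_{i+1} (lower arcs) remain, and one
lower arc is redundant. This gives Δ ≐ Σ_i ∏_{j<i} b_j ∏_{j>i} a_j (`dvd_minors_iff_dvd_det`,
`det_cyclic`, `associated_alexanderPolynomial`).

All q_i odd: a knot has n = 2p + 1, and then the two strands of every band are antiparallel. With τ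
= t or t⁻¹ one finds 2a_i = q_i(τ - 1) + (τ + 1) and 2b_i = q_i(τ - 1) - (τ + 1). As a_i - b_i = τ +
1 is constant, the sum telescopes to (τ + 1)Δ ≐ ∏ a_i - ∏ b_i, whence 4^p Δ ≐ Σ_j σ_{2j} (t -
1)^{2j} (t + 1)^{2(p-j)} (`exists_associated_odd`). Both extreme coefficients are Σ σ_{2j}, which
settles the degree. The polynomials multiplied by the σ_{2j} are linearly independent, and 4t = (t +
1)² - (t - 1)² gives the coefficients of the trivial polynomial.

One q_e even: all other bands have parallel strands. With s = -t and θ_i equal to (s^|q_i| - 1)/(s -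
1) up to a unit, Δ ≐ Σ_i ∏_{j≠i} θ_j, except that θ_e = (q_e/2)(1 + s⁻¹) if the band e is
antiparallel, i.e. if n is odd. For q_e ≠ 0, clearing denominators turns triviality into an identity
between ± X^k (X - 1)^N and an expression in the polynomials X^{a_i} - 1 with a_i = |q_i| (i ≠ e if
e is antiparallel). Extreme coefficients show that the signs of these q_i sum to zero; the symmetry
X ↦ 1/X expresses Σ a_i through k; the power series of 1/(X^a - 1) makes the small a_i cancel in
signed counts, or bounds k by 2. Since every a_i ≥ 1, almost all a_i must be 1
(`of_isMonomialTimes_even`, `of_isMonomialTimes_odd`). -/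

theorem AlternatingMap.map_sum_smul_eq_det_mul {F ι : Type*} [AddCommGroup F] [Module R F]
    [Fintype ι] [DecidableEq ι] (ω : F [⋀^ι]→ₗ[R] R) (C : Matrix ι ι R) (g : ι → F) :
    ω (fun i => ∑ j, C i j • g j) = C.det * ω g := by
  have h := congrArg (fun f => f C)
    ((ω.compLinearMap (Fintype.linearCombination R g)).eq_smul_basis_det (Pi.basisFun R ι))
  have h2 : (fun i => Fintype.linearCombination R g (C i)) = fun i => ∑ j, C i j • g j := by
    ext i; simp [Fintype.linearCombination_apply]
  have h3 : (fun i => Fintype.linearCombination R g (Pi.basisFun R ι i)) = g := by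
    ext i; simp
  simp only [AlternatingMap.compLinearMap_apply] at h
  rw [← h2]
  erw [h]
  rw [mul_comm, Pi.basisFun_det]
  simp only [h3]
  rfl

/-- Multilinearity allows the arguments to be treated one at a time; `key` inducts on the set of
arguments that are only known to lie in the span. -/
theorem AlternatingMap.dvd_of_mem_span {F ι : Type*} [AddCommGroup F] [Module R F]
    [Fintype ι] [DecidableEq ι] (ω : F [⋀^ι]→ₗ[R] R) (S : Set F) (d : R)
    (h : ∀ v : ι → F, (∀ i, v i ∈ S) → d ∣ ω v) (v : ι → F)
    (hv : ∀ i, v i ∈ Submodule.span R S) : d ∣ ω v := by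
  have key : ∀ (s : Finset ι) (v : ι → F), (∀ i ∈ s, v i ∈ Submodule.span R S) →
      (∀ i, i ∉ s → v i ∈ S) → d ∣ ω v := by
    intro s
    induction s using Finset.induction_on with
    | empty => exact fun v _ hv => h v fun i => hv i (by simp)
    | insert a s ha ih =>
      intro v hv hv'
      have : ∀ y ∈ Submodule.span R S, d ∣ ω (Function.update v a y) := by
        intro y hy
        induction hy using Submodule.span_induction with
        | mem y hy =>
          refine ih _ (fun i hi => ?_) (fun i hi => ?_)
          · rw [Function.update_of_ne (by rintro rfl; exact ha hi)]
            exact hv i (Finset.mem_insert_of_mem hi)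
          · by_cases hia : i = a
            · subst hia; simpa using hy
            · rw [Function.update_of_ne hia]
              exact hv' i (by simp [hia, hi])
        | zero => simp
        | add x y _ _ hx hy => rw [ω.map_update_add]; exact dvd_add hx hy
        | smul c x _ hx => rw [ω.map_update_smul]; exact hx.mul_left c
      simpa using this (v a) (hv a (Finset.mem_insert_self _ _))
  exact key Finset.univ v (fun i _ => hv i) (fun i hi => absurd (Finset.mem_univ i) hi)

/-- The alternating form that maps a family of vectors to the minor with columns `s`. -/
noncomputable def minorForm {E ι : Type*} [Fintype ι] [DecidableEq ι] (s : ι → E) :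
    (E → R) [⋀^ι]→ₗ[R] R :=
  (Matrix.detRowAlternating (n := ι) (R := R)).compLinearMap (LinearMap.funLeft R R s)

theorem minorForm_apply {E ι ρ : Type*} [Fintype ι] [DecidableEq ι] (s : ι → E)
    (A : Matrix ρ E R) (r : ι → ρ) : minorForm s (fun i => A (r i)) = (A.submatrix r s).det := rfl

/-- If the rows of `A` span the same submodule as the rows of `W * g`, where `g` spans all
differences of standard basis vectors, then the corank one minors of `A` have the same
common divisors as `det W`. -/
theorem dvd_minors_iff_dvd_det {E ρ ι : Type*} [Fintype E] [DecidableEq E] [Fintype ι]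
    [DecidableEq ι] (A : Matrix ρ E R) (e₀ : E) (hc : Fintype.card ι = Fintype.card E - 1)
    (g : ι → E → R) (W : Matrix ι ι R)
    (h₁ : ∀ r, A r ∈ Submodule.span R (Set.range fun i => ∑ j, W i j • g j))
    (h₂ : ∀ i, ∑ j, W i j • g j ∈ Submodule.span R (Set.range A))
    (h₃ : ∀ e, Pi.single e 1 - Pi.single e₀ 1 ∈ Submodule.span R (Set.range g)) (d : R) :
    (∀ (r : Fin (Fintype.card E - 1) → ρ) (s : Fin (Fintype.card E - 1) → E),
      d ∣ (A.submatrix r s).det) ↔ d ∣ W.det := by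
  obtain ⟨σ⟩ : Nonempty (ι ≃ Fin (Fintype.card E - 1)) :=
    ⟨(Fintype.equivFinOfCardEq hc)⟩
  constructor
  · intro h
    have hcard : Fintype.card ι = Fintype.card {e // e ≠ e₀} := by
      rw [hc, Fintype.card_subtype_compl, Fintype.card_subtype_eq]
    let τ : ι ≃ {e // e ≠ e₀} := Fintype.equivOfCardEq hcard
    have hω : d ∣ minorForm (R := R) (fun i => (τ i : E)) (fun i => ∑ j, W i j • g j) := by
      refine AlternatingMap.dvd_of_mem_span _ (Set.range A) d ?_ _ h₂
      intro v hv
      choose r hr using hv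
      obtain rfl : (fun i => A (r i)) = v := funext hr
      rw [minorForm_apply]
      have := h (r ∘ σ.symm) ((fun i => (τ i : E)) ∘ σ.symm)
      rwa [← Matrix.submatrix_submatrix, Matrix.det_submatrix_equiv_self] at this
    rw [AlternatingMap.map_sum_smul_eq_det_mul] at hω
    -- The vectors `Pi.single (τ i) 1 - Pi.single e₀ 1` are combinations of `g`, and in the columns
    -- other than `e₀` they form the identity matrix, so the minor of `g` divides 1.
    have hu : IsUnit (minorForm (R := R) (fun i => (τ i : E)) g) := by
      have : ∀ i, ∃ c : ι → R, ∑ j, c j • g j = Pi.single (τ i : E) 1 - Pi.single e₀ 1 :=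
        fun i => (Submodule.mem_span_range_iff_exists_fun R).1 (h₃ _)
      choose c hcg using this
      have h1 := AlternatingMap.map_sum_smul_eq_det_mul
        (minorForm (R := R) (fun i => (τ i : E))) (Matrix.of c) g
      have h2 : minorForm (R := R) (fun i => (τ i : E))
          (fun i => ∑ j, Matrix.of c i j • g j) = 1 := by
        have : (fun i => ∑ j, Matrix.of c i j • g j)
          = fun i => (Matrix.of fun i : ι => (Pi.single (τ i : E) 1 - Pi.single e₀ 1 : E → R)) i := by
          ext i : 1
          exact hcg i
        rw [this, minorForm_apply _ _ (fun i => i)]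
        convert Matrix.det_one (n := ι) (R := R)
        ext i j
        have : (τ j : E) ≠ e₀ := (τ j).2
        simp [Matrix.one_apply, Pi.single_apply, this, Subtype.coe_inj, eq_comm]
      rw [h2] at h1
      exact IsUnit.of_mul_eq_one_right _ h1.symm
    exact hu.dvd_mul_right.1 hω
  · intro h r s
    -- The chosen rows of `A` are C * (W * g), so every minor of `A` is det C * det W times a minor
    -- of `g`.
    have : ∀ i, ∃ c : ι → R, ∑ j, c j • (∑ k, W j k • g k) = A (r (σ i)) :=
      fun i => (Submodule.mem_span_range_iff_exists_fun R).1 (h₁ _)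
    choose c hcg using this
    have h1 := AlternatingMap.map_sum_smul_eq_det_mul
        (minorForm (R := R) (s ∘ σ)) (Matrix.of c) (fun j => (∑ k, W j k • g k))
    have h2 : (fun i => ∑ j, Matrix.of c i j • (∑ k, W j k • g k)) = fun i => A ((r ∘ σ) i) :=
      funext hcg
    rw [h2, minorForm_apply, AlternatingMap.map_sum_smul_eq_det_mul,
      ← Matrix.submatrix_submatrix, Matrix.det_submatrix_equiv_self] at h1
    rw [h1]
    exact (h.mul_right _).mul_left _

/-- The determinant of a cyclic presentation matrix: the first row consists of ones, and the other
rows are `b i • x i - a (i + 1) • x (i + 1)`. -/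
theorem det_cyclic (m : ℕ) (a b : ℕ → R) :
    Matrix.det (Matrix.of (Fin.cons (fun _ => 1) fun i : Fin m =>
      Pi.single i.castSucc (b i) - Pi.single i.succ (a (i + 1))) :
        Matrix (Fin (m + 1)) (Fin (m + 1)) R)
      = (-1) ^ m * ∑ i ∈ Finset.range (m + 1),
        (∏ j ∈ Finset.range i, b j) * ∏ j ∈ Finset.Ioc i m, a j := by
  induction m with
  | zero => simp [Matrix.det_unique]
  | succ m ih =>
    -- Only the first and the last entry of the last column are nonzero. Without the last row the
    -- matrix of the previous size remains, without the first row an upper triangular one with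
    -- diagonal `b`.
    rw [Matrix.det_succ_column _ (Fin.last (m + 1)), Fin.sum_univ_succ, Fin.sum_univ_castSucc,
      Finset.sum_eq_zero]
    · have h1 : Matrix.submatrix (Matrix.of (Fin.cons (fun _ => 1) fun i : Fin (m + 1) =>
          Pi.single i.castSucc (b i) - Pi.single i.succ (a (i + 1))) :
            Matrix (Fin (m + 2)) (Fin (m + 2)) R) (Fin.last m).succ.succAbove
              (Fin.last (m + 1)).succAbove
          = Matrix.of (Fin.cons (fun _ => 1) fun i : Fin m =>
            Pi.single i.castSucc (b i) - Pi.single i.succ (a (i + 1))) := by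
        ext i j
        rw [Fin.succ_last, Fin.succAbove_last]
        induction i using Fin.cases with
        | zero => simp
        | succ i =>
          rw [Matrix.submatrix_apply, ← Fin.succ_castSucc]
          simp only [Matrix.of_apply, Fin.cons_succ, Pi.sub_apply,
            Pi.single_apply, Fin.ext_iff, Fin.val_castSucc, Fin.val_succ]
      have h2 : Matrix.det (Matrix.submatrix (Matrix.of (Fin.cons (fun _ => 1)
          fun i : Fin (m + 1) => Pi.single i.castSucc (b i) - Pi.single i.succ (a (i + 1))) :
            Matrix (Fin (m + 2)) (Fin (m + 2)) R) (Fin.succAbove 0)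
              (Fin.last (m + 1)).succAbove) = ∏ j ∈ Finset.range (m + 1), b j := by
        rw [Matrix.det_of_isUpperTriangular, Finset.prod_range]
        · refine Finset.prod_congr rfl fun i _ => ?_
          simp [Fin.ext_iff]
        · intro i j hij
          have hij : (j : ℕ) < i := hij
          simp [Pi.single_apply, Fin.ext_iff, hij.ne]
          omega
      rw [h1, h2, ih, Finset.sum_range_succ _ (m + 1)]
      have h3 : ∀ i ∈ Finset.range (m + 1), (∏ j ∈ Finset.range i, b j) *
          ∏ j ∈ Finset.Ioc i (m + 1), a j
            = ((∏ j ∈ Finset.range i, b j) * ∏ j ∈ Finset.Ioc i m, a j) * a (m + 1) := by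
        intro i hi
        rw [← Finset.insert_Ioc_right_eq_Ioc_add_one (by simp at hi; omega),
          Finset.prod_insert (by simp)]
        ring
      rw [Finset.sum_congr rfl h3, ← Finset.sum_mul]
      simp [Fin.ext_iff]
      ring
    · intro i _
      simp [Pi.single_apply, Fin.ext_iff, i.2.ne']
      omega

end Minors

/-- After clearing negative exponents, a unit and its inverse are polynomials whose product is a
power of the prime X. -/
theorem eqUpToUnit_one_iff (f : ℤ[T;T⁻¹]) : EqUpToUnit f 1 ↔ IsUnit f := by
  constructor
  · rintro ⟨k, rfl | rfl⟩
    · simpa using LaurentPolynomial.isUnit_T k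
    · simpa using LaurentPolynomial.isUnit_T k
  · intro h
    obtain ⟨g, hg⟩ := h.exists_right_inv
    obtain ⟨k, p, hp⟩ := LaurentPolynomial.exists_T_pow f
    obtain ⟨l, r, hr⟩ := LaurentPolynomial.exists_T_pow g
    have h1 : p * r = Polynomial.X ^ (k + l) := by
      apply Polynomial.toLaurent_injective
      rw [map_mul, hp, hr, Polynomial.toLaurent_X_pow, mul_mul_mul_comm, hg, one_mul,
        ← LaurentPolynomial.T_add]
      simp
    obtain ⟨i, -, hi⟩ := (dvd_prime_pow Polynomial.prime_X _).1 (Dvd.intro _ h1)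
    obtain ⟨u, hu⟩ := hi.symm
    obtain ⟨c, hc, hcu⟩ := Polynomial.isUnit_iff.1 u.isUnit
    have hf : f = LaurentPolynomial.C c * LaurentPolynomial.T (i - k) := by
      have : f * LaurentPolynomial.T k * LaurentPolynomial.T (-k)
          = LaurentPolynomial.C c * LaurentPolynomial.T i * LaurentPolynomial.T (-k) := by
        rw [← hp, ← hu, ← hcu, map_mul, Polynomial.toLaurent_X_pow, Polynomial.toLaurent_C,
          mul_comm (LaurentPolynomial.T _)]
      rw [mul_assoc, mul_assoc, ← LaurentPolynomial.T_add, ← LaurentPolynomial.T_add] at this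
      simpa [sub_eq_add_neg] using this
    refine ⟨i - k, ?_⟩
    rcases Int.isUnit_iff.1 hc with rfl | rfl
    · left; simpa using hf
    · right; simpa using hf

/-! ## Twisted bands -/

section Band

open LaurentPolynomial

/-- At the `j`-th crossing of a band, whose upper left and upper right ends are directed downwards
if `l` and `r` hold, the difference of the generators on the right and on the left is multiplied by
`-t ^ twistExp pos l r j`. -/
def twistExp (pos l r : Bool) (j : ℕ) : ℤ :=
  if (if pos then (if Even j then l else r) else !(if Even j then r else l)) then 1 else -1

/-- The difference of the generators on the right and on the left below `j` crossings of a band, as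
a multiple of the difference above the band. -/
noncomputable def twistDiff (pos l r : Bool) : ℕ → ℤ[T;T⁻¹]
  | 0 => 1
  | j + 1 => -T (twistExp pos l r j) * twistDiff pos l r j

/-- The displacement of the generator on the left below `j` crossings of a band, as a multiple of
the difference of the generators above the band. -/
noncomputable def twistLeft (pos l r : Bool) : ℕ → ℤ[T;T⁻¹]
  | 0 => 0
  | j + 1 => if pos then twistLeft pos l r j - twistDiff pos l r (j + 1)
      else twistLeft pos l r j + twistDiff pos l r j

/-- The displacement of the generator on the left between the upper and the lower end of a band
with `|q|` crossings, as a multiple of the difference of the upper generators. -/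
noncomputable def bandLeft (q : ℤ) (l r : Bool) : ℤ[T;T⁻¹] :=
  twistLeft (decide (0 < q)) l r q.natAbs

/-- The displacement of the generator on the right between the upper and the lower end of a band
with `|q|` crossings, as a multiple of the difference of the upper generators. -/
noncomputable def bandRight (q : ℤ) (l r : Bool) : ℤ[T;T⁻¹] :=
  bandLeft q l r + twistDiff (decide (0 < q)) l r q.natAbs - 1

end Band

/-! ### Directions along the strands of a band and across the arcs. -/

section Orientation

variable {n : ℕ} {q : Fin n → ℤ}

/-- Whether the segment `⟨i, j, s⟩` is directed downwards. -/
def isDown (o : (pretzelDiagram q).Orientation) (e : PretzelEdge q) : Bool := o.head e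

theorem isDown_succ (o : (pretzelDiagram q).Orientation) (i : Fin n) (j : Fin (q i).natAbs)
    (s : Bool) : isDown o ⟨i, j.succ, s⟩ = isDown o ⟨i, j.castSucc, !s⟩ := by
  have h1 := o.lower ⟨i, j⟩
  have h2 := o.upper ⟨i, j⟩
  unfold isDown
  by_cases h : 0 < q i <;> cases s <;>
    simp [pretzelDiagram, pretzelCorner, h] at h1 h2 ⊢ <;> grind

theorem isDown_finRotate_zero (o : (pretzelDiagram q).Orientation) (i : Fin n) :
    isDown o ⟨finRotate n i, 0, false⟩ = !isDown o ⟨i, 0, true⟩ := by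
  have h1 := o.joint (i, false)
  unfold isDown
  simp [pretzelDiagram, pretzelTie] at h1 ⊢
  grind

theorem isDown_finRotate_last (o : (pretzelDiagram q).Orientation) (i : Fin n) :
    isDown o ⟨finRotate n i, Fin.last _, false⟩ = !isDown o ⟨i, Fin.last _, true⟩ := by
  have h1 := o.joint (i, true)
  unfold isDown
  simp [pretzelDiagram, pretzelTie] at h1 ⊢
  grind

theorem isDown_eq (o : (pretzelDiagram q).Orientation) (i : Fin n) (j : Fin ((q i).natAbs + 1))
    (s : Bool) : isDown o ⟨i, j, s⟩ = isDown o ⟨i, 0, if Even (j : ℕ) then s else !s⟩ := by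
  induction j using Fin.induction generalizing s with
  | zero => simp
  | succ j ih =>
    rw [isDown_succ, ih]
    by_cases h : Even (j : ℕ) <;> simp [Nat.even_add_one, h]

theorem isDown_last (o : (pretzelDiagram q).Orientation) (i : Fin n) (s : Bool) :
    isDown o ⟨i, Fin.last _, s⟩ = isDown o ⟨i, 0, if Even (q i) then s else !s⟩ := by
  rw [isDown_eq]
  simp

end Orientation

/-! ### Solving the crossing relations of a band. -/

section Coloring

open LaurentPolynomial

variable {n : ℕ} {q : Fin n → ℤ} (o : (pretzelDiagram q).Orientation)
  {Q : Type*} [AddCommGroup Q] [Module ℤ[T;T⁻¹] Q]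

/-- The relations of the Alexander module at the crossings. -/
def CrossingRelations (x : PretzelEdge q → Q) : Prop :=
  ∀ c : (pretzelDiagram q).Crossing,
    x ((pretzelDiagram q).corner c 1).1 - x ((pretzelDiagram q).corner c 3).1 = 0 ∧
    (1 - T 1 : ℤ[T;T⁻¹]) • x ((pretzelDiagram q).corner c 1).1
      + (T 1 : ℤ[T;T⁻¹]) • x (o.left c) - x (o.right c) = 0

variable {o}

theorem T_neg_one_smul_eq {u v : Q} (h : (T 1 : ℤ[T;T⁻¹]) • u = v) :
    u = (T (-1) : ℤ[T;T⁻¹]) • v := by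
  rw [← h, smul_smul, ← T_add]; simp

/-- The overstrand carries the generator from the upper left to the lower right, and the remaining
relation multiplies the difference by -t or -t⁻¹ according to its direction. In `step_neg` the
overstrand runs from the upper right to the lower left. -/
theorem CrossingRelations.step_pos {x : PretzelEdge q → Q} (hx : CrossingRelations o x) {i : Fin n}
    (hi : 0 < q i) (j : Fin (q i).natAbs) :
    x ⟨i, j.succ, true⟩ = x ⟨i, j.castSucc, false⟩ ∧
    x ⟨i, j.succ, true⟩ - x ⟨i, j.succ, false⟩ =
      -(T (if isDown o ⟨i, j.castSucc, false⟩ then 1 else -1) : ℤ[T;T⁻¹]) •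
        (x ⟨i, j.castSucc, true⟩ - x ⟨i, j.castSucc, false⟩) := by
  obtain ⟨h1, h2⟩ := hx ⟨i, j⟩
  rw [← Bool.not_true, ← isDown_succ]
  simp only [LinkDiagram.Orientation.left, LinkDiagram.Orientation.right] at h2
  unfold isDown
  simp [pretzelDiagram, pretzelCorner, hi] at h1 h2 ⊢
  rw [sub_eq_zero] at h1
  refine ⟨h1.symm, ?_⟩
  rw [← h1]
  cases hh : o.head ⟨i, j.succ, true⟩ <;> simp [hh] at h2 ⊢
  · have := T_neg_one_smul_eq (u := x ⟨i, j.castSucc, false⟩ - x ⟨i, j.succ, false⟩)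
      (v := x ⟨i, j.castSucc, false⟩ - x ⟨i, j.castSucc, true⟩) (by
        rw [← sub_eq_zero, ← neg_eq_zero, ← h2]; module)
    rw [this]; module
  · rw [← sub_eq_zero, ← h2]; module

theorem CrossingRelations.step_neg {x : PretzelEdge q → Q} (hx : CrossingRelations o x) {i : Fin n}
    (hi : ¬ 0 < q i) (j : Fin (q i).natAbs) :
    x ⟨i, j.succ, false⟩ = x ⟨i, j.castSucc, true⟩ ∧
    x ⟨i, j.succ, true⟩ - x ⟨i, j.succ, false⟩ =
      -(T (if isDown o ⟨i, j.castSucc, true⟩ then -1 else 1) : ℤ[T;T⁻¹]) •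
        (x ⟨i, j.castSucc, true⟩ - x ⟨i, j.castSucc, false⟩) := by
  obtain ⟨h1, h2⟩ := hx ⟨i, j⟩
  simp only [LinkDiagram.Orientation.left, LinkDiagram.Orientation.right] at h2
  unfold isDown
  have e1 : (1 : Fin 4) + 1 = 2 := rfl
  have e2 : (2 : Fin 4) + 1 = 3 := rfl
  have e3 : (3 : Fin 4) + 1 = 0 := rfl
  simp [pretzelDiagram, pretzelCorner, hi, e1, e2, e3] at h1 h2 ⊢
  rw [sub_eq_zero] at h1
  refine ⟨h1, ?_⟩
  rw [h1] at h2 ⊢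
  cases hh : o.head ⟨i, j.castSucc, true⟩ <;> simp [hh] at h2 ⊢
  · rw [← sub_eq_zero, ← neg_eq_zero, ← h2]; module
  · have := T_neg_one_smul_eq (u := x ⟨i, j.castSucc, true⟩ - x ⟨i, j.succ, true⟩)
      (v := x ⟨i, j.castSucc, true⟩ - x ⟨i, j.castSucc, false⟩) (by
        rw [← sub_eq_zero, ← neg_eq_zero, ← h2]; module)
    rw [← neg_eq_iff_eq_neg, ← this]; module

/-- The generators have values in an arbitrary module `Q`, so that the computation applies in every
quotient of the free module on the segments. -/
theorem CrossingRelations.band {x : PretzelEdge q → Q} (hx : CrossingRelations o x) (i : Fin n)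
    (j : Fin ((q i).natAbs + 1)) :
    x ⟨i, j, false⟩ = x ⟨i, 0, false⟩ +
      twistLeft (decide (0 < q i)) (isDown o ⟨i, 0, false⟩) (isDown o ⟨i, 0, true⟩) j •
        (x ⟨i, 0, true⟩ - x ⟨i, 0, false⟩) ∧
    x ⟨i, j, true⟩ - x ⟨i, j, false⟩ =
      twistDiff (decide (0 < q i)) (isDown o ⟨i, 0, false⟩) (isDown o ⟨i, 0, true⟩) j •
        (x ⟨i, 0, true⟩ - x ⟨i, 0, false⟩) := by
  induction j using Fin.induction with
  | zero => simp [twistLeft, twistDiff]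
  | succ j ih =>
    obtain ⟨ih1, ih2⟩ := ih
    by_cases hi : 0 < q i
    · obtain ⟨h1, h2⟩ := hx.step_pos hi j
      have h3 : x ⟨i, j.succ, true⟩ - x ⟨i, j.succ, false⟩ =
          twistDiff (decide (0 < q i)) (isDown o ⟨i, 0, false⟩) (isDown o ⟨i, 0, true⟩) (j + 1) •
          (x ⟨i, 0, true⟩ - x ⟨i, 0, false⟩) := by
        rw [h2, ih2, isDown_eq, smul_smul, twistDiff, twistExp]
        congr 3
        by_cases hj : Even (j : ℕ) <;> simp [hj, hi]
      refine ⟨?_, h3⟩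
      have h4 : x ⟨i, j.succ, false⟩ = x ⟨i, j.castSucc, false⟩ -
          (x ⟨i, j.succ, true⟩ - x ⟨i, j.succ, false⟩) := by rw [h1]; abel
      rw [h4, h3, ih1, Fin.val_succ, twistLeft, if_pos (by simpa using hi), Fin.val_castSucc]
      module
    · obtain ⟨h1, h2⟩ := hx.step_neg hi j
      have h3 : x ⟨i, j.succ, true⟩ - x ⟨i, j.succ, false⟩ =
          twistDiff (decide (0 < q i)) (isDown o ⟨i, 0, false⟩) (isDown o ⟨i, 0, true⟩) (j + 1) •
          (x ⟨i, 0, true⟩ - x ⟨i, 0, false⟩) := by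
        rw [h2, ih2, isDown_eq, smul_smul, twistDiff, twistExp]
        congr 3
        by_cases hj : Even (j : ℕ)
        · cases hd : isDown o ⟨i, 0, true⟩ <;> simp [hj, hi, hd]
        · cases hd : isDown o ⟨i, 0, false⟩ <;> simp [hj, hi, hd]
      refine ⟨?_, h3⟩
      have h4 : x ⟨i, j.succ, false⟩ = x ⟨i, j.castSucc, false⟩ +
          (x ⟨i, j.castSucc, true⟩ - x ⟨i, j.castSucc, false⟩) := by rw [h1]; abel
      rw [h4, ih2, ih1, Fin.val_succ, twistLeft, if_neg (by simpa using hi), Fin.val_castSucc]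
      module

theorem CrossingRelations.last_false {x : PretzelEdge q → Q} (hx : CrossingRelations o x)
    (i : Fin n) : x ⟨i, Fin.last _, false⟩ = x ⟨i, 0, false⟩ +
      bandLeft (q i) (isDown o ⟨i, 0, false⟩) (isDown o ⟨i, 0, true⟩) •
        (x ⟨i, 0, true⟩ - x ⟨i, 0, false⟩) :=
  (hx.band i (Fin.last _)).1

theorem CrossingRelations.last_true {x : PretzelEdge q → Q} (hx : CrossingRelations o x)
    (i : Fin n) : x ⟨i, Fin.last _, true⟩ = x ⟨i, 0, true⟩ +
      bandRight (q i) (isDown o ⟨i, 0, false⟩) (isDown o ⟨i, 0, true⟩) •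
        (x ⟨i, 0, true⟩ - x ⟨i, 0, false⟩) := by
  have h := (hx.band i (Fin.last _)).2
  have h' := hx.last_false i
  rw [sub_eq_iff_eq_add, h'] at h
  rw [h, bandRight, Fin.val_last]
  module

end Coloring

/-! ## A square presentation matrix of the Alexander module -/

/-- The square matrix with a first row of ones and further rows
`b i • x i - a (i + 1) • x (i + 1)`. -/
def cyclicMatrix {R : Type*} [CommRing R] (m : ℕ) (a b : ℕ → R) :
    Matrix (Fin (m + 1)) (Fin (m + 1)) R :=
  Matrix.of (Fin.cons (fun _ => 1) fun i : Fin m =>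
      Pi.single i.castSucc (b i) - Pi.single i.succ (a (i + 1)))

theorem cyclicMatrix_sum_zero {R Q : Type*} [CommRing R] [AddCommGroup Q] [Module R Q] {m : ℕ}
    (a b : ℕ → R) (δ : Fin (m + 1) → Q) : ∑ j, cyclicMatrix m a b 0 j • δ j = ∑ j, δ j := by
  simp [cyclicMatrix]

theorem cyclicMatrix_sum_succ {R Q : Type*} [CommRing R] [AddCommGroup Q] [Module R Q] {m : ℕ}
    (a b : ℕ → R) (δ : Fin (m + 1) → Q) (i : Fin m) :
    ∑ j, cyclicMatrix m a b i.succ j • δ j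
      = b i • δ i.castSucc - a (i + 1) • δ i.succ := by
  simp [cyclicMatrix, sub_smul, Finset.sum_sub_distrib, Pi.single_apply, ite_smul]

theorem finRotate_castSucc {m : ℕ} (i : Fin m) : finRotate (m + 1) i.castSucc = i.succ := by
  exact finRotate_of_lt i.2

namespace LinkDiagram.Orientation

variable {D : LinkDiagram} (o : D.Orientation) [DecidableEq D.Edge]

theorem alexanderMatrix_upper (c : D.Crossing) : o.alexanderMatrix (Sum.inl c) =
    Pi.single (D.corner c 1).1 1 - Pi.single (D.corner c 3).1 1 := by
  ext e
  rw [alexanderMatrix, Matrix.of_apply, Sum.elim_inl]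
  congr!

theorem alexanderMatrix_lower (c : D.Crossing) : o.alexanderMatrix (Sum.inr (Sum.inl c)) =
    Pi.single (D.corner c 1).1 (1 - LaurentPolynomial.T 1)
      + Pi.single (o.left c) (LaurentPolynomial.T 1) - Pi.single (o.right c) 1 := by
  ext e
  rw [alexanderMatrix, Matrix.of_apply, Sum.elim_inr, Sum.elim_inl]
  congr!

theorem alexanderMatrix_joint (j : D.Joint) : o.alexanderMatrix (Sum.inr (Sum.inr j)) =
    Pi.single (D.tie j false).1 1 - Pi.single (D.tie j true).1 1 := by
  ext e
  rw [alexanderMatrix, Matrix.of_apply, Sum.elim_inr, Sum.elim_inr]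
  congr!

end LinkDiagram.Orientation

section Presentation

open LaurentPolynomial

variable {m : ℕ} {q : Fin (m + 1) → ℤ} (o : (pretzelDiagram q).Orientation)

/-- The relations at the joints between the upper ends of consecutive bands, apart from the joint
between the last and the first band. -/
def UpperRelations {Q : Type*} [AddCommGroup Q] (x : PretzelEdge q → Q) : Prop :=
  ∀ i : Fin m, x ⟨i.castSucc, 0, true⟩ - x ⟨i.succ, 0, false⟩ = 0

theorem UpperRelations.sum_eq {Q : Type*} [AddCommGroup Q] {x : PretzelEdge q → Q}
    (hx : UpperRelations x) : ∑ i, (x ⟨i, 0, true⟩ - x ⟨i, 0, false⟩)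
      = x ⟨Fin.last m, 0, true⟩ - x ⟨0, 0, false⟩ := by
  rw [Finset.sum_sub_distrib, Fin.sum_univ_castSucc, Fin.sum_univ_succ (fun i => x ⟨i, 0, false⟩),
    Finset.sum_congr rfl fun i _ => sub_eq_zero.1 (hx i)]
  abel

theorem UpperRelations.eq_zero {Q : Type*} [AddCommGroup Q] {x : PretzelEdge q → Q}
    (hx : UpperRelations x) (hδ : ∀ i, x ⟨i, 0, true⟩ - x ⟨i, 0, false⟩ = 0) (i : Fin (m + 1)) :
    x ⟨i, 0, false⟩ = x ⟨0, 0, false⟩ := by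
  induction i using Fin.induction with
  | zero => rfl
  | succ i ih => rw [← sub_eq_zero.1 (hx i), sub_eq_zero.1 (hδ _), ih]

variable {o}

/-- The common upper generator cancels, and only the displacements along the two bands remain. -/
theorem joint_relation_iff {Q : Type*} [AddCommGroup Q] [Module ℤ[T;T⁻¹] Q]
    {x : PretzelEdge q → Q} (hx : CrossingRelations o x) {i i' : Fin (m + 1)}
    (h : x ⟨i, 0, true⟩ - x ⟨i', 0, false⟩ = 0) :
    x ⟨i, Fin.last _, true⟩ - x ⟨i', Fin.last _, false⟩ =
      bandRight (q i) (isDown o ⟨i, 0, false⟩) (isDown o ⟨i, 0, true⟩) •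
        (x ⟨i, 0, true⟩ - x ⟨i, 0, false⟩) -
      bandLeft (q i') (isDown o ⟨i', 0, false⟩) (isDown o ⟨i', 0, true⟩) •
        (x ⟨i', 0, true⟩ - x ⟨i', 0, false⟩) := by
  rw [hx.last_true, hx.last_false, sub_eq_zero.1 h]
  abel

variable (o)

/-- The rows of the Alexander matrix of a pretzel diagram. -/
noncomputable def pretzelRow : ((i : Fin (m + 1)) × Fin (q i).natAbs) ⊕
    ((i : Fin (m + 1)) × Fin (q i).natAbs) ⊕ (Fin (m + 1) × Bool) →
      PretzelEdge q → ℤ[T;T⁻¹] :=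
  o.alexanderMatrix

/-- The index set of the square presentation matrix. -/
abbrev PresentationIndex (q : Fin (m + 1) → ℤ) : Type := ((i : Fin (m + 1)) × Fin (q i).natAbs) ⊕
    ((i : Fin (m + 1)) × Fin (q i).natAbs) ⊕ Fin m ⊕ Fin (m + 1)

/-- The generators of the space of relations: the relations at the crossings and at most of the
upper joints, and the differences of the two upper ends of each band. -/
noncomputable def presentationBasis : PresentationIndex q → PretzelEdge q → ℤ[T;T⁻¹]
  | .inl c => pretzelRow o (.inl c)
  | .inr (.inl c) => pretzelRow o (.inr (.inl c))
  | .inr (.inr (.inl i)) => pretzelRow o (.inr (.inr (i.castSucc, false)))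
  | .inr (.inr (.inr i)) => Pi.single ⟨i, 0, true⟩ 1 - Pi.single ⟨i, 0, false⟩ 1

/-- The presentation matrix with respect to `presentationBasis`. -/
noncomputable def presentationMatrix (q : Fin (m + 1) → ℤ) (a b : ℕ → ℤ[T;T⁻¹]) :
    Matrix (PresentationIndex q) (PresentationIndex q) ℤ[T;T⁻¹] :=
  Matrix.fromBlocks 1 0 0 (Matrix.fromBlocks 1 0 0 (Matrix.fromBlocks 1 0 0 (cyclicMatrix m a b)))

/-- The relations given by the rows of `presentationMatrix`. -/
noncomputable def presentationRow (a b : ℕ → ℤ[T;T⁻¹]) :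
    PresentationIndex q → PretzelEdge q → ℤ[T;T⁻¹]
  | .inl c => pretzelRow o (.inl c)
  | .inr (.inl c) => pretzelRow o (.inr (.inl c))
  | .inr (.inr (.inl i)) => pretzelRow o (.inr (.inr (i.castSucc, false)))
  | .inr (.inr (.inr i)) => ∑ j, cyclicMatrix m a b i j •
      (Pi.single ⟨j, 0, true⟩ 1 - Pi.single ⟨j, 0, false⟩ 1)

/-- With C crossings there are 2C + 2(m + 1) segments and 2C + m + (m + 1) indices, so the
presentation matrix has exactly the size of the minors. -/
theorem card_presentationIndex :
    Fintype.card (PresentationIndex q) = Fintype.card (PretzelEdge q) - 1 := by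
  simp [Fintype.card_sigma, Finset.sum_add_distrib, add_mul, ← Finset.sum_mul]
  omega

theorem det_presentationMatrix (a b : ℕ → ℤ[T;T⁻¹]) :
    (presentationMatrix q a b).det = (cyclicMatrix m a b).det := by
  simp [presentationMatrix]

theorem presentationMatrix_sum (a b : ℕ → ℤ[T;T⁻¹]) (i) :
    ∑ j, presentationMatrix q a b i j • presentationBasis o j = presentationRow o a b i := by
  rcases i with c | c | i | i <;>
    simp [Fintype.sum_sum_type, presentationMatrix, presentationBasis, presentationRow,
      Matrix.one_apply, ite_smul]

section Relations

variable {Q : Type*} [AddCommGroup Q] [Module ℤ[T;T⁻¹] Q]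
  (φ : (PretzelEdge q → ℤ[T;T⁻¹]) →ₗ[ℤ[T;T⁻¹]] Q)

theorem map_single_eq_smul (e : PretzelEdge q) (c : ℤ[T;T⁻¹]) :
    φ (Pi.single e c) = c • φ (Pi.single e 1) := by
  rw [← map_smul, ← Pi.single_smul, smul_eq_mul, mul_one]

theorem map_pretzelRow_upper (c : (i : Fin (m + 1)) × Fin (q i).natAbs) :
    φ (pretzelRow o (Sum.inl c)) = φ (Pi.single ((pretzelDiagram q).corner c 1).1 1)
      - φ (Pi.single ((pretzelDiagram q).corner c 3).1 1) := by
  rw [← map_sub]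
  congr 1
  exact @LinkDiagram.Orientation.alexanderMatrix_upper _ o
    (inferInstanceAs (DecidableEq (PretzelEdge q))) c

theorem map_pretzelRow_lower (c : (i : Fin (m + 1)) × Fin (q i).natAbs) :
    φ (pretzelRow o (Sum.inr (Sum.inl c))) =
      (1 - T 1 : ℤ[T;T⁻¹]) • φ (Pi.single ((pretzelDiagram q).corner c 1).1 1)
      + (T 1 : ℤ[T;T⁻¹]) • φ (Pi.single (o.left c) 1) - φ (Pi.single (o.right c) 1) := by
  have h1 := map_single_eq_smul φ ((pretzelDiagram q).corner c 1).1 (1 - T 1)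
  have h2 := map_single_eq_smul φ (o.left c) (T 1)
  rw [← h1, ← h2, ← map_add, ← map_sub]
  congr 1
  exact @LinkDiagram.Orientation.alexanderMatrix_lower _ o
    (inferInstanceAs (DecidableEq (PretzelEdge q))) c

theorem map_pretzelRow_joint (i : Fin (m + 1)) (b : Bool) :
    φ (pretzelRow o (Sum.inr (Sum.inr (i, b)))) =
      φ (Pi.single ⟨i, if b then Fin.last _ else 0, true⟩ 1) -
      φ (Pi.single ⟨finRotate _ i, if b then Fin.last _ else 0, false⟩ 1) := by
  rw [← map_sub]
  congr 1
  exact @LinkDiagram.Orientation.alexanderMatrix_joint _ o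
    (inferInstanceAs (DecidableEq (PretzelEdge q))) (i, b)

theorem crossingRelations_iff : CrossingRelations o (fun e => φ (Pi.single e 1)) ↔
    (∀ c, φ (pretzelRow o (Sum.inl c)) = 0) ∧ ∀ c, φ (pretzelRow o (Sum.inr (Sum.inl c))) = 0 := by
  rw [← forall_and]
  refine forall_congr' fun c => ?_
  exact and_congr (iff_of_eq (congrArg (· = 0) (map_pretzelRow_upper o φ c).symm))
    (iff_of_eq (congrArg (· = 0) (map_pretzelRow_lower o φ c).symm))

theorem upperRelations_iff : UpperRelations (fun e => φ (Pi.single e 1)) ↔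
    ∀ i : Fin m, φ (pretzelRow o (Sum.inr (Sum.inr (i.castSucc, false)))) = 0 := by
  refine forall_congr' fun i => ?_
  rw [map_pretzelRow_joint, finRotate_castSucc]
  rfl

variable {o φ}

/-- Two joints have no row of their own. The upper joint from the last band to the first is
recovered from the row of ones, because Σ δ_i telescopes along the other upper joints; the lower one
is supplied by `hred`. -/
theorem map_pretzelRow_eq_zero {a b : ℕ → ℤ[T;T⁻¹]}
    (ha : ∀ i : Fin (m + 1), a i
      = bandLeft (q i) (isDown o ⟨i, 0, false⟩) (isDown o ⟨i, 0, true⟩))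
    (hb : ∀ i : Fin (m + 1), b i
      = bandRight (q i) (isDown o ⟨i, 0, false⟩) (isDown o ⟨i, 0, true⟩))
    (hred : ∀ (δ : Fin (m + 1) → Q),
      (∀ i : Fin m, b i • δ i.castSucc = a (i + 1) • δ i.succ) → ∑ i, δ i = 0 →
        b m • δ (Fin.last m) = a 0 • δ 0)
    (h : ∀ i, φ (presentationRow o a b i) = 0) (r) : φ (pretzelRow o r) = 0 := by
  have hC : CrossingRelations o (fun e => φ (Pi.single e 1)) :=
    (crossingRelations_iff o φ).2 ⟨fun c => h (Sum.inl c), fun c => h (Sum.inr (Sum.inl c))⟩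
  have hU : UpperRelations (fun e => φ (Pi.single e 1)) :=
    (upperRelations_iff o φ).2 fun i => h (Sum.inr (Sum.inr (Sum.inl i)))
  have h0 := h (Sum.inr (Sum.inr (Sum.inr 0)))
  have hs := fun i : Fin m => h (Sum.inr (Sum.inr (Sum.inr i.succ)))
  simp only [presentationRow, cyclicMatrix_sum_zero, cyclicMatrix_sum_succ, map_sum, map_sub,
    map_smul] at h0 hs
  have hlast := hred (fun i => φ (Pi.single ⟨i, 0, true⟩ 1) - φ (Pi.single ⟨i, 0, false⟩ 1))
    (fun i => sub_eq_zero.1 (hs i)) h0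
  rw [hU.sum_eq] at h0
  have hU' : ∀ i, φ (Pi.single ⟨i, 0, true⟩ 1) -
      φ (Pi.single ⟨finRotate _ i, 0, false⟩ 1) = 0 := by
    intro i
    induction i using Fin.lastCases with
    | last => rw [finRotate_last]; exact h0
    | cast i => rw [finRotate_castSucc]; exact hU i
  rcases r with c | c | ⟨i, _ | _⟩
  · exact ((crossingRelations_iff o φ).1 hC).1 c
  · exact ((crossingRelations_iff o φ).1 hC).2 c
  · rw [map_pretzelRow_joint]
    exact hU' i
  · rw [map_pretzelRow_joint]
    refine (joint_relation_iff hC (hU' i)).trans ?_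
    rw [← ha, ← hb, sub_eq_zero]
    induction i using Fin.lastCases with
    | last => rw [finRotate_last]; exact hlast
    | cast i => rw [finRotate_castSucc]; exact sub_eq_zero.1 (hs i)

theorem map_presentationRow_eq_zero {a b : ℕ → ℤ[T;T⁻¹]}
    (ha : ∀ i : Fin (m + 1), a i
      = bandLeft (q i) (isDown o ⟨i, 0, false⟩) (isDown o ⟨i, 0, true⟩))
    (hb : ∀ i : Fin (m + 1), b i
      = bandRight (q i) (isDown o ⟨i, 0, false⟩) (isDown o ⟨i, 0, true⟩))
    (h : ∀ r, φ (pretzelRow o r) = 0) (i) : φ (presentationRow o a b i) = 0 := by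
  have hC : CrossingRelations o (fun e => φ (Pi.single e 1)) :=
    (crossingRelations_iff o φ).2 ⟨fun c => h _, fun c => h _⟩
  have hU : UpperRelations (fun e => φ (Pi.single e 1)) := (upperRelations_iff o φ).2 fun i => h _
  rcases i with c | c | i | i
  · exact h _
  · exact h _
  · exact h _
  · induction i using Fin.cases with
    | zero =>
      simp only [presentationRow, cyclicMatrix_sum_zero, map_sum, map_sub]
      rw [hU.sum_eq]
      have := h (Sum.inr (Sum.inr (Fin.last m, false)))
      rwa [map_pretzelRow_joint, finRotate_last] at this
    | succ i =>
      simp only [presentationRow, cyclicMatrix_sum_succ, map_sub, map_smul]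
      have := h (Sum.inr (Sum.inr (i.castSucc, true)))
      rw [map_pretzelRow_joint, finRotate_castSucc] at this
      have h2 := joint_relation_iff hC (hU i)
      rw [← ha, ← hb] at h2
      exact h2.symm.trans this

/-- If all δ_i vanish, so do all displacements, and every segment has the generator of the first
upper left end. -/
theorem map_single_sub_single_eq_zero (h : ∀ i, φ (presentationBasis o i) = 0)
    (e : PretzelEdge q) : φ (Pi.single e 1 - Pi.single ⟨0, 0, false⟩ 1) = 0 := by
  have hC : CrossingRelations o (fun e => φ (Pi.single e 1)) :=
    (crossingRelations_iff o φ).2 ⟨fun c => h (Sum.inl c), fun c => h (Sum.inr (Sum.inl c))⟩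
  have hU : UpperRelations (fun e => φ (Pi.single e 1)) :=
    (upperRelations_iff o φ).2 fun i => h (Sum.inr (Sum.inr (Sum.inl i)))
  have hδ : ∀ i, φ (Pi.single ⟨i, 0, true⟩ 1) - φ (Pi.single ⟨i, 0, false⟩ 1) = 0 := by
    intro i
    have := h (Sum.inr (Sum.inr (Sum.inr i)))
    simpa only [presentationBasis, map_sub] using this
  obtain ⟨i, j, s⟩ := e
  rw [map_sub, sub_eq_zero]
  refine Eq.trans ?_ (hU.eq_zero hδ i)
  obtain ⟨h1, h2⟩ := hC.band i j
  simp only [hδ, smul_zero, add_zero, sub_eq_zero] at h1 h2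
  cases s
  · exact h1
  · exact h2.trans h1

end Relations

/-- The quotient map by the span is the universal test. Comparing row spans thus becomes deducing
relations from each other in an arbitrary module. -/
theorem mem_span_of_forall_linearMap {R F : Type} [Ring R] [AddCommGroup F] [Module R F]
    {S : Set F} {v : F} (h : ∀ (Q : Type) [AddCommGroup Q] [Module R Q] (φ : F →ₗ[R] Q),
      (∀ s ∈ S, φ s = 0) → φ v = 0) : v ∈ Submodule.span R S :=
  (Submodule.Quotient.mk_eq_zero _).1 (h _ (Submodule.span R S).mkQ fun _ hs =>
    (Submodule.Quotient.mk_eq_zero _).2 (Submodule.subset_span hs))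

/-- If the relation at the last lower joint follows from the other ones, then the Alexander
polynomial is the determinant of the cyclic presentation matrix. -/
theorem associated_alexanderPolynomial (a b : ℕ → ℤ[T;T⁻¹])
    (ha : ∀ i : Fin (m + 1), a i
      = bandLeft (q i) (isDown o ⟨i, 0, false⟩) (isDown o ⟨i, 0, true⟩))
    (hb : ∀ i : Fin (m + 1), b i
      = bandRight (q i) (isDown o ⟨i, 0, false⟩) (isDown o ⟨i, 0, true⟩))
    (hred : ∀ (Q : Type) [AddCommGroup Q] [Module ℤ[T;T⁻¹] Q] (δ : Fin (m + 1) → Q),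
      (∀ i : Fin m, b i • δ i.castSucc = a (i + 1) • δ i.succ) → ∑ i, δ i = 0 →
        b m • δ (Fin.last m) = a 0 • δ 0) :
    Associated o.alexanderPolynomial (∑ i ∈ Finset.range (m + 1),
        (∏ j ∈ Finset.range i, b j) * ∏ j ∈ Finset.Ioc i m, a j) := by
  have key : ∀ d, d ∣ o.alexanderPolynomial ↔ d ∣ (cyclicMatrix m a b).det := by
    intro d
    refine (o.exists_isAlexanderPolynomial.choose_spec d).trans ?_
    rw [← det_presentationMatrix (q := q)]
    refine dvd_minors_iff_dvd_det (E := PretzelEdge q) (pretzelRow o) ⟨0, 0, false⟩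
      card_presentationIndex (presentationBasis o) _ (fun r => ?_) (fun i => ?_) (fun e => ?_) d
    · refine mem_span_of_forall_linearMap fun Q _ _ φ h => ?_
      simp only [presentationMatrix_sum, Set.forall_mem_range] at h
      exact map_pretzelRow_eq_zero ha hb (hred Q) h r
    · rw [presentationMatrix_sum]
      refine mem_span_of_forall_linearMap fun Q _ _ φ h => ?_
      exact map_presentationRow_eq_zero ha hb (Set.forall_mem_range.1 h) i
    · refine mem_span_of_forall_linearMap fun Q _ _ φ h => ?_
      exact map_single_sub_single_eq_zero (Set.forall_mem_range.1 h) e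
  have h2 : Associated o.alexanderPolynomial (cyclicMatrix m a b).det :=
    associated_of_dvd_dvd ((key _).1 dvd_rfl) ((key _).2 dvd_rfl)
  rw [cyclicMatrix, det_cyclic] at h2
  exact h2.trans (associated_unit_mul_left _ _ ((isUnit_one.neg).pow m))

end Presentation

/-! ## The coefficients of a band -/

section BandFormulas

open LaurentPolynomial

/-- The exponent `1` for the downward and `-1` for the upward direction. -/
def dirExp (b : Bool) : ℤ := if b then 1 else -1

theorem twistExp_antiparallel (pos l : Bool) (j : ℕ) :
    twistExp pos l (!l) j = if Even j then dirExp l else -dirExp l := by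
  by_cases h : Even j <;> cases pos <;> cases l <;> simp [twistExp, dirExp, h]

/-- The exponents at consecutive crossings are opposite, so the factors cancel in pairs. -/
theorem twistDiff_antiparallel (pos l : Bool) (k : ℕ) :
    twistDiff pos l (!l) (2 * k) = 1 ∧ twistDiff pos l (!l) (2 * k + 1) = -T (dirExp l) := by
  have h : ∀ k, twistDiff pos l (!l) (2 * k) = 1 →
      twistDiff pos l (!l) (2 * k + 1) = -T (dirExp l) := fun k hk => by
    rw [twistDiff, hk, twistExp_antiparallel, if_pos (even_two_mul k), mul_one]
  have h2 : twistDiff pos l (!l) (2 * k) = 1 := by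
    induction k with
    | zero => rfl
    | succ k ih =>
      rw [mul_add, twistDiff, h k ih, twistExp_antiparallel, if_neg (by simp), neg_mul_neg,
        ← T_add, neg_add_cancel, T_zero]
  exact ⟨h2, h k h2⟩

theorem twistLeft_antiparallel (pos l : Bool) (k : ℕ) :
    twistLeft pos l (!l) (2 * k) = (if pos then (k : ℤ[T;T⁻¹]) else -k) * (T (dirExp l) - 1) := by
  induction k with
  | zero => simp [twistLeft]
  | succ k ih =>
    have h := (twistDiff_antiparallel pos l (k + 1)).1
    rw [mul_add, mul_one] at h ⊢
    rw [twistLeft, twistLeft, ih, h, (twistDiff_antiparallel pos l k).1,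
      (twistDiff_antiparallel pos l k).2]
    cases pos <;> push_cast <;> simp <;> ring

theorem bandLeft_antiparallel_even (h : ℤ) (l : Bool) :
    bandLeft (2 * h) l (!l) = h * (T (dirExp l) - 1 : ℤ[T;T⁻¹]) := by
  have h2 : (2 * h).natAbs = 2 * h.natAbs := by omega
  rw [bandLeft, h2, twistLeft_antiparallel, ← Int.cast_natCast, Int.natCast_natAbs]
  rcases lt_or_ge 0 h with h0 | h0
  · simp [h0, abs_of_pos h0]
  · simp [h0.not_gt, abs_of_nonpos h0]

theorem bandRight_antiparallel_even (h : ℤ) (l : Bool) :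
    bandRight (2 * h) l (!l) = h * (T (dirExp l) - 1 : ℤ[T;T⁻¹]) := by
  have h2 : (2 * h).natAbs = 2 * h.natAbs := by omega
  rw [bandRight, bandLeft_antiparallel_even, h2, (twistDiff_antiparallel _ l _).1]
  ring

theorem natAbs_two_mul_add_one (k : ℤ) : ∃ j : ℕ, (2 * k + 1).natAbs = 2 * j + 1 ∧
    (0 < 2 * k + 1 ∧ k = j ∨ ¬ 0 < 2 * k + 1 ∧ k = -j - 1) := by
  rcases lt_or_ge 0 (2 * k + 1) with h | h
  · exact ⟨k.natAbs, by omega, by omega⟩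
  · exact ⟨(-k - 1).natAbs, by omega, by omega⟩

theorem bandLeft_antiparallel_odd (k : ℤ) (l : Bool) :
    bandLeft (2 * k + 1) l (!l) = (k : ℤ[T;T⁻¹]) * (T (dirExp l) - 1) + T (dirExp l) := by
  obtain ⟨j, hj, ⟨h, hk⟩ | ⟨h, hk⟩⟩ := natAbs_two_mul_add_one k
  · rw [bandLeft, hj, twistLeft, twistLeft_antiparallel, (twistDiff_antiparallel _ l _).2]
    simp only [h, decide_true, if_true]
    rw [hk]
    push_cast
    ring
  · rw [bandLeft, hj, twistLeft, twistLeft_antiparallel, (twistDiff_antiparallel _ l _).1]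
    simp only [h, decide_false, if_false, Bool.false_eq_true]
    rw [hk]
    push_cast
    ring

/-- The difference to `bandLeft_antiparallel_odd` is `T (dirExp l) + 1`, independent of `k`; this is
what makes the odd case telescope. -/
theorem bandRight_antiparallel_odd (k : ℤ) (l : Bool) :
    bandRight (2 * k + 1) l (!l) = k * (T (dirExp l) - 1 : ℤ[T;T⁻¹]) - 1 := by
  obtain ⟨j, hj, -⟩ := natAbs_two_mul_add_one k
  rw [bandRight, bandLeft_antiparallel_odd, hj, (twistDiff_antiparallel _ l _).2]
  ring

/-- The variable `s = -t` that is natural for bands with parallel strands. -/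
noncomputable def negT : ℤ[T;T⁻¹] := -T 1

/-- The inverse of `s = -t`. -/
noncomputable def negTInv : ℤ[T;T⁻¹] := -T (-1)

theorem negT_mul_negTInv : negT * negTInv = 1 := by
  rw [negT, negTInv, neg_mul_neg, ← T_add, add_neg_cancel, T_zero]

theorem isUnit_negT : IsUnit negT := IsUnit.of_mul_eq_one _ negT_mul_negTInv

theorem isUnit_negTInv : IsUnit negTInv := IsUnit.of_mul_eq_one_right _ negT_mul_negTInv

/-- The factor `s` or `1` that depends on the direction of a strand. -/
noncomputable def dirFactor (b : Bool) : ℤ[T;T⁻¹] := if b then negT else 1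

theorem isUnit_dirFactor (b : Bool) : IsUnit (dirFactor b) := by
  cases b
  · exact isUnit_one
  · exact isUnit_negT

/-- Up to sign and powers of `s`, the `q`-analogue `1 + s + ... + s ^ (|q| - 1)`. -/
noncomputable def bandTheta (q : ℤ) (b : Bool) : ℤ[T;T⁻¹] :=
  q.sign * (if b = decide (0 < q) then 1 else negTInv ^ q.natAbs) *
    ∑ k ∈ Finset.range q.natAbs, negT ^ k

theorem bandTheta_zero (b : Bool) : bandTheta 0 b = 0 := by simp [bandTheta]

theorem bandTheta_mul (q : ℤ) (b : Bool) : bandTheta q b * (negT - 1) =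
    q.sign * (if b = decide (0 < q) then 1 else negTInv ^ q.natAbs) * (negT ^ q.natAbs - 1) := by
  rw [bandTheta, mul_assoc, geom_sum_mul]

theorem twistDiff_parallel (pos b : Bool) (j : ℕ) :
    twistDiff pos b b j = (if b = pos then negT else negTInv) ^ j := by
  induction j with
  | zero => rfl
  | succ j ih =>
    rw [twistDiff, ih, pow_succ, mul_comm]
    congr 1
    cases pos <;> cases b <;> simp [twistExp, negT, negTInv]

theorem negT_sub_one_ne_zero : negT - 1 ≠ 0 := by
  intro h
  have := congrArg (fun f : ℤ[T;T⁻¹] => f.coeff 1) h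
  simp [negT, ← T_zero] at this

theorem twistLeft_parallel (pos b : Bool) (j : ℕ) :
    twistLeft pos b b j * (negT - 1) =
      (if b then 1 else -1) * dirFactor b *
        (1 - (if b = pos then negT else negTInv) ^ j) := by
  induction j with
  | zero => simp [twistLeft]
  | succ j ih =>
    have h := negT_mul_negTInv
    rw [twistLeft]
    cases pos <;> cases b <;>
      simp only [twistDiff_parallel, if_true, if_false, sub_mul, add_mul, ih, dirFactor,
        Bool.false_eq_true, reduceCtorEq, pow_succ]
    · ring
    · linear_combination (negTInv ^ j) * h
    · linear_combination (-negTInv ^ j) * h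
    · ring

theorem bandLeft_parallel (q : ℤ) (b : Bool) :
    bandLeft q b b = -dirFactor b * bandTheta q b := by
  refine mul_right_cancel₀ negT_sub_one_ne_zero ?_
  rw [bandLeft, twistLeft_parallel, mul_assoc (-dirFactor b), bandTheta_mul]
  have h : negTInv ^ q.natAbs * negT ^ q.natAbs = 1 := by
    rw [← mul_pow, mul_comm, negT_mul_negTInv, one_pow]
  rcases lt_trichotomy 0 q with h0 | h0 | h0
  · rw [Int.sign_eq_one_of_pos h0]
    cases b <;> simp only [h0, decide_true, if_true, if_false, Bool.false_eq_true] <;>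
      push_cast
    · linear_combination dirFactor false * h
    · ring
  · subst h0; simp
  · rw [Int.sign_eq_neg_one_of_neg h0]
    cases b <;> simp only [h0.not_gt, decide_false, if_true, if_false, reduceCtorEq,
      Bool.false_eq_true] <;> push_cast
    · ring
    · linear_combination -dirFactor true * h

/-- The right end carries the factor of the direction opposite to `b`. Since an upper arc reverses
the direction, this is the factor at the left end of the next parallel band, and the two sides of a
lower joint relation share a unit. -/
theorem bandRight_parallel (q : ℤ) (b : Bool) :
    bandRight q b b = -dirFactor (!b) * bandTheta q b := by
  refine mul_right_cancel₀ negT_sub_one_ne_zero ?_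
  have h1 := bandTheta_mul q b
  rw [bandRight, bandLeft_parallel, twistDiff_parallel]
  have h : negTInv ^ q.natAbs * negT ^ q.natAbs = 1 := by
    rw [← mul_pow, mul_comm, negT_mul_negTInv, one_pow]
  suffices h2 : (if b = decide (0 < q) then negT else negTInv) ^ q.natAbs - 1 =
      (if b then 1 else -1) * (bandTheta q b * (negT - 1)) by
    cases b <;> simp only [dirFactor, if_true, if_false, Bool.false_eq_true, Bool.not_true,
      Bool.not_false] at h2 ⊢
    · linear_combination (negT - 1) * h2
    · linear_combination (negT - 1) * h2
  rw [h1]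
  rcases lt_trichotomy 0 q with h0 | h0 | h0
  · rw [Int.sign_eq_one_of_pos h0]
    cases b <;> simp only [h0, decide_true, if_true, if_false, Bool.false_eq_true] <;>
      push_cast
    · linear_combination h
    · ring
  · subst h0; simp
  · rw [Int.sign_eq_neg_one_of_neg h0]
    cases b <;> simp only [h0.not_gt, decide_false, if_true, if_false, reduceCtorEq,
      Bool.false_eq_true] <;> push_cast
    · ring
    · linear_combination h

end BandFormulas

/-! ## Directions of the strands -/

section Directions

/-- The rotation is a single cycle: go from `i₀` up to the last index, on to 0, and up again. -/
theorem forall_of_finRotate {n : ℕ} {P : Fin n → Prop} (h : ∀ i, P i → P (finRotate n i))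
    {i₀ : Fin n} (h₀ : P i₀) (i : Fin n) : P i := by
  obtain _ | m := n
  · exact i.elim0
  have up : ∀ k (hk : k < m + 1) (d : ℕ) (hd : k + d < m + 1), P ⟨k, hk⟩ → P ⟨k + d, hd⟩ := by
    intro k hk d
    induction d with
    | zero => exact fun _ h => h
    | succ d ih =>
      intro hd hP
      have := h _ (ih (by omega) hP)
      rwa [finRotate_of_lt (by omega)] at this
  have hlast : P (Fin.last m) := by
    have := up i₀ i₀.2 (m - i₀) (by omega) h₀
    convert this using 1
    ext
    simp
    omega
  have hzero : P 0 := by simpa using h _ hlast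
  have := up 0 (by omega) i (by omega) hzero
  simpa using this

theorem dirExp_not (b : Bool) : dirExp (!b) = -dirExp b := by cases b <;> rfl

theorem odd_dirExp (b : Bool) : Odd (dirExp b) := by cases b <;> decide

theorem even_card_of_sum_dirExp_eq_zero {ι : Type*} {s : Finset ι} {b : ι → Bool}
    (h : ∑ i ∈ s, dirExp (b i) = 0) : Even s.card := by
  have h2 : (∑ i ∈ s, dirExp (b i)) % 2 = (∑ i ∈ s, 1 : ℤ) % 2 := by
    rw [Finset.sum_int_mod, Finset.sum_int_mod s 2 (fun _ => 1)]
    congr 1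
    refine Finset.sum_congr rfl fun i _ => ?_
    exact Int.odd_iff.1 (odd_dirExp _)
  rw [h] at h2
  rw [← Int.even_coe_nat, Int.even_iff]
  simpa using h2.symm

variable {n : ℕ} {q : Fin n → ℤ} (o : (pretzelDiagram q).Orientation)

/-- The direction of the upper left end of the band. -/
def leftDir (i : Fin n) : Bool := isDown o ⟨i, 0, false⟩

/-- The direction of the upper right end of the band. -/
def rightDir (i : Fin n) : Bool := isDown o ⟨i, 0, true⟩

theorem leftDir_finRotate (i : Fin n) : leftDir o (finRotate n i) = !rightDir o i :=
  isDown_finRotate_zero o i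

theorem lower_finRotate (i : Fin n) :
    (if Even (q (finRotate n i)) then leftDir o (finRotate n i) else rightDir o (finRotate n i))
      = !(if Even (q i) then rightDir o i else leftDir o i) := by
  have := isDown_finRotate_last o i
  rw [isDown_last, isDown_last] at this
  unfold leftDir rightDir
  split_ifs at this ⊢ <;> exact this

/-- The two ends of an upper arc have opposite vertical directions, so their contributions cancel.
-/
theorem sum_leftDir : ∑ i, dirExp (leftDir o i) + ∑ i, dirExp (rightDir o i) = 0 := by
  rw [← Equiv.sum_comp (finRotate n), ← Finset.sum_add_distrib]
  refine Finset.sum_eq_zero fun i _ => ?_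
  rw [leftDir_finRotate, dirExp_not, neg_add_cancel]

/-- Odd bands exchange the sides of their strands, so one parallel band makes the next one parallel,
and hence all. Then `sum_leftDir` makes a sum of n signs vanish, impossible for odd n. -/
theorem exists_antiparallel (hq : ∀ i, Odd (q i)) (hn : Odd n) :
    ∃ b, ∀ i, leftDir o i = b ∧ rightDir o i = !b := by
  have hlow : ∀ i, rightDir o (finRotate n i) = !leftDir o i := by
    intro i
    have := lower_finRotate o i
    simpa [Int.not_even_iff_odd.2 (hq _)] using this
  have hne : ∀ i, rightDir o i = !leftDir o i := by
    by_contra! h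
    obtain ⟨i₀, h₀⟩ := h
    have hall : ∀ i, rightDir o i = leftDir o i := forall_of_finRotate (i₀ := i₀)
      (fun i hi => by rw [hlow, leftDir_finRotate, hi]) (by grind)
    have hs := sum_leftDir o
    simp only [hall] at hs
    have := even_card_of_sum_dirExp_eq_zero (s := Finset.univ) (b := leftDir o) (by omega)
    rw [Finset.card_univ, Fintype.card_fin] at this
    exact Nat.not_even_iff_odd.2 hn this
  have i₀ : Fin n := ⟨0, hn.pos⟩
  refine ⟨leftDir o i₀, fun i => ?_⟩
  have : leftDir o i = leftDir o i₀ :=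
    forall_of_finRotate (P := fun i => leftDir o i = leftDir o i₀) (i₀ := i₀)
      (fun i hi => by rw [leftDir_finRotate, hne, Bool.not_not, hi]) rfl i
  exact ⟨this, by rw [hne, this]⟩

variable {e : Fin n}

/-- Strands leave an even band on the side on which they entered, so the upper and the lower arc
from band `e` reach the next band with the same direction; as that band is odd, it is parallel.
Parallelism then passes through the odd bands. -/
theorem parallel_of_ne (he : Even (q e)) (hq : ∀ i, i ≠ e → Odd (q i)) :
    ∀ i, i ≠ e → leftDir o i = rightDir o i := by
  intro i
  refine forall_of_finRotate (P := fun i => i ≠ e → leftDir o i = rightDir o i) (i₀ := e)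
    (fun i hi hie => ?_) (fun h => absurd rfl h) i
  have hlow := lower_finRotate o i
  rw [if_neg (Int.not_even_iff_odd.2 (hq _ hie))] at hlow
  rw [hlow, leftDir_finRotate]
  split_ifs with h
  · rfl
  · rw [hi fun h' => h (h' ▸ he)]

/-- The arcs make a sum of signs vanish: over all bands if `e` is parallel, over the others if the
two signs of `e` cancel. The number of summands is even in either case, which decides the parity of
n. -/
theorem directions_of_even (he : Even (q e)) (hq : ∀ i, i ≠ e → Odd (q i)) :
    (Even n ∧ rightDir o e = leftDir o e ∧ ∑ i, dirExp (leftDir o i) = 0) ∨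
    (Odd n ∧ rightDir o e = !leftDir o e ∧
      ∑ i ∈ Finset.univ.erase e, dirExp (leftDir o i) = 0) := by
  have hp := parallel_of_ne o he hq
  have hs := sum_leftDir o
  rw [← Finset.add_sum_erase _ _ (Finset.mem_univ e),
    ← Finset.add_sum_erase _ (fun i => dirExp (rightDir o i)) (Finset.mem_univ e),
    ← Finset.sum_congr rfl fun i hi => congrArg dirExp (hp i (Finset.ne_of_mem_erase hi))] at hs
  by_cases h : rightDir o e = leftDir o e
  · left
    rw [h] at hs
    have h0 : ∑ i, dirExp (leftDir o i) = 0 := by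
      rw [← Finset.add_sum_erase _ _ (Finset.mem_univ e)]
      omega
    exact ⟨by simpa using even_card_of_sum_dirExp_eq_zero h0, h, h0⟩
  · right
    have h' : rightDir o e = !leftDir o e := by grind
    rw [h', dirExp_not] at hs
    have h0 : ∑ i ∈ Finset.univ.erase e, dirExp (leftDir o i) = 0 := by omega
    refine ⟨?_, h', h0⟩
    have := even_card_of_sum_dirExp_eq_zero h0
    rw [Finset.card_erase_of_mem (Finset.mem_univ e), Finset.card_univ, Fintype.card_fin] at this
    have hpos : 0 < n := e.pos
    obtain ⟨k, hk⟩ := this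
    exact ⟨k, by omega⟩

end Directions

/-! ### The Alexander polynomial as a sum of products over all bands but one. -/

section AlexanderPolynomial

theorem cyclic_sum_eq {R : Type*} [CommRing R] (m : ℕ) (K θ : ℕ → R) :
    ∑ i ∈ Finset.range (m + 1), (∏ j ∈ Finset.range i, -K (j + 1) * θ j) *
      ∏ j ∈ Finset.Ioc i m, -K j * θ j =
    (∏ j ∈ Finset.range m, -K (j + 1)) *
      ∑ i ∈ Finset.range (m + 1), ∏ j ∈ (Finset.range (m + 1)).erase i, θ j := by
  rw [Finset.mul_sum]
  refine Finset.sum_congr rfl fun i hi => ?_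
  have hi : i ≤ m := by simpa [Nat.lt_succ_iff] using hi
  have h1 : ∏ j ∈ Finset.Ioc i m, -K j = ∏ j ∈ Finset.Ico i m, -K (j + 1) := by
    rw [Finset.prod_Ico_add' (fun j => -K j)]
    refine Finset.prod_congr ?_ fun _ _ => rfl
    ext; simp
  have h2 : ∏ j ∈ (Finset.range (m + 1)).erase i, θ j =
      (∏ j ∈ Finset.range i, θ j) * ∏ j ∈ Finset.Ioc i m, θ j := by
    rw [← Finset.prod_union]
    · refine Finset.prod_congr ?_ fun _ _ => rfl
      ext; simp; omega
    · rw [Finset.disjoint_left]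
      simp only [Finset.mem_range, Finset.mem_Ioc]; omega
  rw [Finset.prod_mul_distrib, Finset.prod_mul_distrib, h1, h2,
    ← Finset.prod_range_mul_prod_Ico _ hi]
  ring

theorem sum_range_prod_erase {R : Type*} [CommRing R] {n : ℕ} (θ : ℕ → R) :
    ∑ i ∈ Finset.range n, ∏ j ∈ (Finset.range n).erase i, θ j =
      ∑ i : Fin n, ∏ j ∈ Finset.univ.erase i, θ j := by
  rw [Finset.sum_range]
  refine Finset.sum_congr rfl fun i _ => ?_
  have : (Finset.range n).erase i = (Finset.univ.erase i).map Fin.valEmbedding := by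
    ext k
    simp only [Finset.mem_erase, Finset.mem_range, Finset.mem_map, Finset.mem_univ,
      Fin.valEmbedding_apply, and_true]
    exact ⟨fun h => ⟨⟨k, h.2⟩, fun h' => h.1 (congrArg Fin.val h'), rfl⟩,
      by rintro ⟨j, hj, rfl⟩; exact ⟨fun h' => hj (Fin.ext h'), j.2⟩⟩
  rw [this, Finset.prod_map]
  rfl

variable {m : ℕ} {q : Fin (m + 1) → ℤ} (o : (pretzelDiagram q).Orientation)

theorem ofNat_add_one_eq (k : ℕ) :
    Fin.ofNat (m + 1) (k + 1) = finRotate (m + 1) (Fin.ofNat (m + 1) k) := by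
  rw [finRotate_apply]
  ext
  simp [Fin.val_add]

theorem associated_sum_prod_erase (θ : Fin (m + 1) → ℤ[T;T⁻¹])
    (hl : ∀ i, bandLeft (q i) (leftDir o i) (rightDir o i) = -dirFactor (leftDir o i) * θ i)
    (hr : ∀ i, bandRight (q i) (leftDir o i) (rightDir o i) = -dirFactor (!rightDir o i) * θ i) :
    Associated o.alexanderPolynomial (∑ i, ∏ j ∈ Finset.univ.erase i, θ j) := by
  -- Indices are read modulo m + 1, so that `f (m + 1) = 0` closes the cycle.
  let f : ℕ → Fin (m + 1) := Fin.ofNat (m + 1)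
  have hf : ∀ i : Fin (m + 1), f i = i := fun i => by simp [f]
  have hf' : ∀ k, leftDir o (f (k + 1)) = !rightDir o (f k) := fun k => by
    rw [← leftDir_finRotate, ← ofNat_add_one_eq]
  have hb : ∀ k, -dirFactor (leftDir o (f (k + 1))) * θ (f k) =
      bandRight (q (f k)) (leftDir o (f k)) (rightDir o (f k)) := fun k => by rw [hr, hf']
  have key := associated_alexanderPolynomial o
    (fun k => -dirFactor (leftDir o (f k)) * θ (f k))
    (fun k => -dirFactor (leftDir o (f (k + 1))) * θ (f k))
    (fun i => by rw [← hl, hf]; rfl) (fun i => by rw [hb, hf]; rfl) ?_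
  · rw [cyclic_sum_eq m (fun k => dirFactor (leftDir o (f k))) (fun k => θ (f k)),
      sum_range_prod_erase] at key
    simp only [hf] at key
    refine key.trans (associated_unit_mul_left _ _ ?_)
    exact Finset.prod_induction _ IsUnit (fun _ _ => IsUnit.mul) isUnit_one
      fun i _ => (isUnit_dirFactor _).neg
  -- Cancelling the common unit in each relation gives θ_i δ_i = θ_{i+1} δ_{i+1}. So all θ_i δ_i
  -- agree, and the last relation follows.
  · intro Q _ _ δ h _
    have h2 : ∀ i, θ i • δ i = θ 0 • δ 0 := by
      intro i
      induction i using Fin.induction with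
      | zero => rfl
      | succ i ih =>
        have := h i
        have h3 : f i = i.castSucc := hf i.castSucc
        have h4 : f (i + 1) = i.succ := hf i.succ
        simp only [h3, h4] at this
        rw [mul_smul, mul_smul, (isUnit_dirFactor _).neg.smul_left_cancel, ih] at this
        exact this.symm
    have h3 : f m = Fin.last m := hf (Fin.last m)
    have h4 : f (m + 1) = 0 := by simp [f]
    have h5 : f 0 = 0 := hf 0
    simp only [h3, h4, h5, mul_smul, h2]

end AlexanderPolynomial

/-! ## Odd parameters -/

section OddParameters

/-- Writing c as a_i - b_i in the i-th summand makes the sum telescope. -/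
theorem cyclic_sum_mul {R : Type*} [CommRing R] (m : ℕ) (a b : ℕ → R) (c : R)
    (h : ∀ j, a j - b j = c) :
    (∑ i ∈ Finset.range (m + 1), (∏ j ∈ Finset.range i, b j) * ∏ j ∈ Finset.Ioc i m, a j) * c =
      ∏ j ∈ Finset.range (m + 1), a j - ∏ j ∈ Finset.range (m + 1), b j := by
  induction m with
  | zero => simp [h]
  | succ m ih =>
    have h3 : ∀ i ∈ Finset.range (m + 1), (∏ j ∈ Finset.range i, b j) *
        ∏ j ∈ Finset.Ioc i (m + 1), a j
          = ((∏ j ∈ Finset.range i, b j) * ∏ j ∈ Finset.Ioc i m, a j) * a (m + 1) := by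
      intro i hi
      rw [← Finset.insert_Ioc_right_eq_Ioc_add_one (by simp at hi; omega),
        Finset.prod_insert (by simp)]
      ring
    rw [Finset.sum_range_succ _ (m + 1), Finset.sum_congr rfl h3, ← Finset.sum_mul, add_mul,
      mul_right_comm, ih, Finset.prod_range_succ a (m + 1), Finset.prod_range_succ b (m + 1),
      ← h (m + 1)]
    simp
    ring

theorem prod_mul_add_eq_sum_sigmaSymm {R : Type*} [CommRing R] {n : ℕ} (q : Fin n → ℤ) (u v : R) :
    ∏ i, ((q i : R) * u + v) =
      ∑ k ∈ Finset.range (n + 1), (sigmaSymm q k : R) * u ^ k * v ^ (n - k) := by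
  rw [Finset.prod_add, Finset.sum_powerset, Finset.card_univ, Fintype.card_fin]
  refine Finset.sum_congr rfl fun k _ => ?_
  rw [sigmaSymm, Int.cast_sum, Finset.sum_mul, Finset.sum_mul]
  refine Finset.sum_congr rfl fun s hs => ?_
  obtain ⟨-, hs⟩ := Finset.mem_powersetCard.1 hs
  rw [Finset.prod_mul_distrib, Finset.prod_const, Finset.prod_const, hs,
    Finset.card_sdiff_of_subset (Finset.subset_univ s), hs, Finset.card_univ, Fintype.card_fin]
  push_cast
  ring

theorem sum_range_two_mul {M : Type*} [AddCommMonoid M] (g : ℕ → M) (N : ℕ) :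
    ∑ k ∈ Finset.range (2 * N), g k = ∑ j ∈ Finset.range N, (g (2 * j) + g (2 * j + 1)) := by
  induction N with
  | zero => simp
  | succ N ih =>
    rw [mul_add, mul_one, Finset.sum_range_succ, Finset.sum_range_succ, ih,
      Finset.sum_range_succ _ N, add_assoc]

/-- The Alexander polynomial of a pretzel knot with odd parameters, multiplied by a power of four,
with coefficients `c j = σ_{2j}`. -/
noncomputable def oddPretzelPoly (p : ℕ) (c : ℕ → ℤ) : Polynomial ℤ :=
  ∑ j ∈ Finset.range (p + 1), Polynomial.C (c j) *
    ((Polynomial.X - 1) ^ (2 * j) * (Polynomial.X + 1) ^ (2 * (p - j)))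

open LaurentPolynomial

theorem two_ne_zero_laurent : (2 : ℤ[T;T⁻¹]) ≠ 0 := by
  have := Polynomial.toLaurent_ne_zero.2 (two_ne_zero : (2 : Polynomial ℤ) ≠ 0)
  rwa [map_ofNat] at this

theorem exists_associated_odd {p : ℕ} {q : Fin (2 * p + 1) → ℤ} (hq : ∀ i, Odd (q i))
    (o : (pretzelDiagram q).Orientation) :
    ∃ D : ℤ[T;T⁻¹], Associated o.alexanderPolynomial D ∧
      4 ^ p * D = Polynomial.toLaurent (oddPretzelPoly p fun j => sigmaSymm q (2 * j)) := by
  obtain ⟨β, hβ⟩ := exists_antiparallel o hq ⟨p, rfl⟩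
  choose k hk using hq
  set τ : ℤ[T;T⁻¹] := T (dirExp β) with hτ
  let f : ℕ → Fin (2 * p + 1) := Fin.ofNat (2 * p + 1)
  have hf : ∀ i : Fin (2 * p + 1), f i = i := fun i => by simp [f]
  let a : ℕ → ℤ[T;T⁻¹] := fun j => k (f j) * (τ - 1) + τ
  let b : ℕ → ℤ[T;T⁻¹] := fun j => k (f j) * (τ - 1) - 1
  have hab : ∀ j, a j - b j = τ + 1 := fun j => by simp only [a, b]; ring
  have ha : ∀ i : Fin (2 * p + 1), a i = bandLeft (q i) (leftDir o i) (rightDir o i) := by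
    intro i
    simp only [a, hf]
    rw [(hβ i).1, (hβ i).2, hk, bandLeft_antiparallel_odd]
  have hb : ∀ i : Fin (2 * p + 1), b i = bandRight (q i) (leftDir o i) (rightDir o i) := by
    intro i
    simp only [b, hf]
    rw [(hβ i).1, (hβ i).2, hk, bandRight_antiparallel_odd]
  have key := associated_alexanderPolynomial o a b ha hb ?_
  · set S := ∑ i ∈ Finset.range (2 * p + 1),
      (∏ j ∈ Finset.range i, b j) * ∏ j ∈ Finset.Ioc i (2 * p), a j with hS
    have hτ1 : τ + 1 ≠ 0 := by
      intro h
      have := congrArg (fun f : ℤ[T;T⁻¹] => f.coeff 0) h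
      simp only [hτ, ← T_zero] at this
      cases β <;> simp [dirExp] at this
    have h1 : S * (τ + 1) = _ := cyclic_sum_mul (2 * p) a b (τ + 1) hab
    have h2 : ∀ i : Fin (2 * p + 1), 2 * a i = q i * (τ - 1) + (τ + 1) := fun i => by
      simp only [a, hf]; rw [hk i]; push_cast; ring
    have h3 : ∀ i : Fin (2 * p + 1), 2 * b i = q i * (τ - 1) + -(τ + 1) := fun i => by
      simp only [b, hf]; rw [hk i]; push_cast; ring
    have h4 : 4 ^ p * S = ∑ j ∈ Finset.range (p + 1), (sigmaSymm q (2 * j) : ℤ[T;T⁻¹]) *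
        ((τ - 1) ^ (2 * j) * (τ + 1) ^ (2 * (p - j))) := by
      have h5 : 2 ^ (2 * p + 1) * (S * (τ + 1)) = ∏ i : Fin (2 * p + 1), (2 * a i) -
          ∏ i : Fin (2 * p + 1), (2 * b i) := by
        rw [h1, Finset.prod_mul_distrib, Finset.prod_mul_distrib, Finset.prod_range,
          Finset.prod_range]
        simp
        ring
      simp only [h2, h3] at h5
      -- The two products differ in the sign of τ + 1. Their number of factors is odd, so exactly
      -- the terms with even `σ`-index survive, and they are doubled.
      rw [prod_mul_add_eq_sum_sigmaSymm, prod_mul_add_eq_sum_sigmaSymm, ← Finset.sum_sub_distrib,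
        show 2 * p + 1 + 1 = 2 * (p + 1) by ring, sum_range_two_mul] at h5
      have h6 : (2 * (τ + 1)) * (4 ^ p * S) = (2 * (τ + 1)) *
          ∑ j ∈ Finset.range (p + 1), (sigmaSymm q (2 * j) : ℤ[T;T⁻¹]) *
            ((τ - 1) ^ (2 * j) * (τ + 1) ^ (2 * (p - j))) := by
        have : (2 * (τ + 1)) * (4 ^ p * S) = 2 ^ (2 * p + 1) * (S * (τ + 1)) := by
          rw [pow_succ, pow_mul]; norm_num; ring
        rw [this, h5, Finset.mul_sum]
        refine Finset.sum_congr rfl fun j hj => ?_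
        obtain ⟨i, rfl⟩ : ∃ i, p = j + i := ⟨p - j, by simp at hj; omega⟩
        rw [show 2 * (j + i) + 1 - 2 * j = 2 * i + 1 by omega,
          show 2 * (j + i) + 1 - (2 * j + 1) = 2 * i by omega, show j + i - j = i by omega,
          Odd.neg_pow ⟨i, rfl⟩, Even.neg_pow (even_two_mul i)]
        ring
      exact mul_left_cancel₀ (mul_ne_zero two_ne_zero_laurent hτ1) h6
    have h7 : Polynomial.toLaurent (oddPretzelPoly p fun j => sigmaSymm q (2 * j)) =
        ∑ j ∈ Finset.range (p + 1), (sigmaSymm q (2 * j) : ℤ[T;T⁻¹]) *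
          ((T 1 - 1) ^ (2 * j) * (T 1 + 1) ^ (2 * (p - j))) := by
      simp [oddPretzelPoly]
    -- If `β` is false then τ = t⁻¹, and the factor t^(2p) turns every summand into the
    -- corresponding one in t.
    cases β
    · refine ⟨T (2 * p) * S, key.trans (associated_unit_mul_right _ _ (isUnit_T _)), ?_⟩
      rw [h7, mul_left_comm, h4, Finset.mul_sum]
      refine Finset.sum_congr rfl fun j hj => ?_
      obtain ⟨i, rfl⟩ : ∃ i, p = j + i := ⟨p - j, by simp at hj; omega⟩
      have h8 : T 1 * τ = 1 := by rw [hτ, ← T_add]; rfl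
      have h9 : (T (2 * ((j + i : ℕ) : ℤ)) : ℤ[T;T⁻¹]) = T 1 ^ (2 * j) * T 1 ^ (2 * i) := by
        rw [T_pow, T_pow, ← T_add]; push_cast; congr 1; ring
      rw [h9, show j + i - j = i by omega]
      have h10 : (T 1 - 1 : ℤ[T;T⁻¹]) ^ (2 * j) = (T 1 * (τ - 1)) ^ (2 * j) := by
        rw [mul_sub, h8, mul_one, ← Even.neg_pow (even_two_mul j)]; ring
      have h11 : (T 1 + 1 : ℤ[T;T⁻¹]) ^ (2 * i) = (T 1 * (τ + 1)) ^ (2 * i) := by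
        rw [mul_add, h8, mul_one, add_comm]
      rw [h10, h11, mul_pow, mul_pow]
      ring
    · exact ⟨S, key, by rw [h4, h7]; rfl⟩
  -- As a_i - b_i is constant, Σ δ_i = 0 implies Σ a_i δ_i = Σ b_i δ_i; the given relations cancel
  -- all but one term on each side.
  · intro Q _ _ δ h h0
    have h1 : ∑ i : Fin (2 * p + 1), a i • δ i - ∑ i : Fin (2 * p + 1), b i • δ i = 0 := by
      rw [← Finset.sum_sub_distrib]
      simp only [← sub_smul, hab]
      rw [← Finset.smul_sum, h0, smul_zero]
    rw [Fin.sum_univ_succ, Fin.sum_univ_castSucc (fun i => b i • δ i)] at h1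
    simp only [Fin.val_castSucc, h, Fin.val_succ, Fin.val_zero, Fin.val_last] at h1
    rw [add_comm, add_sub_add_left_eq_sub, sub_eq_zero] at h1
    exact h1.symm

variable (p : ℕ) (c : ℕ → ℤ)

theorem natDegree_oddPretzelPoly_le : (oddPretzelPoly p c).natDegree ≤ 2 * p := by
  refine Polynomial.natDegree_sum_le_of_forall_le _ _ fun j hj => ?_
  have hj : j ≤ p := by simpa [Nat.lt_succ_iff] using hj
  compute_degree
  omega

theorem coeff_zero_oddPretzelPoly :
    (oddPretzelPoly p c).coeff 0 = ∑ j ∈ Finset.range (p + 1), c j := by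
  simp [oddPretzelPoly, Polynomial.coeff_zero_eq_eval_zero, Polynomial.eval_finsetSum]

theorem coeff_top_oddPretzelPoly :
    (oddPretzelPoly p c).coeff (2 * p) = ∑ j ∈ Finset.range (p + 1), c j := by
  rw [oddPretzelPoly, Polynomial.finsetSum_coeff]
  refine Finset.sum_congr rfl fun j hj => ?_
  have hj : j ≤ p := by simpa [Nat.lt_succ_iff] using hj
  have h1 : ((Polynomial.X - 1 : Polynomial ℤ) ^ (2 * j) *
      (Polynomial.X + 1) ^ (2 * (p - j))).Monic := by
    refine ((Polynomial.monic_X_sub_C 1).pow _).mul ((Polynomial.monic_X_add_C 1).pow _)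
  have h2 : ((Polynomial.X - 1 : Polynomial ℤ) ^ (2 * j) *
      (Polynomial.X + 1) ^ (2 * (p - j))).natDegree = 2 * p := by
    have e1 : (Polynomial.X - 1 : Polynomial ℤ).natDegree = 1 := Polynomial.natDegree_X_sub_C 1
    have e2 : (Polynomial.X + 1 : Polynomial ℤ).natDegree = 1 := Polynomial.natDegree_X_add_C 1
    have e3 : (Polynomial.X - 1 : Polynomial ℤ).Monic := Polynomial.monic_X_sub_C 1
    have e4 : (Polynomial.X + 1 : Polynomial ℤ).Monic := Polynomial.monic_X_add_C 1
    rw [(e3.pow _).natDegree_mul (e4.pow _), e3.natDegree_pow, e4.natDegree_pow, e1, e2]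
    omega
  rw [Polynomial.coeff_C_mul, ← h2, h1.coeff_natDegree, mul_one]

/-- The span is `N` exactly if both ends of the window are attained, and either end is attained
under the same condition `P`. -/
theorem spanDegree_eq_iff {f : ℤ[T;T⁻¹]} {k : ℤ} {N : ℕ} {P : Prop}
    (hs : ∀ i, f.coeff i ≠ 0 → k ≤ i ∧ i ≤ k + N) (h₀ : f.coeff k ≠ 0 ↔ P)
    (h₁ : f.coeff (k + N) ≠ 0 ↔ P) : spanDegree f = ((N : ℤ) : WithBot ℤ) ↔ P := by
  unfold spanDegree
  split_ifs with h
  · rw [WithBot.coe_inj]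
    have hmax := Finset.max'_mem _ h
    have hmin := Finset.min'_mem _ h
    rw [Finsupp.mem_support_iff] at hmax hmin
    constructor
    · intro h2
      rw [← h₀]
      have h3 := hs _ hmax
      have h4 := hs _ hmin
      rwa [show k = f.coeff.support.min' h by omega]
    · intro hP
      have h3 := Finset.min'_le f.coeff.support k (Finsupp.mem_support_iff.2 (h₀.2 hP))
      have h4 := Finset.le_max' f.coeff.support (k + N) (Finsupp.mem_support_iff.2 (h₁.2 hP))
      have h5 := hs _ hmax
      have h6 := hs _ hmin
      omega
  · refine ⟨fun h2 => absurd h2 (by simp), fun hP => (h ⟨k, ?_⟩).elim⟩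
    exact Finsupp.mem_support_iff.2 (h₀.2 hP)

variable {p c}

theorem coeff_T_mul (k : ℤ) (f : ℤ[T;T⁻¹]) (i : ℤ) : (T k * f).coeff i = f.coeff (i - k) := by
  rw [T, AddMonoidAlgebra.coeff_single_mul_apply, one_mul, neg_add_eq_sub]

theorem coeff_toLaurent_natCast (P : Polynomial ℤ) (i : ℕ) :
    (Polynomial.toLaurent P).coeff i = P.coeff i := by
  rw [LaurentPolynomial.coeff_toLaurent]
  exact Finsupp.mapDomain_apply Nat.castEmbedding.injective _ _

theorem coeff_toLaurent_ne_zero {P : Polynomial ℤ} {i : ℤ}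
    (h : (Polynomial.toLaurent P).coeff i ≠ 0) : 0 ≤ i ∧ i ≤ P.natDegree := by
  rw [← Finsupp.mem_support_iff, LaurentPolynomial.support_coeff_toLaurent, Finset.mem_map] at h
  obtain ⟨j, hj, rfl⟩ := h
  have := Polynomial.le_natDegree_of_mem_supp _ hj
  exact ⟨Int.natCast_nonneg j, Int.ofNat_le.2 this⟩

theorem spanDegree_odd_iff {f D : ℤ[T;T⁻¹]} (hf : Associated D f)
    (hD : 4 ^ p * D = Polynomial.toLaurent (oddPretzelPoly p c)) :
    spanDegree f = (((2 * p : ℕ) : ℤ) : WithBot ℤ) ↔ ∑ j ∈ Finset.range (p + 1), c j ≠ 0 := by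
  obtain ⟨u, rfl⟩ := hf
  have h0 : ∀ i, D.coeff i ≠ 0 ↔
      (Polynomial.toLaurent (oddPretzelPoly p c)).coeff i ≠ 0 := by
    intro i
    have : (4 ^ p * D : ℤ[T;T⁻¹]) = (4 ^ p : ℤ) • D := by
      rw [zsmul_eq_mul]; push_cast; rfl
    rw [← hD, this, AddMonoidAlgebra.coeff_smul, Finsupp.smul_apply, smul_eq_mul]
    exact ⟨fun h => mul_ne_zero (by positivity) h, right_ne_zero_of_mul⟩
  obtain ⟨k, hk⟩ : ∃ k : ℤ, ∀ i, (D * u).coeff i ≠ 0 ↔ D.coeff (i - k) ≠ 0 := by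
    obtain ⟨k, hk | hk⟩ := (eqUpToUnit_one_iff u).2 u.isUnit
    · exact ⟨k, fun i => by rw [hk, mul_one, mul_comm, coeff_T_mul]⟩
    · refine ⟨k, fun i => ?_⟩
      rw [hk, mul_one, mul_comm, neg_mul]
      have : (-(T k * D)).coeff i = -((T k * D).coeff i) := rfl
      rw [this, coeff_T_mul, neg_ne_zero]
  refine spanDegree_eq_iff (k := k) (fun i hi => ?_) ?_ ?_
  · rw [hk, h0] at hi
    have h1 := coeff_toLaurent_ne_zero hi
    have h2 := natDegree_oddPretzelPoly_le p c
    omega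
  · rw [hk, h0, sub_self]
    have := coeff_toLaurent_natCast (oddPretzelPoly p c) 0
    rw [Nat.cast_zero] at this
    rw [this, coeff_zero_oddPretzelPoly]
  · rw [hk, h0, add_sub_cancel_left, coeff_toLaurent_natCast, coeff_top_oddPretzelPoly]

theorem eval_odd {D : ℤ[T;T⁻¹]} (hD : 4 ^ p * D = Polynomial.toLaurent (oddPretzelPoly p c))
    (x : ℚˣ) : (4 : ℚ) ^ p * LaurentPolynomial.eval₂ (Int.castRingHom ℚ) x D =
      ∑ j ∈ Finset.range (p + 1),
        (c j : ℚ) * ((x - 1 : ℚ) ^ (2 * j) * (x + 1 : ℚ) ^ (2 * (p - j))) := by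
  have := congrArg (LaurentPolynomial.eval₂ (Int.castRingHom ℚ) x) hD
  rw [map_mul, map_pow, map_ofNat, LaurentPolynomial.eval₂_toLaurent] at this
  rw [this, oddPretzelPoly, Polynomial.eval₂_finsetSum]
  refine Finset.sum_congr rfl fun j _ => ?_
  rw [Polynomial.eval₂_mul, Polynomial.eval₂_C]
  simp [Polynomial.eval₂_mul, Polynomial.eval₂_pow]

/-- Division by (x + 1)^(2p) leaves a polynomial in ((x - 1)/(x + 1))² with the coefficients `d`. It
vanishes at infinitely many points; `w` collects those with x = N + 1. -/
theorem eq_zero_of_sum_eq_zero {d : ℕ → ℚ} (h : ∀ x : ℚ, 0 < x →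
      ∑ j ∈ Finset.range (p + 1), d j * ((x - 1) ^ (2 * j) * (x + 1) ^ (2 * (p - j))) = 0)
    (k : ℕ) (hk : k ≤ p) : d k = 0 := by
  let Q : Polynomial ℚ := ∑ j ∈ Finset.range (p + 1), Polynomial.C (d j) * Polynomial.X ^ j
  have hQ : Q = 0 := by
    let w : ℕ → ℚ := fun N => ((N : ℚ) / (N + 2)) ^ 2
    have hw : Function.Injective w := by
      intro a b hab
      have h1 : (0 : ℚ) ≤ a := Nat.cast_nonneg a
      have h2 : (0 : ℚ) ≤ b := Nat.cast_nonneg b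
      have h3 := (sq_eq_sq₀ (by positivity) (by positivity)).1 hab
      rw [div_eq_div_iff (by positivity) (by positivity)] at h3
      exact_mod_cast (by linarith : (a : ℚ) = b)
    refine Polynomial.eq_zero_of_infinite_isRoot _ (Set.infinite_of_injective_forall_mem hw ?_)
    intro N
    have h1 : (0 : ℚ) ≤ N := Nat.cast_nonneg N
    have h2 := h (N + 1) (by positivity)
    have h3 : (N + 2 : ℚ) ≠ 0 := by positivity
    have h4 : (N + 2 : ℚ) ^ (2 * p) * Q.eval (w N) = 0 := by
      rw [← h2, Polynomial.eval_finsetSum, Finset.mul_sum]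
      refine Finset.sum_congr rfl fun j hj => ?_
      obtain ⟨i, rfl⟩ : ∃ i, p = j + i := ⟨p - j, by simp at hj; omega⟩
      simp only [Polynomial.eval_mul, Polynomial.eval_C, Polynomial.eval_pow, Polynomial.eval_X, w]
      rw [show j + i - j = i by omega, ← pow_mul, div_pow, mul_add, pow_add]
      field_simp
      ring
    exact (mul_eq_zero.1 h4).resolve_left (pow_ne_zero _ h3)
  have := congrArg (fun Q => Q.coeff k) hQ
  simpa [Q, Polynomial.finsetSum_coeff, Polynomial.coeff_X_pow, Nat.lt_succ_iff, hk] using this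

/-- Binomial expansion of 4x = (x + 1)² - (x - 1)². -/
theorem sum_choose_eq (x : ℚ) : ∑ j ∈ Finset.range (p + 1),
    ((-1) ^ j * (p.choose j : ℚ)) * ((x - 1) ^ (2 * j) * (x + 1) ^ (2 * (p - j))) =
      4 ^ p * x ^ p := by
  have := add_pow (-(x - 1) ^ 2) ((x + 1) ^ 2) p
  rw [← mul_pow, show 4 * x = -(x - 1) ^ 2 + (x + 1) ^ 2 by ring, this]
  refine Finset.sum_congr rfl fun j _ => ?_
  rw [neg_pow ((x - 1) ^ 2), ← pow_mul, ← pow_mul]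
  ring

theorem isUnit_odd_iff {D : ℤ[T;T⁻¹]} (hc : c 0 = 1)
    (hD : 4 ^ p * D = Polynomial.toLaurent (oddPretzelPoly p c)) :
    IsUnit D ↔ ∀ k ≤ p, c k = (-1) ^ k * (p.choose k : ℤ) := by
  constructor
  · intro hu
    obtain ⟨k, ε, hε, hk⟩ : ∃ (k : ℤ) (ε : ℚ), (ε = 1 ∨ ε = -1) ∧
        ∀ x : ℚˣ, LaurentPolynomial.eval₂ (Int.castRingHom ℚ) x D = ε * (x : ℚ) ^ k := by
      obtain ⟨k, hk | hk⟩ := (eqUpToUnit_one_iff D).2 hu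
      · exact ⟨k, 1, Or.inl rfl, fun x => by rw [hk]; simp⟩
      · exact ⟨k, -1, Or.inr rfl, fun x => by rw [hk]; simp⟩
    have key := fun x => eval_odd hD x
    simp only [hk] at key
    -- At x = 1 only the term j = 0 survives.
    have hε1 : ε = 1 := by
      have h1 := key 1
      rw [Finset.sum_eq_single 0 (fun j _ hj => by simp [hj]) (by simp), hc] at h1
      norm_num [pow_mul] at h1
      exact h1
    subst hε1
    -- The sum is palindromic of degree 2p, so its values at 2 and 1/2 differ by the factor 2^(2p);
    -- those of x^k differ by 2^(2k).
    have hkp : k = p := by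
      have h1 := key (Units.mk0 2 two_ne_zero)
      have h2 := key (Units.mk0 2⁻¹ (inv_ne_zero two_ne_zero))
      simp only [Units.val_mk0, one_mul] at h1 h2
      have h3 : (2 : ℚ) ^ (2 * p) * (4 ^ p * 2⁻¹ ^ k) = 4 ^ p * 2 ^ k := by
        rw [h1, h2, Finset.mul_sum]
        refine Finset.sum_congr rfl fun j hj => ?_
        obtain ⟨i, rfl⟩ : ∃ i, p = j + i := ⟨p - j, by simp at hj; omega⟩
        rw [show j + i - j = i by omega, show 2 * (j + i) = 2 * j + 2 * i by ring, pow_add,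
          ← Even.neg_pow (even_two_mul j) (2⁻¹ - 1 : ℚ)]
        have e1 : (2 : ℚ) ^ (2 * j) * (-(2⁻¹ - 1)) ^ (2 * j) = (2 - 1) ^ (2 * j) := by
          rw [← mul_pow]; norm_num
        have e2 : (2 : ℚ) ^ (2 * i) * (2⁻¹ + 1) ^ (2 * i) = (2 + 1) ^ (2 * i) := by
          rw [← mul_pow]; norm_num
        rw [← e1, ← e2]
        ring
      rw [mul_left_comm] at h3
      have h4 := mul_left_cancel₀ (by positivity) h3
      rw [inv_zpow', ← zpow_natCast, ← zpow_add₀ two_ne_zero] at h4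
      have := zpow_right_injective₀ (by norm_num : (0 : ℚ) < 2) (by norm_num) h4
      push_cast at this
      omega
    intro j hj
    have h1 := eq_zero_of_sum_eq_zero (p := p)
      (d := fun j => (c j : ℚ) - (-1) ^ j * (p.choose j : ℚ)) (fun x hx => ?_) j hj
    · have h2 : (c j : ℚ) = (-1) ^ j * (p.choose j : ℚ) := sub_eq_zero.1 h1
      exact_mod_cast h2
    · have h2 := key (Units.mk0 x hx.ne')
      simp only [Units.val_mk0, one_mul, hkp, zpow_natCast] at h2
      simp only [sub_mul, Finset.sum_sub_distrib, ← h2, sum_choose_eq, sub_self]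
  · intro h
    have h1 : oddPretzelPoly p c = 4 ^ p * Polynomial.X ^ p := by
      have := add_pow (-(Polynomial.X - 1) ^ 2) ((Polynomial.X + 1) ^ 2 : Polynomial ℤ) p
      rw [← mul_pow, show (4 * Polynomial.X : Polynomial ℤ) =
        -(Polynomial.X - 1) ^ 2 + (Polynomial.X + 1) ^ 2 by ring, this, oddPretzelPoly]
      refine Finset.sum_congr rfl fun j hj => ?_
      rw [h j (by simpa [Nat.lt_succ_iff] using hj), neg_pow ((Polynomial.X - 1) ^ 2 : Polynomial ℤ),
        ← pow_mul, ← pow_mul]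
      simp
      ring
    rw [h1, map_mul, map_pow, map_pow, map_ofNat] at hD
    have h4 : (4 : ℤ[T;T⁻¹]) ≠ 0 := by
      rw [show (4 : ℤ[T;T⁻¹]) = 2 * 2 by norm_num]
      exact mul_ne_zero two_ne_zero_laurent two_ne_zero_laurent
    rw [mul_left_cancel₀ (pow_ne_zero p h4) hD, Polynomial.toLaurent_X]
    exact (isUnit_T 1).pow p

end OddParameters

/-! ## Products of polynomials `X ^ a - 1` -/

section SignedSum

open Polynomial

variable {ι : Type*} {S : Finset ι} {a : ι → ℕ} {ε : ι → ℤ}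

/-- Equality with `± X ^ k * (X - 1) ^ N` for some `k`. -/
def IsMonomialTimes (N : ℕ) (P : ℤ[X]) : Prop :=
  ∃ k : ℕ, ∃ η : ℤ, (η = 1 ∨ η = -1) ∧ P = C η * X ^ k * (X - 1) ^ N

theorem X_pow_sub_one_monic {k : ℕ} (hk : 0 < k) : (X ^ k - 1 : ℤ[X]).Monic :=
  monic_X_pow_sub_C 1 hk.ne'

theorem X_sub_one_ne_zero' : (X - 1 : ℤ[X]) ≠ 0 := X_sub_C_ne_zero 1

theorem X_pow_sub_one_natDegree (k : ℕ) : (X ^ k - 1 : ℤ[X]).natDegree = k :=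
  natDegree_X_pow_sub_C (r := 1)

theorem prod_X_pow_sub_one_monic (ha : ∀ i ∈ S, 0 < a i) :
    (∏ j ∈ S, (X ^ a j - 1) : ℤ[X]).Monic :=
  monic_prod_of_monic _ _ fun j hj => X_pow_sub_one_monic (ha j hj)

theorem prod_X_pow_sub_one_natDegree (ha : ∀ i ∈ S, 0 < a i) :
    (∏ j ∈ S, (X ^ a j - 1) : ℤ[X]).natDegree = ∑ j ∈ S, a j := by
  rw [natDegree_prod_of_monic _ _ fun j hj => X_pow_sub_one_monic (ha j hj)]
  simp only [X_pow_sub_one_natDegree]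

theorem eval_zero_prod (ha : ∀ i ∈ S, 0 < a i) :
    (∏ j ∈ S, (X ^ a j - 1) : ℤ[X]).eval 0 = (-1) ^ S.card := by
  rw [eval_prod, Finset.prod_congr rfl (g := fun _ => (-1 : ℤ)), Finset.prod_const]
  intro j hj
  simp [(ha j hj).ne']

/-- The nonzero constant term excludes a power of X. Equality of degrees then says that the positive
numbers a_j have sum `S.card`. -/
theorem isMonomialTimes_prod_iff (ha : ∀ i ∈ S, 0 < a i) :
    IsMonomialTimes S.card (∏ j ∈ S, (X ^ a j - 1)) ↔ ∀ j ∈ S, a j = 1 := by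
  constructor
  · rintro ⟨k, η, hη, h⟩
    have hk : k = 0 := by
      by_contra hk
      have := congrArg (eval 0) h
      rw [eval_zero_prod ha] at this
      simp [hk] at this
    subst hk
    have hd := congrArg natDegree h
    have e1 : (X - 1 : ℤ[X]).natDegree = 1 := natDegree_X_sub_C 1
    rw [prod_X_pow_sub_one_natDegree ha, pow_zero, mul_one,
      natDegree_C_mul (by rcases hη with rfl | rfl <;> decide), natDegree_pow, e1, mul_one] at hd
    have h2 : ∑ j ∈ S, 1 = ∑ j ∈ S, a j := by simp [hd]
    intro j hj
    exact ((Finset.sum_eq_sum_iff_of_le fun i hi => ha i hi).1 h2 j hj).symm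
  · intro h
    refine ⟨0, 1, Or.inl rfl, ?_⟩
    rw [Finset.prod_congr rfl fun j hj => by rw [h j hj, pow_one], Finset.prod_const]
    simp

theorem two_pow_sub_one_ne_zero (ha : ∀ i ∈ S, 0 < a i) :
    ∀ i ∈ S, (2 : ℚ) ^ a i - 1 ≠ 0 := fun i hi =>
  (sub_pos.2 (one_lt_pow₀ one_lt_two (ha i hi).ne')).ne'

theorem inv_two_pow_sub_one_ne_zero (ha : ∀ i ∈ S, 0 < a i) :
    ∀ i ∈ S, (2⁻¹ : ℚ) ^ a i - 1 ≠ 0 := fun i hi =>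
  (sub_neg.2 (pow_lt_one₀ (by norm_num) (by norm_num) (ha i hi).ne')).ne

theorem prod_inv_two :
    (∏ j ∈ S, ((2⁻¹ : ℚ) ^ a j - 1)) * 2 ^ (∑ j ∈ S, a j)
      = (-1) ^ S.card * ∏ j ∈ S, ((2 : ℚ) ^ a j - 1) := by
  rw [← Finset.prod_pow_eq_pow_sum, ← Finset.prod_mul_distrib, ← Finset.prod_const,
    ← Finset.prod_mul_distrib]
  refine Finset.prod_congr rfl fun j _ => ?_
  rw [sub_mul, ← mul_pow]
  norm_num

/-- The hypothesis `h2` is the functional equation P(1/x) x^A = (-1)^N P(x) at the single point x =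
2, which suffices because powers of 2 determine their exponents. -/
theorem eq_of_aeval_eq {P : ℤ[X]} {k N A : ℕ} {η : ℤ} (hη : η = 1 ∨ η = -1)
    (h : P = C η * X ^ k * (X - 1) ^ N)
    (h2 : aeval (2⁻¹ : ℚ) P * 2 ^ A = (-1) ^ N * aeval (2 : ℚ) P) : A = 2 * k + N := by
  rw [h] at h2
  have hη' : (η : ℚ) ≠ 0 := by rcases hη with rfl | rfl <;> norm_num
  simp only [map_mul, map_pow, map_sub, aeval_X, aeval_C, map_one] at h2
  have e1 : (2⁻¹ - 1 : ℚ) ^ N = (-1) ^ N * (2 ^ N)⁻¹ := by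
    rw [← inv_pow, ← mul_pow]; norm_num
  rw [e1, inv_pow] at h2
  simp only [eq_intCast] at h2
  have h3 : (2 : ℚ) ^ A = 2 ^ (2 * k + N) := by
    have h4 : (-1 : ℚ) ^ N ≠ 0 := by positivity
    norm_num at h2
    field_simp at h2
    rw [h2]
    ring
  exact pow_right_injective₀ (by norm_num) (by norm_num) h3

/-- The power series `X ^ a + X ^ (2 * a) + ...`. -/
noncomputable def multiplesSeries (k : ℕ) : PowerSeries ℤ :=
  PowerSeries.mk fun m => if 0 < m ∧ k ∣ m then 1 else 0

theorem mul_multiplesSeries {k : ℕ} (hk : 0 < k) :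
    ((X ^ k - 1 : ℤ[X]) : PowerSeries ℤ) * (1 + multiplesSeries k) = -1 := by
  have h : (PowerSeries.X : PowerSeries ℤ) ^ k * (1 + multiplesSeries k) = multiplesSeries k := by
    ext m
    rw [PowerSeries.coeff_X_pow_mul']
    split_ifs with hm
    · obtain ⟨d, rfl⟩ := Nat.exists_eq_add_of_le hm
      rw [Nat.add_sub_cancel_left, map_add, multiplesSeries, PowerSeries.coeff_mk,
        PowerSeries.coeff_mk, PowerSeries.coeff_one]
      rcases Nat.eq_zero_or_pos d with rfl | hd
      · simp [hk]
      · simp [hd, hd.ne', hk]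
    · rw [multiplesSeries, PowerSeries.coeff_mk, if_neg]
      rintro ⟨h1, h2⟩
      exact hm (Nat.le_of_dvd h1 h2)
  push_cast
  rw [sub_mul, h]
  ring

theorem isUnit_coe_prod (ha : ∀ i ∈ S, 0 < a i) :
    IsUnit ((∏ j ∈ S, (X ^ a j - 1) : ℤ[X]) : PowerSeries ℤ) := by
  rw [PowerSeries.isUnit_iff_constantCoeff, constantCoeff_coe, coeff_zero_eq_eval_zero,
    eval_zero_prod ha]
  exact (isUnit_one.neg).pow _

theorem coeff_sum_multiplesSeries {m : ℕ} (hm : 0 < m) :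
    PowerSeries.coeff m (∑ i ∈ S, PowerSeries.C (ε i) * multiplesSeries (a i)) =
      ∑ i ∈ S with a i ∣ m, ε i := by
  rw [map_sum, Finset.sum_filter]
  refine Finset.sum_congr rfl fun i _ => ?_
  rw [PowerSeries.coeff_C_mul, multiplesSeries, PowerSeries.coeff_mk]
  simp [hm]

theorem coe_dvd_of_eq {P : ℤ[X]} {k N : ℕ} {η : ℤ} (h : P = C η * X ^ k * (X - 1) ^ N) :
    (PowerSeries.X : PowerSeries ℤ) ^ k ∣ P := by
  rw [h]
  push_cast
  exact ((dvd_refl _).mul_left _).mul_right _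

theorem coeff_monomialTimes_of_lt {k N A : ℕ} {η : ℤ} (hk : k + N < A) :
    (C η * X ^ k * (X - 1) ^ N : ℤ[X]).coeff A = 0 := by
  refine coeff_eq_zero_of_natDegree_lt (lt_of_le_of_lt ?_ hk)
  compute_degree

/-- 1/(x⁻ᵃ - 1) + 1/(xᵃ - 1) = -1, and the weights ε_i sum to zero. -/
theorem sum_div_inv_two (ha : ∀ i ∈ S, 0 < a i) (hε : ∑ i ∈ S, ε i = 0) :
    ∑ i ∈ S, (ε i : ℚ) / ((2⁻¹ : ℚ) ^ a i - 1) = -∑ i ∈ S, (ε i : ℚ) / ((2 : ℚ) ^ a i - 1) := by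
  have hε' : ∑ i ∈ S, (ε i : ℚ) = 0 := by exact_mod_cast hε
  rw [eq_neg_iff_add_eq_zero, ← Finset.sum_add_distrib, ← neg_eq_zero, ← hε',
    ← Finset.sum_neg_distrib]
  refine Finset.sum_congr rfl fun i hi => ?_
  have h1 := two_pow_sub_one_ne_zero ha i hi
  have h2 := inv_two_pow_sub_one_ne_zero ha i hi
  rw [inv_pow] at h2 ⊢
  have h3 : ((2 : ℚ) ^ a i)⁻¹ - 1 = -((2 : ℚ) ^ a i - 1) / 2 ^ a i := by field_simp; ring
  rw [h3]
  field_simp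
  ring

variable [DecidableEq ι]

/-- The numerator of the sum of the fractions `ε i / (X ^ a i - 1)`. -/
noncomputable def signedSum (S : Finset ι) (a : ι → ℕ) (ε : ι → ℤ) : ℤ[X] :=
  ∑ i ∈ S, C (ε i) * ∏ j ∈ S.erase i, (X ^ a j - 1)

theorem coeff_signedSum (ha : ∀ i ∈ S, 0 < a i) {N : ℕ} (hN : ∑ j ∈ S, a j ≤ N) :
    (signedSum S a ε).coeff N = 0 := by
  rw [signedSum, finsetSum_coeff]
  refine Finset.sum_eq_zero fun i hi => ?_
  rw [coeff_C_mul, coeff_eq_zero_of_natDegree_lt, mul_zero]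
  rw [prod_X_pow_sub_one_natDegree fun j hj => ha j (Finset.mem_of_mem_erase hj)]
  have := Finset.add_sum_erase S a hi
  have := ha i hi
  omega

theorem eval_zero_signedSum (ha : ∀ i ∈ S, 0 < a i) :
    (signedSum S a ε).eval 0 = -(-1) ^ S.card * ∑ i ∈ S, ε i := by
  rw [signedSum, eval_finsetSum, Finset.mul_sum]
  refine Finset.sum_congr rfl fun i hi => ?_
  rw [eval_mul, eval_C, eval_zero_prod fun j hj => ha j (Finset.mem_of_mem_erase hj),
    ← Finset.card_erase_add_one hi, pow_succ]
  ring

theorem aeval_signedSum {x : ℚ} (hx : ∀ i ∈ S, x ^ a i - 1 ≠ 0) :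
    aeval x (signedSum S a ε) = (∏ j ∈ S, (x ^ a j - 1)) * ∑ i ∈ S, ε i / (x ^ a i - 1) := by
  rw [signedSum, map_sum, Finset.mul_sum]
  refine Finset.sum_congr rfl fun i hi => ?_
  rw [← Finset.mul_prod_erase _ _ hi]
  have := hx i hi
  simp only [map_mul, map_prod, map_sub, map_pow, aeval_X, map_one, aeval_C]
  field_simp
  simp [mul_comm]

theorem aeval_inv_two_signedSum (ha : ∀ i ∈ S, 0 < a i) (hε : ∑ i ∈ S, ε i = 0) :
    aeval (2⁻¹ : ℚ) (signedSum S a ε) * 2 ^ (∑ j ∈ S, a j) =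
      -(-1) ^ S.card * aeval (2 : ℚ) (signedSum S a ε) := by
  rw [aeval_signedSum (two_pow_sub_one_ne_zero ha),
    aeval_signedSum (inv_two_pow_sub_one_ne_zero ha), sum_div_inv_two ha hε, mul_right_comm,
    prod_inv_two]
  ring

/-- Expand ε/(X^a - 1) = -ε(1 + X^a + X^(2a) + ...); the constant terms cancel. The product in front
is an invertible series, so divisibility of the signed sum by X^k becomes a condition on signed
counts of divisors. -/
theorem coe_signedSum (ha : ∀ i ∈ S, 0 < a i) (hε : ∑ i ∈ S, ε i = 0) :
    ((signedSum S a ε : ℤ[X]) : PowerSeries ℤ) = -((∏ j ∈ S, (X ^ a j - 1) : ℤ[X]) : PowerSeries ℤ) *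
      ∑ i ∈ S, PowerSeries.C (ε i) * multiplesSeries (a i) := by
  have h0 : ∑ i ∈ S, PowerSeries.C (ε i) = 0 := by rw [← map_sum, hε, map_zero]
  have h1 : ∑ i ∈ S, PowerSeries.C (ε i) * multiplesSeries (a i) =
      ∑ i ∈ S, PowerSeries.C (ε i) * (1 + multiplesSeries (a i)) := by
    simp only [mul_add, mul_one, Finset.sum_add_distrib, h0, zero_add]
  have h2 : ((signedSum S a ε : ℤ[X]) : PowerSeries ℤ) = ∑ i ∈ S,
      PowerSeries.C (ε i) * ((∏ j ∈ S.erase i, (X ^ a j - 1) : ℤ[X]) : PowerSeries ℤ) := by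
    rw [signedSum, ← coeToPowerSeries.ringHom_apply, map_sum]
    refine Finset.sum_congr rfl fun i _ => ?_
    rw [map_mul, coeToPowerSeries.ringHom_apply, coeToPowerSeries.ringHom_apply, coe_C]
  rw [h1, h2, Finset.mul_sum]
  refine Finset.sum_congr rfl fun i hi => ?_
  rw [← Finset.mul_prod_erase _ _ hi, coe_mul]
  linear_combination (PowerSeries.C (ε i) *
    ((∏ j ∈ S.erase i, (X ^ a j - 1) : ℤ[X]) : PowerSeries ℤ)) * mul_multiplesSeries (ha i hi)



end SignedSum

/-! ### When such sums are a monomial times a power of X - 1. -/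

section SignedSumCriteria

open Polynomial

variable {ι : Type*} {S : Finset ι} {a : ι → ℕ} {ε : ι → ℤ} {κ : ℤ}

theorem card_le_sum (ha : ∀ i ∈ S, 0 < a i) : S.card ≤ ∑ j ∈ S, a j := by
  rw [Finset.card_eq_sum_ones]
  exact Finset.sum_le_sum ha

/-- If all signed counts of the multiples of `1, ..., k - 1` vanish, then so do the signed counts
of these values themselves. -/
theorem sum_eq_zero_of_sum_dvd_eq_zero (ha : ∀ i ∈ S, 0 < a i) {k : ℕ}
    (h : ∀ m, 0 < m → m < k → ∑ i ∈ S with a i ∣ m, ε i = 0) (m : ℕ) (hm : m < k) :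
    ∑ i ∈ S with a i = m, ε i = 0 := by
  induction m using Nat.strong_induction_on with
  | _ m ih =>
    rcases Nat.eq_zero_or_pos m with rfl | h0
    · rw [Finset.filter_false_of_mem fun i hi => (ha i hi).ne', Finset.sum_empty]
    · have h1 := h m h0 hm
      have h2 : ∀ i ∈ S.filter (fun i => a i ∣ m), a i ∈ m.divisors := fun i hi =>
        Nat.mem_divisors.2 ⟨(Finset.mem_filter.1 hi).2, h0.ne'⟩
      -- The indices with `a i ∣ m` are grouped by the value `a i`; proper divisors contribute zero
      -- by induction.
      rw [← Finset.sum_fiberwise_of_maps_to h2, ← Finset.sum_erase_add _ _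
        (Nat.mem_divisors_self m h0.ne'), Finset.sum_eq_zero, zero_add] at h1
      · rw [← h1]
        refine Finset.sum_congr ?_ fun _ _ => rfl
        ext i
        simp only [Finset.mem_filter]
        exact ⟨fun h => ⟨⟨h.1, h.2 ▸ dvd_rfl⟩, h.2⟩, fun h => ⟨h.1.1, h.2⟩⟩
      · intro d hd
        rw [Finset.mem_erase, Nat.mem_divisors] at hd
        have hdm : d < m := lt_of_le_of_ne (Nat.le_of_dvd h0 hd.2.1) hd.1
        rw [← ih d hdm (hdm.trans hm)]
        refine Finset.sum_congr ?_ fun _ _ => rfl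
        ext i
        simp only [Finset.mem_filter]
        exact ⟨fun h => ⟨h.1.1, h.2⟩, fun h => ⟨⟨h.1, h.2 ▸ hd.2.1⟩, h.2⟩⟩

variable [DecidableEq ι]

/-- A product of all but one factors is the full product divided by the missing factor. -/
theorem mul_signedSum (W : ℤ[X]) (w : ι → ℤ[X])
    (hw : ∀ i ∈ S, W = w i * (X ^ a i - 1)) :
    W * signedSum S a ε = (∏ j ∈ S, (X ^ a j - 1)) * ∑ i ∈ S, C (ε i) * w i := by
  rw [signedSum, Finset.mul_sum, Finset.mul_sum]
  refine Finset.sum_congr rfl fun i hi => ?_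
  rw [hw i hi, ← Finset.mul_prod_erase _ _ hi]
  ring

/-! ### All bands parallel: exactly one even exponent. -/

section Even

variable {e : ι} (heS : e ∈ S) (ha : ∀ i ∈ S, 0 < a i) (hodd : ∀ i ∈ S, i ≠ e → Odd (a i))
  (heven : Even (a e)) (hε : ∀ i ∈ S, ε i = 1 ∨ ε i = -1) (hκ : 2 * κ = ∑ i ∈ S, ε i)

-- If k = 0, the right side has too small a degree to have a coefficient at Σ a_j, which is κ on the
-- left. If k > 0, the constant term must vanish; up to a common sign it is -2κ + κ.
include heS ha hκ in
theorem eq_zero_of_isMonomialTimes_even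
    (h : IsMonomialTimes (S.card - 1)
      (signedSum S a ε + C κ * ∏ j ∈ S, (X ^ a j - 1))) : κ = 0 := by
  obtain ⟨k, η, hη, h⟩ := h
  have hcard : 0 < S.card := Finset.card_pos.2 ⟨e, heS⟩
  rcases Nat.eq_zero_or_pos k with rfl | hk
  · have h1 := congrArg (fun P => P.coeff (∑ j ∈ S, a j)) h
    have h2 := card_le_sum ha
    have h3 := (prod_X_pow_sub_one_monic ha).coeff_natDegree
    rw [prod_X_pow_sub_one_natDegree ha] at h3
    simp only [coeff_add, coeff_C_mul] at h1
    rw [coeff_monomialTimes_of_lt (by omega), coeff_signedSum ha le_rfl, h3] at h1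
    simpa using h1
  · have h1 := congrArg (eval 0) h
    rw [eval_add, eval_zero_signedSum ha, eval_mul, eval_C, eval_zero_prod ha, ← hκ] at h1
    simp only [eval_mul, eval_pow, eval_X, zero_pow hk.ne', mul_zero, zero_mul] at h1
    have h2 : -(-1) ^ S.card * κ = 0 := by linear_combination h1
    simpa using h2

-- Symmetry gives Σ a_j = 2k + `S.card` - 1, and the signed count of every value below k vanishes.
-- Therefore a_e, the only even value, is at least k, and so is some other a_r. This leaves room
-- only for a_e + a_r = 2k + 1 and ones elsewhere.
include heS ha hodd heven hε hκ in
theorem of_isMonomialTimes_even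
    (h : IsMonomialTimes (S.card - 1)
      (signedSum S a ε + C κ * ∏ j ∈ S, (X ^ a j - 1))) :
    ∑ i ∈ S, ε i = 0 ∧ (((∀ i ∈ S, i ≠ e → a i = 1) ∧ a e = 2) ∨
      ∃ r ∈ S, r ≠ e ∧ a r ≠ 1 ∧ (∀ i ∈ S, i ≠ e → i ≠ r → a i = 1) ∧
        (a r = a e + 1 ∨ a e = a r + 1) ∧ ∑ i ∈ S with a i = 1, ε i = 0) := by
  have hκ0 := eq_zero_of_isMonomialTimes_even heS ha hκ h
  subst hκ0
  have hε0 : ∑ i ∈ S, ε i = 0 := by rw [← hκ, mul_zero]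
  refine ⟨hε0, ?_⟩
  rw [C_0, zero_mul, add_zero] at h
  obtain ⟨k, η, hη, h⟩ := h
  have hcard : 0 < S.card := Finset.card_pos.2 ⟨e, heS⟩
  have hA : ∑ j ∈ S, a j = 2 * k + (S.card - 1) := by
    refine eq_of_aeval_eq hη h ?_
    rw [aeval_inv_two_signedSum ha hε0]
    congr 1
    obtain ⟨c, hc⟩ := Nat.exists_eq_add_of_lt hcard
    rw [hc, zero_add, Nat.add_sub_cancel, pow_succ]
    ring
  have hk : 0 < k := by
    have h1 : a e ≤ ∑ j ∈ S, a j := Finset.single_le_sum (fun _ _ => Nat.zero_le _) heS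
    have h2 := Finset.card_erase_of_mem heS
    have h3 := Finset.add_sum_erase S a heS
    have h4 := card_le_sum (S := S.erase e) fun j hj => ha j (Finset.mem_of_mem_erase hj)
    have h5 := ha e heS
    obtain ⟨c, hc⟩ := heven
    omega
  have hdvd : ∀ m, 0 < m → m < k → ∑ i ∈ S with a i ∣ m, ε i = 0 := by
    intro m hm hmk
    have h1 := coe_dvd_of_eq h
    rw [coe_signedSum ha hε0, (isUnit_coe_prod ha).neg.dvd_mul_left, PowerSeries.X_pow_dvd_iff] at h1
    rw [← coeff_sum_multiplesSeries hm, h1 m hmk]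
  have hval := sum_eq_zero_of_sum_dvd_eq_zero ha hdvd
  have hae : k ≤ a e := by
    by_contra! hlt
    have h1 := hval _ hlt
    have h2 : S.filter (fun i => a i = a e) = {e} := by
      ext i
      simp only [Finset.mem_filter, Finset.mem_singleton]
      refine ⟨fun hi => ?_, by rintro rfl; exact ⟨heS, rfl⟩⟩
      by_contra hne
      have := hodd i hi.1 hne
      rw [hi.2] at this
      exact Nat.not_even_iff_odd.2 this heven
    rw [h2, Finset.sum_singleton] at h1
    rcases hε e heS with h3 | h3 <;> omega
  -- Otherwise the signs of all indices but `e` would cancel value by value, which leaves ε_e = 0.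
  obtain ⟨r, hrS, hre, har⟩ : ∃ r ∈ S, r ≠ e ∧ k ≤ a r := by
    by_contra! hlt
    have h1 : ∑ i ∈ S.erase e, ε i = 0 := by
      have h2 : ∀ i ∈ S.erase e, a i ∈ Finset.range k := fun i hi =>
        Finset.mem_range.2 (hlt i (Finset.mem_of_mem_erase hi) (Finset.ne_of_mem_erase hi))
      rw [← Finset.sum_fiberwise_of_maps_to h2]
      refine Finset.sum_eq_zero fun d hd => ?_
      by_cases hde : d = a e
      · rw [Finset.filter_false_of_mem, Finset.sum_empty]
        intro i hi h3
        have := hodd i (Finset.mem_of_mem_erase hi) (Finset.ne_of_mem_erase hi)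
        rw [h3, hde] at this
        exact Nat.not_even_iff_odd.2 this heven
      · rw [← hval d (Finset.mem_range.1 hd)]
        refine Finset.sum_congr ?_ fun _ _ => rfl
        ext i
        simp only [Finset.mem_filter, Finset.mem_erase]
        exact ⟨fun h => ⟨h.1.2, h.2⟩, fun h => ⟨⟨fun h' => hde (h' ▸ h.2.symm), h.1⟩, h.2⟩⟩
    rw [← Finset.add_sum_erase _ _ heS, h1] at hε0
    rcases hε e heS with h3 | h3 <;> omega
  have hrS' : r ∈ S.erase e := Finset.mem_erase.2 ⟨hre, hrS⟩
  have hsum1 := Finset.add_sum_erase S a heS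
  have hsum2 := Finset.add_sum_erase (S.erase e) a hrS'
  have hc1 := Finset.card_erase_of_mem heS
  have hc2 := Finset.card_erase_of_mem hrS'
  have hc3 : 0 < (S.erase e).card := Finset.card_pos.2 ⟨r, hrS'⟩
  have hrest := card_le_sum (S := (S.erase e).erase r)
    fun j hj => ha j (Finset.mem_of_mem_erase (Finset.mem_of_mem_erase hj))
  have hro := hodd r hrS hre
  have hone : ∀ i ∈ S, i ≠ e → i ≠ r → a i = 1 := by
    have h1 : ∑ j ∈ (S.erase e).erase r, 1 = ∑ j ∈ (S.erase e).erase r, a j := by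
      rw [← Finset.card_eq_sum_ones]
      obtain ⟨x, hx⟩ := heven
      obtain ⟨y, hy⟩ := hro
      omega
    intro i hi hie hir
    exact ((Finset.sum_eq_sum_iff_of_le fun j hj => ha j (Finset.mem_of_mem_erase
      (Finset.mem_of_mem_erase hj))).1 h1 i (by simp [hi, hie, hir])).symm
  have hsize : (a r = a e + 1 ∨ a e = a r + 1) ∧ a e + a r = 2 * k + 1 := by
    obtain ⟨x, hx⟩ := heven
    obtain ⟨y, hy⟩ := hro
    omega
  by_cases har1 : a r = 1
  · left
    refine ⟨fun i hi hie => ?_, ?_⟩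
    · by_cases hir : i = r
      · rw [hir, har1]
      · exact hone i hi hie hir
    · have := ha e heS
      omega
  · right
    -- The value 1 lies below k: a_r is odd and not 1, so a_r ≥ 3, a_e ≥ 2 and k ≥ 2.
    refine ⟨r, hrS, hre, har1, hone, hsize.1, hval 1 ?_⟩
    obtain ⟨y, hy⟩ := hro
    omega

-- The fractions with a_i = 1 have total sign -ε_e, and over the denominator X² - 1 the numerator is
-- ε_e - ε_e(X + 1) = -ε_e X.
include heS in
theorem isMonomialTimes_of_units (hε : ∀ i ∈ S, ε i = 1 ∨ ε i = -1) (hε0 : ∑ i ∈ S, ε i = 0)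
    (hone : ∀ i ∈ S, i ≠ e → a i = 1) (hae : a e = 2) :
    IsMonomialTimes (S.card - 1) (signedSum S a ε) := by
  have h1 := mul_signedSum (ε := ε) (S := S) (a := a) ((X - 1) * (X + 1))
    (fun i => if i = e then 1 else X + 1) (fun i hi => by
      split_ifs with h
      · rw [h, hae]; ring
      · rw [hone i hi h]; ring)
  have hV : ∏ j ∈ S, (X ^ a j - 1 : ℤ[X]) = (X - 1) * (X + 1) * (X - 1) ^ (S.card - 1) := by
    rw [← Finset.mul_prod_erase _ _ heS, hae, Finset.prod_congr rfl
      fun j hj => by rw [hone j (Finset.mem_of_mem_erase hj) (Finset.ne_of_mem_erase hj), pow_one],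
      Finset.prod_const, Finset.card_erase_of_mem heS]
    ring
  have hsum : ∑ i ∈ S, C (ε i) * (if i = e then 1 else X + 1 : ℤ[X]) = C (-ε e) * X := by
    rw [← Finset.add_sum_erase _ _ heS, Finset.sum_congr rfl fun i hi => by
      rw [if_neg (Finset.ne_of_mem_erase hi)], ← Finset.sum_mul, ← map_sum]
    rw [← Finset.add_sum_erase _ _ heS] at hε0
    rw [eq_neg_of_add_eq_zero_right hε0, if_pos rfl, C_neg]
    ring
  rw [hV, hsum, mul_assoc ((X - 1) * (X + 1) : ℤ[X])] at h1
  have h2 := mul_left_cancel₀ (mul_ne_zero X_sub_one_ne_zero' (X_add_C_ne_zero 1)) h1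
  refine ⟨1, -ε e, ?_, by rw [h2]; ring⟩
  rcases hε e heS with h3 | h3 <;> simp [h3]

-- The fractions with a_i = 1 cancel. The other two have the numerator ε_e(X^{a_r} - X^{a_e}), which
-- is ± a monomial times X - 1 for consecutive exponents.
include heS in
theorem isMonomialTimes_of_pair (ha : ∀ i ∈ S, 0 < a i) (hε : ∀ i ∈ S, ε i = 1 ∨ ε i = -1)
    (hε0 : ∑ i ∈ S, ε i = 0) {r : ι} (hrS : r ∈ S) (hre : r ≠ e) (har : a r ≠ 1) (hae : a e ≠ 1)
    (hone : ∀ i ∈ S, i ≠ e → i ≠ r → a i = 1) (hsize : a r = a e + 1 ∨ a e = a r + 1)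
    (hu : ∑ i ∈ S with a i = 1, ε i = 0) :
    IsMonomialTimes (S.card - 1) (signedSum S a ε) := by
  have hrS' : r ∈ S.erase e := Finset.mem_erase.2 ⟨hre, hrS⟩
  have hc1 := Finset.card_erase_of_mem heS
  have hc2 := Finset.card_erase_of_mem hrS'
  have hc3 : 0 < (S.erase e).card := Finset.card_pos.2 ⟨r, hrS'⟩
  have h1 := mul_signedSum (ε := ε) (S := S) (a := a) ((X - 1) * (X ^ a e - 1) * (X ^ a r - 1))
    (fun i => if i = e then (X - 1) * (X ^ a r - 1) else
      if i = r then (X - 1) * (X ^ a e - 1) else (X ^ a e - 1) * (X ^ a r - 1)) (fun i hi => by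
      split_ifs with h h'
      · rw [h]; ring
      · rw [h']
      · rw [hone i hi h h']; ring)
  have hV : ∏ j ∈ S, (X ^ a j - 1 : ℤ[X]) =
      (X ^ a e - 1) * (X ^ a r - 1) * (X - 1) ^ (S.card - 2) := by
    rw [← Finset.mul_prod_erase _ _ heS, ← Finset.mul_prod_erase _ _ hrS', Finset.prod_congr rfl
      fun j hj => by rw [hone j (Finset.mem_of_mem_erase (Finset.mem_of_mem_erase hj))
        (Finset.ne_of_mem_erase (Finset.mem_of_mem_erase hj)) (Finset.ne_of_mem_erase hj), pow_one],
      Finset.prod_const, hc2, hc1, Nat.sub_sub]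
    ring
  have hfil : S.filter (fun i => a i = 1) = (S.erase e).erase r := by
    ext i
    simp only [Finset.mem_filter, Finset.mem_erase]
    exact ⟨fun h => ⟨fun h' => har (h' ▸ h.2), fun h' => hae (h' ▸ h.2), h.1⟩,
      fun h => ⟨h.2.2, hone i h.2.2 h.2.1 h.1⟩⟩
  rw [hfil] at hu
  have hεr : ε r = -ε e := by
    rw [← Finset.add_sum_erase _ _ heS, ← Finset.add_sum_erase _ _ hrS', hu] at hε0
    omega
  have hsum : ∑ i ∈ S, C (ε i) * (if i = e then (X - 1) * (X ^ a r - 1) else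
      if i = r then (X - 1) * (X ^ a e - 1) else (X ^ a e - 1) * (X ^ a r - 1) : ℤ[X]) =
        (X - 1) * C (ε e) * (X ^ a r - X ^ a e) := by
    rw [← Finset.add_sum_erase _ _ heS, ← Finset.add_sum_erase _ _ hrS', Finset.sum_congr rfl
      fun i hi => by rw [if_neg (Finset.ne_of_mem_erase (Finset.mem_of_mem_erase hi)),
        if_neg (Finset.ne_of_mem_erase hi)], ← Finset.sum_mul, ← map_sum, hu, if_pos rfl,
      if_neg hre, if_pos rfl, hεr, C_neg, C_0]
    ring
  rw [hV, hsum] at h1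
  have h2 : signedSum S a ε = C (ε e) * (X ^ a r - X ^ a e) * (X - 1) ^ (S.card - 2) := by
    have hne : ((X - 1) * (X ^ a e - 1) * (X ^ a r - 1) : ℤ[X]) ≠ 0 :=
      mul_ne_zero (mul_ne_zero X_sub_one_ne_zero' (X_pow_sub_one_monic (ha e heS)).ne_zero)
        (X_pow_sub_one_monic (ha r hrS)).ne_zero
    refine mul_left_cancel₀ hne (h1.trans ?_)
    ring
  have hc4 : S.card - 1 = S.card - 2 + 1 := by omega
  rcases hsize with h3 | h3
  · refine ⟨a e, ε e, hε e heS, ?_⟩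
    rw [h2, h3, hc4]
    ring
  · refine ⟨a r, ε r, hε r hrS, ?_⟩
    rw [h2, h3, hc4, hεr, C_neg]
    ring

end Even

/-! ### One antiparallel band: the remaining exponents are odd. -/

section Odd

variable (ha : ∀ i ∈ S, 0 < a i) (hodd : ∀ i ∈ S, Odd (a i)) (hκ : 2 * κ = ∑ i ∈ S, ε i) {h : ℤ}
  (hh : h ≠ 0)

include ha hκ hh in
theorem eq_zero_of_isMonomialTimes_odd
    (hP : IsMonomialTimes S.card (X * ∏ j ∈ S, (X ^ a j - 1) + C h * (X ^ 2 - 1) *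
      (signedSum S a ε + C κ * ∏ j ∈ S, (X ^ a j - 1)))) : κ = 0 := by
  obtain ⟨k, η, hη, hP⟩ := hP
  rcases Nat.eq_zero_or_pos k with rfl | hk
  · have h1 := congrArg (fun P => P.coeff (∑ j ∈ S, a j + 2)) hP
    have h2 := card_le_sum ha
    have h3 := (prod_X_pow_sub_one_monic ha).coeff_natDegree
    have h4 := prod_X_pow_sub_one_natDegree ha
    rw [h4] at h3
    have h5 : ∀ i, 0 < i → (∏ j ∈ S, (X ^ a j - 1) : ℤ[X]).coeff (∑ j ∈ S, a j + i) = 0 :=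
      fun i hi => coeff_eq_zero_of_natDegree_lt (by omega)
    have h6 : ∀ P : ℤ[X], C h * (X ^ 2 - 1) * P = C h * (P * X ^ 2 - P) := fun P => by ring
    simp only [h6, coeff_add, coeff_C_mul, coeff_sub, coeff_mul_X_pow, coeff_X_mul] at h1
    rw [coeff_monomialTimes_of_lt (by omega), coeff_signedSum ha le_rfl,
      coeff_signedSum ha (by omega), h3, h5 1 one_pos, h5 2 two_pos] at h1
    simpa [hh] using h1
  · have h1 := congrArg (eval 0) hP
    simp only [eval_add, eval_mul, eval_sub, eval_pow, eval_X, eval_C, eval_one,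
      eval_zero_signedSum ha, eval_zero_prod ha, ← hκ, zero_pow hk.ne', mul_zero, zero_mul] at h1
    have h2 : h * ((-1) ^ S.card * κ) = 0 := by linear_combination h1
    simpa [hh] using h2

-- After division by the invertible product, a series divisible by X^k remains. Its coefficients at
-- X and X² are 1 + hu and hu with the same signed count u of ones, because an odd divisor of 2 is
-- 1. They cannot both vanish, so k ≤ 2, and Σ a_j + 2 = 2k + `S.card` permits at most one exponent
-- 3 besides ones.
include ha hodd hκ hh in
theorem of_isMonomialTimes_odd
    (hP : IsMonomialTimes S.card (X * ∏ j ∈ S, (X ^ a j - 1) + C h * (X ^ 2 - 1) *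
      (signedSum S a ε + C κ * ∏ j ∈ S, (X ^ a j - 1)))) :
    ∑ i ∈ S, ε i = 0 ∧ ((∀ i ∈ S, a i = 1) ∨
      ∃ r ∈ S, a r = 3 ∧ (∀ i ∈ S, i ≠ r → a i = 1) ∧ 1 + h * ∑ i ∈ S with a i = 1, ε i = 0) := by
  have hκ0 := eq_zero_of_isMonomialTimes_odd ha hκ hh hP
  subst hκ0
  have hε0 : ∑ i ∈ S, ε i = 0 := by rw [← hκ, mul_zero]
  refine ⟨hε0, ?_⟩
  rw [C_0, zero_mul, add_zero] at hP
  obtain ⟨k, η, hη, hP⟩ := hP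
  have hA : ∑ j ∈ S, a j + 2 = 2 * k + S.card := by
    refine eq_of_aeval_eq hη hP ?_
    have h1 := aeval_inv_two_signedSum ha hε0
    have h2 := prod_inv_two (S := S) (a := a)
    simp only [map_add, map_mul, map_prod, map_sub, map_pow, aeval_X, map_one, aeval_C, pow_add]
    linear_combination 2 * h2 + (algebraMap ℤ ℚ h) * (2⁻¹ ^ 2 - 1) * 4 * h1
  have hcoeff : ∀ m, m < k → PowerSeries.coeff m (PowerSeries.X + PowerSeries.C h *
      (1 - PowerSeries.X ^ 2) * ∑ i ∈ S, PowerSeries.C (ε i) * multiplesSeries (a i)) = 0 := by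
    have h1 := coe_dvd_of_eq hP
    rw [← PowerSeries.X_pow_dvd_iff]
    have h2 : ((X * ∏ j ∈ S, (X ^ a j - 1) + C h * (X ^ 2 - 1) * signedSum S a ε : ℤ[X]) :
        PowerSeries ℤ) = ((∏ j ∈ S, (X ^ a j - 1) : ℤ[X]) : PowerSeries ℤ) *
          (PowerSeries.X + PowerSeries.C h * (1 - PowerSeries.X ^ 2) *
            ∑ i ∈ S, PowerSeries.C (ε i) * multiplesSeries (a i)) := by
      rw [coe_add, coe_mul, coe_mul, coe_mul, coe_signedSum ha hε0, coe_sub, coe_X, coe_C, coe_pow,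
        coe_X, coe_one]
      ring
    rwa [h2, (isUnit_coe_prod ha).dvd_mul_left] at h1
  set G := ∑ i ∈ S, PowerSeries.C (ε i) * multiplesSeries (a i) with hG
  have hrw : PowerSeries.X + PowerSeries.C h * (1 - PowerSeries.X ^ 2) * G =
      PowerSeries.X + PowerSeries.C h * (G - PowerSeries.X ^ 2 * G) := by ring
  have hdvd1 : S.filter (fun i => a i ∣ 1) = S.filter (fun i => a i = 1) := by simp
  have hdvd2 : S.filter (fun i => a i ∣ 2) = S.filter (fun i => a i = 1) := by
    refine Finset.filter_congr fun i hi => ?_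
    rw [Nat.dvd_prime Nat.prime_two]
    refine ⟨fun h => h.resolve_right fun h2 => ?_, Or.inl⟩
    have := hodd i hi
    rw [h2] at this
    exact absurd this (by decide)
  have hc1 : 1 < k → 1 + h * ∑ i ∈ S with a i = 1, ε i = 0 := by
    intro hk
    have h1 := hcoeff 1 hk
    rw [hrw, map_add, PowerSeries.coeff_C_mul, map_sub, PowerSeries.coeff_X_pow_mul',
      PowerSeries.coeff_one_X, hG, coeff_sum_multiplesSeries one_pos, hdvd1] at h1
    simpa using h1
  have hc2 : 2 < k → h * ∑ i ∈ S with a i = 1, ε i = 0 := by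
    intro hk
    have h1 := hcoeff 2 hk
    have h0 : PowerSeries.constantCoeff G = 0 := by
      rw [hG, map_sum]
      refine Finset.sum_eq_zero fun i _ => ?_
      rw [map_mul, ← PowerSeries.coeff_zero_eq_constantCoeff_apply (multiplesSeries _),
        multiplesSeries, PowerSeries.coeff_mk]
      simp
    rw [hrw, map_add, PowerSeries.coeff_C_mul, map_sub, PowerSeries.coeff_X_pow_mul',
      PowerSeries.coeff_X] at h1
    simp only [le_refl, if_true, Nat.sub_self, PowerSeries.coeff_zero_eq_constantCoeff, h0] at h1
    rw [hG, coeff_sum_multiplesSeries two_pos, hdvd2] at h1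
    simpa using h1
  have hk2 : k ≤ 2 := by
    by_contra! hk
    have := hc1 (by omega)
    have := hc2 hk
    omega
  by_cases hall : ∀ i ∈ S, a i = 1
  · exact Or.inl hall
  · right
    push Not at hall
    obtain ⟨r, hrS, hr⟩ := hall
    have h1 := Finset.add_sum_erase S a hrS
    have h2 := Finset.card_erase_of_mem hrS
    have h3 := card_le_sum (S := S.erase r) fun j hj => ha j (Finset.mem_of_mem_erase hj)
    have h4 : 0 < S.card := Finset.card_pos.2 ⟨r, hrS⟩
    obtain ⟨y, hy⟩ := hodd r hrS
    have h5 : ∑ j ∈ S.erase r, 1 = ∑ j ∈ S.erase r, a j := by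
      rw [← Finset.card_eq_sum_ones]
      omega
    refine ⟨r, hrS, by omega, fun i hi hir => ?_, hc1 (by omega)⟩
    exact ((Finset.sum_eq_sum_iff_of_le fun j hj => ha j (Finset.mem_of_mem_erase hj)).1 h5 i
      (Finset.mem_erase.2 ⟨hir, hi⟩)).symm

theorem isMonomialTimes_of_all_units (hε0 : ∑ i ∈ S, ε i = 0) (hone : ∀ i ∈ S, a i = 1) :
    IsMonomialTimes S.card (X * ∏ j ∈ S, (X ^ a j - 1) + C h * (X ^ 2 - 1) *
      signedSum S a ε) := by
  have h1 := mul_signedSum (ε := ε) (S := S) (a := a) (X - 1) (fun i => 1)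
    (fun i hi => by rw [hone i hi]; ring)
  simp only [mul_one] at h1
  rw [← map_sum, hε0, C_0, mul_zero] at h1
  rw [(mul_eq_zero.1 h1).resolve_left X_sub_one_ne_zero']
  refine ⟨1, 1, Or.inl rfl, ?_⟩
  rw [Finset.prod_congr rfl fun j hj => by rw [hone j hj, pow_one], Finset.prod_const]
  simp

/-- With hu = -1 the factor next to (X - 1)^card is X(X² + X + 1) - (X + 1)(X² + X) = -X². -/
theorem isMonomialTimes_of_three (hε0 : ∑ i ∈ S, ε i = 0) {r : ι} (hrS : r ∈ S) (har : a r = 3)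
    (hone : ∀ i ∈ S, i ≠ r → a i = 1) (hu : 1 + h * ∑ i ∈ S with a i = 1, ε i = 0) :
    IsMonomialTimes S.card (X * ∏ j ∈ S, (X ^ a j - 1) + C h * (X ^ 2 - 1) *
      signedSum S a ε) := by
  have h1 := mul_signedSum (ε := ε) (S := S) (a := a) ((X - 1) * (X ^ 2 + X + 1))
    (fun i => if i = r then 1 else X ^ 2 + X + 1) (fun i hi => by
      split_ifs with h
      · rw [h, har]; ring
      · rw [hone i hi h]; ring)
  have hfil : S.filter (fun i => a i = 1) = S.erase r := by
    ext i
    simp only [Finset.mem_filter, Finset.mem_erase]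
    exact ⟨fun h => ⟨fun h' => by rw [h', har] at h; omega, h.1⟩,
      fun h => ⟨h.2, hone i h.2 h.1⟩⟩
  rw [hfil] at hu
  have hsum : ∑ i ∈ S, C (ε i) * (if i = r then 1 else X ^ 2 + X + 1 : ℤ[X]) =
      C (∑ i ∈ S.erase r, ε i) * (X ^ 2 + X) := by
    rw [← Finset.add_sum_erase _ _ hrS, Finset.sum_congr rfl fun i hi => by
      rw [if_neg (Finset.ne_of_mem_erase hi)], ← Finset.sum_mul, ← map_sum]
    rw [← Finset.add_sum_erase _ _ hrS] at hε0
    rw [eq_neg_of_add_eq_zero_left hε0, if_pos rfl, C_neg]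
    ring
  have hV : ∏ j ∈ S, (X ^ a j - 1 : ℤ[X]) = (X ^ 2 + X + 1) * (X - 1) ^ S.card := by
    rw [← Finset.mul_prod_erase _ _ hrS, har, Finset.prod_congr rfl
      fun j hj => by rw [hone j (Finset.mem_of_mem_erase hj) (Finset.ne_of_mem_erase hj), pow_one],
      Finset.prod_const, ← Finset.card_erase_add_one hrS]
    ring
  have hu' : C h * C (∑ i ∈ S.erase r, ε i) = (-1 : ℤ[X]) := by
    rw [← C_mul, eq_neg_of_add_eq_zero_right hu, C_neg, C_1]
  refine ⟨2, -1, Or.inr rfl, ?_⟩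
  have hne : ((X - 1) * (X ^ 2 + X + 1) : ℤ[X]) ≠ 0 := by
    have : ((X - 1) * (X ^ 2 + X + 1) : ℤ[X]) = X ^ 3 - 1 := by ring
    rw [this]
    exact (X_pow_sub_one_monic (by norm_num)).ne_zero
  refine mul_left_cancel₀ hne ?_
  rw [hsum] at h1
  rw [hV] at h1 ⊢
  rw [C_neg, C_1]
  linear_combination C h * (X ^ 2 - 1) * h1 +
    (X ^ 2 - 1) * (X ^ 2 + X + 1) * (X - 1) ^ S.card * (X ^ 2 + X) * hu'

end Odd

end SignedSumCriteria

/-! ## Parallel bands and polynomials in `s = -t` -/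

section ParallelBands

open Polynomial
open LaurentPolynomial hiding C

/-- The evaluation of integer polynomials at `s = -t`. -/
noncomputable def evalNegT : ℤ[X] →ₐ[ℤ] ℤ[T;T⁻¹] := aeval negT

theorem evalNegT_X : evalNegT X = negT := aeval_X _

theorem evalNegT_C (x : ℤ) : evalNegT (C x) = (x : ℤ[T;T⁻¹]) := by
  simp [evalNegT]

theorem evalNegT_eq (P : ℤ[X]) : evalNegT P = toLaurent (P.comp (-X)) := by
  have h : evalNegT = toLaurentAlg.comp (aeval (-X : ℤ[X])) := by
    ext
    simp [evalNegT, negT]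
  rw [h]
  rfl

theorem evalNegT_injective : Function.Injective evalNegT := by
  intro P Q h
  rw [evalNegT_eq, evalNegT_eq] at h
  have := congrArg (fun R => R.comp (-X)) (toLaurent_injective h)
  simpa [comp_assoc] using this

/-- Laurent units are ± t^k with k of either sign. A negative k is impossible because (X - 1)^N does
not vanish at 0. -/
theorem isUnit_iff_isMonomialTimes {Θ U : ℤ[T;T⁻¹]} {N : ℕ} {P : ℤ[X]} (hU : IsUnit U)
    (h : Θ * (negT - 1) ^ N = U * evalNegT P) : IsUnit Θ ↔ IsMonomialTimes N P := by
  have hs := pow_ne_zero N negT_sub_one_ne_zero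
  constructor
  · intro hΘ
    obtain ⟨V, hV⟩ := hU.exists_left_inv
    have hVU : IsUnit (V * Θ) := (IsUnit.of_mul_eq_one _ hV).mul hΘ
    have hP : evalNegT P = V * Θ * (negT - 1) ^ N := by
      linear_combination (-V) * h - evalNegT P * hV
    obtain ⟨k, hk⟩ := (eqUpToUnit_one_iff _).2 hVU
    obtain ⟨η, hη, hk⟩ : ∃ η : ℤ, (η = 1 ∨ η = -1) ∧ V * Θ = (η : ℤ[T;T⁻¹]) * T k := by
      rcases hk with hk | hk
      · exact ⟨1, Or.inl rfl, by rw [hk]; simp⟩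
      · exact ⟨-1, Or.inr rfl, by rw [hk]; simp⟩
    rw [hk] at hP
    have hT : ∀ m : ℕ, (T (m : ℤ) : ℤ[T;T⁻¹]) = evalNegT ((-X) ^ m) := fun m => by
      rw [map_pow, map_neg, evalNegT_X, negT, neg_neg, T_pow, mul_one]
    have hs1 : negT - 1 = evalNegT (X - 1) := by rw [map_sub, evalNegT_X, map_one]
    rcases Int.eq_nat_or_neg k with ⟨m, rfl | rfl⟩
    · rw [hT, hs1, ← evalNegT_C, ← map_pow, ← map_mul, ← map_mul] at hP
      refine ⟨m, η * (-1) ^ m, ?_, ?_⟩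
      · rcases hη with rfl | rfl <;> rcases neg_one_pow_eq_or ℤ m with h | h <;> simp [h]
      · rw [evalNegT_injective hP, neg_pow (X : ℤ[X]), C_mul, C_pow, C_neg, C_1]
        ring
    · have hP' : evalNegT ((-X) ^ m * P) = evalNegT (C η * (X - 1) ^ N) := by
        rw [map_mul, map_mul, evalNegT_C, map_pow _ (X - 1), ← hs1, ← hT, hP]
        have : (T (m : ℤ) * T (-(m : ℤ)) : ℤ[T;T⁻¹]) = 1 := by
          rw [← T_add, add_neg_cancel, T_zero]
        linear_combination (η * (negT - 1) ^ N) * this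
      have hP2 := evalNegT_injective hP'
      rcases Nat.eq_zero_or_pos m with rfl | hm
      · exact ⟨0, η, hη, by simpa using hP2⟩
      · have := congrArg (eval 0) hP2
        have h1 := pow_ne_zero N (neg_ne_zero.2 one_ne_zero : (-1 : ℤ) ≠ 0)
        rcases hη with rfl | rfl <;> simp [hm.ne', h1.symm] at this
  · rintro ⟨k, η, hη, rfl⟩
    have h1 : Θ = U * (η * negT ^ k) := by
      refine mul_right_cancel₀ hs ?_
      rw [h, map_mul, map_mul, map_pow, map_pow, map_sub, evalNegT_C, evalNegT_X, map_one]
      ring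
    rw [h1]
    refine hU.mul (IsUnit.mul ?_ (isUnit_negT.pow k))
    rcases hη with rfl | rfl <;> simp

/-- The unit by which `bandTheta q b` differs from the quotient of `s ^ |q| - 1` by `s - 1`. -/
noncomputable def bandUnit (q : ℤ) (b : Bool) : ℤ[T;T⁻¹] :=
  q.sign * (if b = decide (0 < q) then 1 else negTInv ^ q.natAbs)

/-- The signed defect of `bandUnit q b`. -/
def bandDefect (q : ℤ) (b : Bool) : ℤ := if b = decide (0 < q) then 0 else q.sign

theorem bandTheta_mul_sub_one (q : ℤ) (b : Bool) : bandTheta q b * (negT - 1) =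
    bandUnit q b * evalNegT (X ^ q.natAbs - 1) := by
  rw [bandTheta_mul, bandUnit, map_sub, map_pow, evalNegT_X, map_one]

theorem isUnit_sign {q : ℤ} (hq : q ≠ 0) : IsUnit (q.sign : ℤ[T;T⁻¹]) := by
  rcases hq.lt_or_gt with h | h
  · simp [Int.sign_eq_neg_one_of_neg h]
  · simp [Int.sign_eq_one_of_pos h]

theorem isUnit_bandUnit {q : ℤ} (hq : q ≠ 0) (b : Bool) : IsUnit (bandUnit q b) := by
  refine (isUnit_sign hq).mul ?_
  split_ifs
  · exact isUnit_one
  · exact isUnit_negTInv.pow _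

/-- The inverse unit is the sign of q, possibly times s^|q|. Writing s^|q| = 1 + (s^|q| - 1)
separates a part that later cancels the denominator s^|q| - 1. -/
theorem bandUnit_mul {q : ℤ} (hq : q ≠ 0) (b : Bool) : bandUnit q b *
    evalNegT (C q.sign + C (bandDefect q b) * (X ^ q.natAbs - 1)) = 1 := by
  have h : negTInv ^ q.natAbs * negT ^ q.natAbs = 1 := by
    rw [← mul_pow, mul_comm, negT_mul_negTInv, one_pow]
  have h2 : (q.sign : ℤ[T;T⁻¹]) * q.sign = 1 := by
    rcases hq.lt_or_gt with h | h
    · simp [Int.sign_eq_neg_one_of_neg h]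
    · simp [Int.sign_eq_one_of_pos h]
  simp only [map_add, map_mul, map_sub, map_pow, evalNegT_C, evalNegT_X, map_one]
  rw [bandUnit, bandDefect]
  split_ifs
  · simp [h2]
  · linear_combination h + (negTInv ^ q.natAbs * negT ^ q.natAbs) * h2

theorem two_mul_bandDefect {q : ℤ} (hq : q ≠ 0) (b : Bool) :
    2 * bandDefect q b = q.sign - dirExp b := by
  rcases hq.lt_or_gt with h | h
  · cases b <;> simp [bandDefect, dirExp, Int.sign_eq_neg_one_of_neg h, h.not_gt]
  · cases b <;> simp [bandDefect, dirExp, Int.sign_eq_one_of_pos h, h]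

variable {ι : Type*} {S : Finset ι} {q : ι → ℤ}

theorem prod_bandTheta_mul (b : ι → Bool) :
    (∏ j ∈ S, bandTheta (q j) (b j)) * (negT - 1) ^ S.card =
      (∏ j ∈ S, bandUnit (q j) (b j)) * evalNegT (∏ j ∈ S, (X ^ (q j).natAbs - 1)) := by
  rw [← Finset.prod_const, ← Finset.prod_mul_distrib, map_prod, ← Finset.prod_mul_distrib]
  exact Finset.prod_congr rfl fun j _ => bandTheta_mul_sub_one _ _

/-- The sum is ∏ θ_j times Σ 1/θ_i, and by `bandUnit_mul` 1/θ_i is s - 1 times sign/(s^|q_i| - 1)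
plus the defect. The defects add up to the multiple of the full product. -/
theorem sum_prod_erase_bandTheta_mul [DecidableEq ι] (hq : ∀ i ∈ S, q i ≠ 0) (b : ι → Bool) :
    (∑ i ∈ S, ∏ j ∈ S.erase i, bandTheta (q j) (b j)) * (negT - 1) ^ S.card =
      (∏ j ∈ S, bandUnit (q j) (b j)) * (negT - 1) *
        evalNegT (signedSum S (fun i => (q i).natAbs) (fun i => (q i).sign) +
          C (∑ i ∈ S, bandDefect (q i) (b i)) * ∏ j ∈ S, (X ^ (q j).natAbs - 1)) := by
  rw [signedSum, map_sum C, Finset.sum_mul, Finset.sum_mul, ← Finset.sum_add_distrib, map_sum,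
    Finset.mul_sum]
  refine Finset.sum_congr rfl fun i hi => ?_
  rw [← Finset.card_erase_add_one hi, pow_succ, ← mul_assoc, prod_bandTheta_mul,
    ← Finset.mul_prod_erase _ _ hi, ← Finset.mul_prod_erase S (fun j => (X ^ (q j).natAbs - 1)) hi,
    ← mul_assoc (C _), ← add_mul, map_mul]
  linear_combination -(∏ j ∈ S.erase i, bandUnit (q j) (b j)) *
    evalNegT (∏ j ∈ S.erase i, (X ^ (q j).natAbs - 1)) * (negT - 1) * bandUnit_mul (hq i hi) (b i)

theorem isUnit_prod_bandUnit (hq : ∀ i ∈ S, q i ≠ 0) (b : ι → Bool) :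
    IsUnit (∏ j ∈ S, bandUnit (q j) (b j)) :=
  IsUnit.prod_iff.2 fun j hj => isUnit_bandUnit (hq j hj) _

/-- The directions cancel in total, so the correction depends only on the signs of the parameters.
-/
theorem two_mul_sum_bandDefect (hq : ∀ i ∈ S, q i ≠ 0) {b : ι → Bool}
    (hb : ∑ i ∈ S, dirExp (b i) = 0) :
    2 * ∑ i ∈ S, bandDefect (q i) (b i) = ∑ i ∈ S, (q i).sign := by
  rw [Finset.mul_sum, Finset.sum_congr rfl fun i hi => two_mul_bandDefect (hq i hi) (b i),
    Finset.sum_sub_distrib, hb, sub_zero]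

theorem isUnit_prod_bandTheta_iff (hq : ∀ i ∈ S, q i ≠ 0) (b : ι → Bool) :
    IsUnit (∏ j ∈ S, bandTheta (q j) (b j)) ↔ ∀ j ∈ S, (q j).natAbs = 1 := by
  rw [isUnit_iff_isMonomialTimes (isUnit_prod_bandUnit hq b) (prod_bandTheta_mul b),
    isMonomialTimes_prod_iff fun j hj => Int.natAbs_pos.2 (hq j hj)]

theorem sign_eq_one_or_neg_one {x : ℤ} (hx : x ≠ 0) : x.sign = 1 ∨ x.sign = -1 :=
  hx.lt_or_gt.symm.imp Int.sign_eq_one_of_pos Int.sign_eq_neg_one_of_neg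

/-- All strands are parallel. -/
theorem isUnit_sum_prod_erase_iff [DecidableEq ι] {e : ι} (heS : e ∈ S) (hq : ∀ i ∈ S, q i ≠ 0)
    (hodd : ∀ i ∈ S, i ≠ e → Odd (q i)) (heven : Even (q e)) {b : ι → Bool}
    (hb : ∑ i ∈ S, dirExp (b i) = 0) :
    IsUnit (∑ i ∈ S, ∏ j ∈ S.erase i, bandTheta (q j) (b j)) ↔
      ∑ i ∈ S, (q i).sign = 0 ∧ (((∀ i ∈ S, i ≠ e → (q i).natAbs = 1) ∧ (q e).natAbs = 2) ∨
        ∃ r ∈ S, r ≠ e ∧ (q r).natAbs ≠ 1 ∧ (∀ i ∈ S, i ≠ e → i ≠ r → (q i).natAbs = 1) ∧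
          ((q r).natAbs = (q e).natAbs + 1 ∨ (q e).natAbs = (q r).natAbs + 1) ∧
            ∑ i ∈ S with (q i).natAbs = 1, (q i).sign = 0) := by
  have hcard : S.card = S.card - 1 + 1 := (Nat.succ_pred (Finset.card_ne_zero_of_mem heS)).symm
  have h1 := sum_prod_erase_bandTheta_mul hq b
  rw [hcard, pow_succ, ← mul_assoc, mul_right_comm (∏ j ∈ S, bandUnit (q j) (b j))] at h1
  have hκ := two_mul_sum_bandDefect hq hb
  have ha : ∀ i ∈ S, 0 < (q i).natAbs := fun i hi => Int.natAbs_pos.2 (hq i hi)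
  have hε : ∀ i ∈ S, (q i).sign = 1 ∨ (q i).sign = -1 := fun i hi =>
    sign_eq_one_or_neg_one (hq i hi)
  have heven' := Int.natAbs_even.2 heven
  rw [isUnit_iff_isMonomialTimes (isUnit_prod_bandUnit hq b)
    (mul_right_cancel₀ negT_sub_one_ne_zero h1)]
  refine ⟨of_isMonomialTimes_even heS ha (fun i hi hie => Int.natAbs_odd.2 (hodd i hi hie))
    heven' hε hκ, ?_⟩
  rintro ⟨h0, h2⟩
  have hκ0 : ∑ i ∈ S, bandDefect (q i) (b i) = 0 := by omega
  rw [hκ0, C_0, zero_mul, add_zero]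
  rcases h2 with ⟨h2, h3⟩ | ⟨r, hr, hre, hr1, hone, hsize, hu⟩
  · exact isMonomialTimes_of_units heS hε h0 h2 h3
  · refine isMonomialTimes_of_pair heS ha hε h0 hr hre hr1 (fun h => ?_) hone hsize hu
    rw [h] at heven'
    exact absurd heven' (by decide)

/-- One band is antiparallel. -/
theorem isUnit_prod_add_iff [DecidableEq ι] {h : ℤ} (hh : h ≠ 0) (hodd : ∀ i ∈ S, Odd (q i))
    {b : ι → Bool} (hb : ∑ i ∈ S, dirExp (b i) = 0) :
    IsUnit ((∏ j ∈ S, bandTheta (q j) (b j)) + h * (1 + negTInv) *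
        ∑ i ∈ S, ∏ j ∈ S.erase i, bandTheta (q j) (b j)) ↔
      ∑ i ∈ S, (q i).sign = 0 ∧ ((∀ i ∈ S, (q i).natAbs = 1) ∨
        ∃ r ∈ S, (q r).natAbs = 3 ∧ (∀ i ∈ S, i ≠ r → (q i).natAbs = 1) ∧
          1 + h * ∑ i ∈ S with (q i).natAbs = 1, (q i).sign = 0) := by
  have hq : ∀ i ∈ S, q i ≠ 0 := fun i hi h0 => by
    have := hodd i hi
    rw [h0] at this
    exact absurd this (by decide)
  have h1 := sum_prod_erase_bandTheta_mul hq b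
  have h2 := prod_bandTheta_mul (S := S) (q := q) b
  have hκ := two_mul_sum_bandDefect hq hb
  have ha : ∀ i ∈ S, 0 < (q i).natAbs := fun i hi => Int.natAbs_pos.2 (hq i hi)
  -- The factor X² - 1 and the unit s⁻¹ come from h(1 + s⁻¹)(s - 1) = h s⁻¹(s² - 1).
  rw [isUnit_iff_isMonomialTimes (N := S.card)
    (P := X * ∏ j ∈ S, (X ^ (q j).natAbs - 1 : ℤ[X]) + C h * (X ^ 2 - 1) *
      (signedSum S (fun i => (q i).natAbs) (fun i => (q i).sign) +
          C (∑ i ∈ S, bandDefect (q i) (b i)) * ∏ j ∈ S, (X ^ (q j).natAbs - 1)))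
    (isUnit_negTInv.mul (isUnit_prod_bandUnit hq b)) ?_]
  · refine ⟨of_isMonomialTimes_odd ha (fun i hi => Int.natAbs_odd.2 (hodd i hi)) hκ hh, ?_⟩
    rintro ⟨h0, h2⟩
    have hκ0 : ∑ i ∈ S, bandDefect (q i) (b i) = 0 := by omega
    rw [hκ0, C_0, zero_mul, add_zero]
    rcases h2 with h2 | ⟨r, hr, hr3, hone, hu⟩
    · exact isMonomialTimes_of_all_units h0 h2
    · exact isMonomialTimes_of_three h0 hr hr3 hone hu
  · rw [map_add, map_mul, map_mul, map_mul, map_sub, map_pow, evalNegT_X, evalNegT_C, map_one]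
    have h3 := negT_mul_negTInv
    set B := evalNegT (signedSum S (fun i => (q i).natAbs) (fun i => (q i).sign) +
          C (∑ i ∈ S, bandDefect (q i) (b i)) * ∏ j ∈ S, (X ^ (q j).natAbs - 1))
    set A := evalNegT (∏ j ∈ S, (X ^ (q j).natAbs - 1))
    set U := ∏ j ∈ S, bandUnit (q j) (b j)
    linear_combination h2 + h * (1 + negTInv) * h1 + (-U * A - h * U * B * (negT - 1)) * h3

end ParallelBands

/-! ## Degenerate parameters -/

section Degenerate

variable {n : ℕ} {q : Fin n → ℤ} {e : Fin n}

theorem abs_eq_one_iff_natAbs (x : ℤ) : |x| = 1 ↔ x.natAbs = 1 := by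
  rw [Int.abs_eq_natAbs]
  omega

theorem unitSum_eq : unitSum q = ∑ i with (q i).natAbs = 1, (q i).sign := by
  rw [unitSum]
  simp only [abs_eq_one_iff_natAbs]
  refine Finset.sum_congr rfl fun i hi => ?_
  have := (Finset.mem_filter.1 hi).2
  rw [← Int.sign_mul_natAbs (q i), this, Int.sign_mul]
  simp

theorem even_sum_iff_even_card {ι : Type*} {s : Finset ι} {f : ι → ℤ} (h : ∀ i ∈ s, Odd (f i)) :
    Even (∑ i ∈ s, f i) ↔ Even s.card := by
  induction s using Finset.cons_induction with
  | empty => simp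
  | cons i s hi ih =>
    rw [Finset.sum_cons, Finset.card_cons, Int.even_add, Nat.even_add_one,
      ih fun j hj => h j (Finset.mem_cons_of_mem hj)]
    have := Int.not_even_iff_odd.2 (h i (Finset.mem_cons_self i s))
    tauto

theorem even_unitSum_iff :
    Even (unitSum q) ↔ Even (Finset.univ.filter fun i => (q i).natAbs = 1).card := by
  simp only [unitSum, abs_eq_one_iff_natAbs]
  refine even_sum_iff_even_card fun i hi => ?_
  rw [← Int.natAbs_odd, (Finset.mem_filter.1 hi).2]
  exact odd_one

theorem filter_eq_erase (he : (q e).natAbs ≠ 1) (h : ∀ i, i ≠ e → (q i).natAbs = 1) :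
    Finset.univ.filter (fun i => (q i).natAbs = 1) = Finset.univ.erase e := by
  ext i
  simp only [Finset.mem_filter, Finset.mem_univ, true_and, Finset.mem_erase, and_true]
  exact ⟨fun hi hie => he (hie ▸ hi), h i⟩

theorem filter_eq_erase_erase (he : (q e).natAbs ≠ 1) {r : Fin n} (hr : (q r).natAbs ≠ 1)
    (h : ∀ i, i ≠ e → i ≠ r → (q i).natAbs = 1) :
    Finset.univ.filter (fun i => (q i).natAbs = 1) = (Finset.univ.erase e).erase r := by
  ext i
  simp only [Finset.mem_filter, Finset.mem_univ, true_and, Finset.mem_erase, and_true]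
  exact ⟨fun hi => ⟨fun hir => hr (hir ▸ hi), fun hie => he (hie ▸ hi)⟩, fun hi => h i hi.2 hi.1⟩

theorem natAbs_ne_one (he : Even (q e)) : (q e).natAbs ≠ 1 := fun h => by
  rw [← Int.natAbs_even, h] at he
  exact absurd he (by decide)

theorem isDegenerateEven_iff_of_eq_zero (he : q e = 0) :
    IsDegenerateEven q e ↔ ∀ i, i ≠ e → (q i).natAbs = 1 := by
  simp only [IsDegenerateEven, he, zero_mul, zero_add, true_or, and_true, abs_eq_one_iff_natAbs, ne_eq]
  refine or_iff_left ?_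
  rintro ⟨r, -, hr, -, ⟨-, h⟩ | ⟨h1, h2, -⟩⟩
  · exact hr h
  · omega

/-- The sum u of the units has the parity of their number, which is n - 1 or n - 2 in the two
degenerate cases. For even n the first case thus needs q_e u = -2, so u = ±1, and the second needs u
= 0. -/
theorem isDegenerateEven_iff_of_even (hn : Even n) (he : Even (q e)) (he0 : q e ≠ 0)
    (hodd : ∀ i, i ≠ e → Odd (q i)) : IsDegenerateEven q e ↔
      ∑ i, (q i).sign = 0 ∧ (((∀ i, i ≠ e → (q i).natAbs = 1) ∧ (q e).natAbs = 2) ∨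
        ∃ r, r ≠ e ∧ (q r).natAbs ≠ 1 ∧ (∀ i, i ≠ e → i ≠ r → (q i).natAbs = 1) ∧
          ((q r).natAbs = (q e).natAbs + 1 ∨ (q e).natAbs = (q r).natAbs + 1) ∧
            ∑ i with (q i).natAbs = 1, (q i).sign = 0) := by
  have hs := Finset.add_sum_erase Finset.univ (fun i => (q i).sign) (Finset.mem_univ e)
  have he1 := natAbs_ne_one he
  have hee := Int.sign_mul_natAbs (q e)
  have hes := sign_eq_one_or_neg_one he0
  have hpar := even_unitSum_iff (q := q)
  have hc := Finset.card_erase_of_mem (Finset.mem_univ e)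
  rw [Finset.card_univ, Fintype.card_fin] at hc
  have hn0 : 0 < n := e.pos
  simp only [IsDegenerateEven, abs_eq_one_iff_natAbs, ne_eq]
  constructor
  · rintro (⟨h, hu⟩ | ⟨r, hre, hr, h, hu⟩)
    · have hfil := filter_eq_erase he1 h
      have hu1 := unitSum_eq (q := q)
      rw [hfil] at hu1 hpar
      have hodd' : ¬ Even (unitSum q) := by
        rw [hpar, hc]
        obtain ⟨x, hx⟩ := hn
        rintro ⟨y, hy⟩
        omega
      have hu2 : q e * unitSum q = -2 := hu.resolve_left fun h0 => by
        rcases mul_eq_zero.1 h0 with h0 | h0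
        · exact he0 h0
        · rw [h0] at hodd'
          exact hodd' (by decide)
      have hu3 : unitSum q = 1 ∨ unitSum q = -1 := by
        obtain ⟨x, hx⟩ := he
        rw [hx] at hu2
        have : x * unitSum q = -1 := by linarith
        exact Int.isUnit_iff.1 (isUnit_iff_dvd_one.2 ⟨-x, by linarith⟩)
      refine ⟨?_, Or.inl ⟨h, ?_⟩⟩
      · rcases hu3 with hu3 | hu3 <;> rw [hu3] at hu2 <;> rcases hes with hes | hes <;>
          rw [hes] at hee hs <;> omega
      · rcases hu3 with hu3 | hu3 <;> rw [hu3] at hu2 <;> omega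
    · have hfil := filter_eq_erase_erase he1 hr h
      have hu1 := unitSum_eq (q := q)
      have hrm : r ∈ Finset.univ.erase e := Finset.mem_erase.2 ⟨hre, Finset.mem_univ r⟩
      have hs2 := Finset.add_sum_erase _ (fun i => (q i).sign) hrm
      have hc2 := Finset.card_erase_of_mem hrm
      have hc3 : 0 < (Finset.univ.erase e).card := Finset.card_pos.2 ⟨r, hrm⟩
      have hr0 : q r ≠ 0 := fun h0 => by
        have := hodd r hre
        rw [h0] at this
        exact absurd this (by decide)
      have hrr := Int.sign_mul_natAbs (q r)
      have hrs := sign_eq_one_or_neg_one hr0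
      have hu2 : unitSum q = 0 ∧ (q e + q r).natAbs = 1 := hu.resolve_right fun h0 => by
        have : Even (unitSum q) := by
          rw [hpar, hfil, hc2, hc]
          obtain ⟨x, hx⟩ := hn
          exact ⟨x - 1, by omega⟩
        rw [← Int.natAbs_even, h0.1] at this
        exact absurd this (by decide)
      have hu3 := hu1.symm.trans hu2.1
      refine ⟨?_, Or.inr ⟨r, hre, hr, h, ?_, hu3⟩⟩
      · rw [hfil] at hu3
        rcases hes with hes | hes <;> rcases hrs with hrs | hrs <;> rw [hes] at hee hs <;>
          rw [hrs] at hrr hs2 <;> omega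
      · rcases hes with hes | hes <;> rcases hrs with hrs | hrs <;> rw [hes] at hee <;>
          rw [hrs] at hrr <;> omega
  · rintro ⟨h0, ⟨h, he2⟩ | ⟨r, hre, hr, h, hsize, hu⟩⟩
    · left
      refine ⟨h, Or.inr ?_⟩
      rw [unitSum_eq, filter_eq_erase he1 h]
      rw [he2] at hee
      have : ∑ i ∈ Finset.univ.erase e, (q i).sign = -(q e).sign := by linarith
      rw [this, ← hee]
      rcases hes with hes | hes <;> rw [hes] <;> simp
    · right
      refine ⟨r, hre, hr, h, Or.inl ⟨unitSum_eq.trans hu, ?_⟩⟩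
      have hrm : r ∈ Finset.univ.erase e := Finset.mem_erase.2 ⟨hre, Finset.mem_univ r⟩
      have hs2 := Finset.add_sum_erase _ (fun i => (q i).sign) hrm
      rw [filter_eq_erase_erase he1 hr h] at hu
      have hrr := Int.sign_mul_natAbs (q r)
      have hrs : (q r).sign = -(q e).sign := by omega
      rcases hes with hes | hes <;> rw [hes] at hee hrs <;> rw [hrs] at hrr <;> omega

/-- For odd n the parities are reversed. In the first case u is even, so q_e u is divisible by 4 and
must be 0; in the second case u is odd, which leaves the alternative with |u| = 1. -/
theorem isDegenerateEven_iff_of_odd (hn : Odd n) {h : ℤ} (he : q e = 2 * h) (hh : h ≠ 0) :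
    IsDegenerateEven q e ↔
      ∑ i ∈ Finset.univ.erase e, (q i).sign = 0 ∧
        ((∀ i ∈ Finset.univ.erase e, (q i).natAbs = 1) ∨
        ∃ r ∈ Finset.univ.erase e, (q r).natAbs = 3 ∧
          (∀ i ∈ Finset.univ.erase e, i ≠ r → (q i).natAbs = 1) ∧
          1 + h * ∑ i ∈ Finset.univ.erase e with (q i).natAbs = 1, (q i).sign = 0) := by
  have he1 := natAbs_ne_one (q := q) (e := e) ⟨h, by rw [he]; ring⟩
  have hfe : ∀ S : Finset (Fin n), S = Finset.univ.erase e → (S.filter fun i => (q i).natAbs = 1) =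
      Finset.univ.filter fun i => (q i).natAbs = 1 := by
    rintro S rfl
    ext i
    simp only [Finset.mem_filter, Finset.mem_univ, true_and, Finset.mem_erase, and_true,
      and_iff_right_iff_imp]
    exact fun hi hie => he1 (hie ▸ hi)
  rw [hfe _ rfl, ← unitSum_eq]
  have hpar := even_unitSum_iff (q := q)
  have hc := Finset.card_erase_of_mem (Finset.mem_univ e)
  rw [Finset.card_univ, Fintype.card_fin] at hc
  simp only [IsDegenerateEven, abs_eq_one_iff_natAbs, ne_eq, Finset.mem_erase, Finset.mem_univ, and_true]
  constructor
  · rintro (⟨h1, hu⟩ | ⟨r, hre, hr, h1, hu⟩)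
    · have hfil := filter_eq_erase he1 h1
      have hu1 := unitSum_eq (q := q)
      rw [hfil] at hu1 hpar
      refine ⟨?_, Or.inl h1⟩
      rw [← hu1]
      rcases hu with hu | hu
      · rw [he] at hu
        rcases mul_eq_zero.1 hu with h0 | h0
        · omega
        · exact h0
      · have h2 : Even (unitSum q) := by
          rw [hpar, hc]
          obtain ⟨x, hx⟩ := hn
          exact ⟨x, by omega⟩
        obtain ⟨x, hx⟩ := h2
        rw [he, hx] at hu
        have : 2 * (h * x) = -1 := by linarith
        omega
    · have hfil := filter_eq_erase_erase he1 hr h1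
      have hu1 := unitSum_eq (q := q)
      have hrm : r ∈ Finset.univ.erase e := Finset.mem_erase.2 ⟨hre, Finset.mem_univ r⟩
      have hs2 := Finset.add_sum_erase _ (fun i => (q i).sign) hrm
      have hc2 := Finset.card_erase_of_mem hrm
      have hc3 : 0 < (Finset.univ.erase e).card := Finset.card_pos.2 ⟨r, hrm⟩
      have hodd' : ¬ Even (unitSum q) := by
        rw [hpar, hfil, hc2, hc]
        obtain ⟨x, hx⟩ := hn
        rintro ⟨y, hy⟩
        omega
      have hu2 := hu.resolve_left fun h0 => hodd' (by rw [h0.1]; decide)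
      rw [hfil] at hu1
      obtain ⟨hu2, hu3, hu4⟩ := hu2
      have hu5 : unitSum q = 1 ∨ unitSum q = -1 := by omega
      refine ⟨?_, Or.inr ⟨r, hre, ?_, h1, ?_⟩⟩
      · have hrs : (q r).sign = -unitSum q := by
          rcases hu5 with hu5 | hu5 <;> rw [hu4, hu5] <;> rfl
        omega
      · omega
      · rcases hu5 with hu5 | hu5 <;> rw [hu5] at hu3 ⊢ <;> omega
  · rintro ⟨h0, h1 | ⟨r, hre, hr, h1, hu⟩⟩
    · left
      refine ⟨h1, Or.inl ?_⟩
      rw [unitSum_eq, filter_eq_erase he1 h1, h0, mul_zero]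
    · right
      have hr1 : (q r).natAbs ≠ 1 := by omega
      refine ⟨r, hre, hr1, h1, Or.inr ?_⟩
      have hrm : r ∈ Finset.univ.erase e := Finset.mem_erase.2 ⟨hre, Finset.mem_univ r⟩
      have hs2 := Finset.add_sum_erase _ (fun i => (q i).sign) hrm
      have hu1 := unitSum_eq (q := q)
      rw [filter_eq_erase_erase he1 hr1 h1] at hu1
      have hrr := Int.sign_mul_natAbs (q r)
      have hrs : (q r).sign = -unitSum q := by omega
      have hu5 : unitSum q = 1 ∨ unitSum q = -1 :=
        Int.isUnit_iff.1 (isUnit_iff_dvd_one.2 ⟨-h, by linarith⟩)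
      rw [hr, hrs] at hrr
      rcases hu5 with hu5 | hu5 <;> rw [hu5] at hu hrr ⊢ <;> omega

end Degenerate

/-! ### The triviality criterion with an even parameter. -/

section EvenParameter

open LaurentPolynomial

variable {m : ℕ} {q : Fin (m + 1) → ℤ} {e : Fin (m + 1)}

theorem sum_prod_erase_eq_add {R ι : Type*} [CommRing R] [DecidableEq ι] {S : Finset ι} {e : ι}
    (he : e ∈ S) (θ : ι → R) : ∑ i ∈ S, ∏ j ∈ S.erase i, θ j =
      ∏ j ∈ S.erase e, θ j + θ e * ∑ i ∈ S.erase e, ∏ j ∈ (S.erase e).erase i, θ j := by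
  rw [← Finset.add_sum_erase _ _ he, Finset.mul_sum]
  congr 1
  refine Finset.sum_congr rfl fun i hi => ?_
  rw [Finset.erase_right_comm, Finset.mul_prod_erase]
  exact Finset.mem_erase.2 ⟨(Finset.ne_of_mem_erase hi).symm, he⟩

/-- The parity of n decides whether the band `e` is parallel or antiparallel. The case q_e = 0 is
separate, since the criteria need nonzero parameters; there θ_e = 0, and only the product over the
other bands remains. -/
theorem isUnit_alexanderPolynomial_iff_of_even (o : (pretzelDiagram q).Orientation)
    (he : Even (q e)) (hodd : ∀ i, i ≠ e → Odd (q i)) :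
    IsUnit o.alexanderPolynomial ↔ IsDegenerateEven q e := by
  have hpar := parallel_of_ne o he hodd
  have hne : ∀ i, i ≠ e → q i ≠ 0 := fun i hi h0 => by
    have := hodd i hi
    rw [h0] at this
    exact absurd this (by decide)
  rcases directions_of_even o he hodd with ⟨hn, hd, hs⟩ | ⟨hn, hd, hs⟩
  · have hpar' : ∀ i, leftDir o i = rightDir o i := fun i => by
      by_cases hie : i = e
      · rw [hie, hd]
      · exact hpar i hie
    rw [(associated_sum_prod_erase o (fun i => bandTheta (q i) (leftDir o i))
      (fun i => by rw [← hpar' i]; exact bandLeft_parallel _ _)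
      (fun i => by rw [← hpar' i]; exact bandRight_parallel _ _)).isUnit_iff]
    by_cases he0 : q e = 0
    · rw [isDegenerateEven_iff_of_eq_zero he0, sum_prod_erase_eq_add (Finset.mem_univ e), he0,
        bandTheta_zero, zero_mul, add_zero,
        isUnit_prod_bandTheta_iff fun i hi => hne i (Finset.ne_of_mem_erase hi)]
      simp
    · have h0 : ∀ i ∈ Finset.univ, q i ≠ 0 := fun i _ => by
        by_cases hie : i = e
        · rwa [hie]
        · exact hne i hie
      rw [isDegenerateEven_iff_of_even hn he he0 hodd,
        isUnit_sum_prod_erase_iff (Finset.mem_univ e) h0 (fun i _ => hodd i) he hs]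
      simp
  · obtain ⟨h, hh⟩ := he
    rw [← two_mul] at hh
    let θ := fun i => if i = e then h * (1 + negTInv) else bandTheta (q i) (leftDir o i)
    have hfac : h * (T (dirExp (leftDir o e)) - 1 : ℤ[T;T⁻¹]) =
        -dirFactor (leftDir o e) * (h * (1 + negTInv)) := by
      have h2 := negT_mul_negTInv
      cases leftDir o e
      · simp only [dirExp, dirFactor, negTInv, Bool.false_eq_true, if_false]
        ring
      · have h3 : (T 1 : ℤ[T;T⁻¹]) = -negT := by rw [negT, neg_neg]
        simp only [dirExp, dirFactor, if_true, h3]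
        linear_combination (h : ℤ[T;T⁻¹]) * h2
    have hθ : ∀ S : Finset (Fin (m + 1)), e ∉ S →
        ∏ j ∈ S, θ j = ∏ j ∈ S, bandTheta (q j) (leftDir o j) := fun S hS =>
      Finset.prod_congr rfl fun j hj => if_neg fun (hje : j = e) => hS (hje ▸ hj)
    rw [(associated_sum_prod_erase o θ (fun i => ?_) (fun i => ?_)).isUnit_iff,
      sum_prod_erase_eq_add (Finset.mem_univ e), hθ _ (Finset.notMem_erase _ _),
      Finset.sum_congr rfl fun i _ =>
        hθ _ fun hi => Finset.notMem_erase e _ (Finset.mem_of_mem_erase hi)]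
    · simp only [θ, if_true]
      by_cases he0 : q e = 0
      · rw [isDegenerateEven_iff_of_eq_zero he0]
        have : h = 0 := by omega
        rw [this, Int.cast_zero, zero_mul, zero_mul, add_zero,
          isUnit_prod_bandTheta_iff fun i hi => hne i (Finset.ne_of_mem_erase hi)]
        simp
      · have h0 : h ≠ 0 := by omega
        rw [isDegenerateEven_iff_of_odd hn hh h0,
          isUnit_prod_add_iff h0 (fun i hi => hodd i (Finset.ne_of_mem_erase hi)) hs]
    · by_cases hie : i = e
      · simp only [θ, hie, if_true]
        rw [hd, hh, bandLeft_antiparallel_even, hfac]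
      · simp only [θ, hie, if_false]
        rw [← hpar i hie]
        exact bandLeft_parallel _ _
    · by_cases hie : i = e
      · simp only [θ, hie, if_true]
        rw [hd, hh, bandRight_antiparallel_even, hfac, Bool.not_not]
      · simp only [θ, hie, if_false]
        rw [← hpar i hie]
        exact bandRight_parallel _ _

end EvenParameter

/-! ## Knots and orientations -/

section Knots

variable {n : ℕ} {q : Fin n → ℤ}

/-- The upper end of the strand through the segment `⟨i, j, s⟩` of a band lies on the right if and
only if this is `true`. -/
def topSide (j : ℕ) (s : Bool) : Bool := if Even j then s else !s

theorem topSide_succ (j : ℕ) (s : Bool) : topSide (j + 1) s = topSide j (!s) := by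
  by_cases h : Even j <;> simp [topSide, Nat.even_add_one, h]

theorem decide_even_succ (k : ℕ) : decide (Even (k + 1)) = !decide (Even k) := by
  simp only [Nat.even_add_one, decide_not]

theorem pretzelCorner_opposite (c : (pretzelDiagram q).Crossing) (k : Fin 4) :
    (pretzelDiagram q).corner c (k + 2) =
      pretzelCorner q c.1 c.2 ((if 0 < q c.1 then k else k + 1) + 2) := by
  have h : (if 0 < q c.1 then k + 2 else k + 2 + 1) = (if 0 < q c.1 then k else k + 1) + 2 := by
    split_ifs
    · rfl
    · exact add_right_comm _ _ _
  rw [← h]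
  rfl

/-- A colouring of the strands that agrees across all arcs descends to the components, of which a
knot has only one. -/
theorem eq_of_isKnot (hK : (pretzelDiagram q).IsKnot) (g : Fin n → Bool → Bool)
    (hup : ∀ i, g (finRotate n i) false = g i true)
    (hlow : ∀ i, g (finRotate n i) (topSide (q (finRotate n i)).natAbs false) =
      g i (topSide (q i).natAbs true)) (i i' : Fin n) (s s' : Bool) : g i s = g i' s' := by
  let F : (pretzelDiagram q).Component → Bool :=
    Quot.lift (fun x : PretzelEdge q => g x.1 (topSide x.2.1 x.2.2)) (by
      rintro x y (⟨c, k⟩ | ⟨j, b⟩)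
      · have key : ∀ k : Fin 4, g (pretzelCorner q c.1 c.2 k).1.1
            (topSide (pretzelCorner q c.1 c.2 k).1.2.1 (pretzelCorner q c.1 c.2 k).1.2.2) =
            g (pretzelCorner q c.1 c.2 (k + 2)).1.1
            (topSide (pretzelCorner q c.1 c.2 (k + 2)).1.2.1
              (pretzelCorner q c.1 c.2 (k + 2)).1.2.2) := by
          intro k
          fin_cases k <;> simp [pretzelCorner, topSide_succ]
        rw [pretzelCorner_opposite]
        exact key _
      · cases b
        · exact (hup j).symm
        · exact (hlow j).symm)
  have hc := Nat.card_eq_one_iff_unique.1 hK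
  have h := hc.1
  have := congrArg F (h.elim (Quot.mk _ ⟨i, 0, s⟩) (Quot.mk _ ⟨i', 0, s'⟩))
  exact this

/-- For even n the colouring by the parity of the band compared with the side is consistent around
the cycle and not constant. -/
theorem odd_of_isKnot (hK : (pretzelDiagram q).IsKnot) (hq : ∀ i, Odd (q i)) : Odd n := by
  obtain _ | m := n
  · have hc := Nat.card_eq_one_iff_unique.1 hK
    obtain ⟨x⟩ := hc.2
    induction x using Quot.ind with
    | mk x => exact (x : PretzelEdge q).1.elim0
  · by_contra hm
    rw [Nat.not_odd_iff_even] at hm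
    have hrot : ∀ i : Fin (m + 1), decide (Even (finRotate _ i).val) = !decide (Even i.val) := by
      intro i
      rw [finRotate_apply, Fin.val_add_one]
      split_ifs with h
      · rw [h, Fin.val_last, ← decide_even_succ]
        simp [hm]
      · exact decide_even_succ _
    have ht : ∀ i s, topSide (q i).natAbs s = !s := fun i s => by
      rw [topSide, if_neg]
      rw [Int.natAbs_even, Int.not_even_iff_odd]
      exact hq i
    have := eq_of_isKnot hK (fun i s => decide (Even i.val) == s)
      (fun i => by rw [hrot]; cases decide (Even i.val) <;> rfl)
      (fun i => by rw [hrot, ht, ht]; cases decide (Even i.val) <;> rfl) 0 0 true false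
    simp at this

/-- For even bands a < b, the right strand of a, the left strand of b and all strands in between are
closed under the arcs, but the left strand of a is missing. -/
theorem odd_of_isKnot_of_ne (hK : (pretzelDiagram q).IsKnot) {e : Fin n} (he : Even (q e)) (i : Fin n)
    (hi : i ≠ e) : Odd (q i) := by
  obtain _ | m := n
  · exact e.elim0
  have key : ∀ a b : Fin (m + 1), a < b → Even (q a) → Even (q b) → False := by
    intro a b hab ha hb
    let g : Fin (m + 1) → Bool → Bool := fun i s =>
      decide ((a < i ∧ i < b) ∨ (i = a ∧ s = true) ∨ (i = b ∧ s = false))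
    have hodd : ∀ i, ¬ Even (q i) → g i false = g i true := fun i hi => by
      have h1 : i ≠ a := fun h => hi (h ▸ ha)
      have h2 : i ≠ b := fun h => hi (h ▸ hb)
      simp [g, h1, h2]
    have hup : ∀ i, g (finRotate _ i) false = g i true := by
      intro i
      have hv := Fin.val_add_one i
      simp only [g, finRotate_apply, decide_eq_decide, Fin.lt_def, Fin.ext_iff, hv]
      have := i.isLt
      have := b.isLt
      rw [Fin.lt_def] at hab
      split_ifs with h
      · simp at h
        simp
        omega
      · simp
        omega
    have ht : ∀ i s, g i (topSide (q i).natAbs s) = g i s := fun i s => by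
      rw [topSide]
      split_ifs with h
      · rfl
      · have := hodd i (by rwa [Int.natAbs_even] at h)
        cases s
        · exact this.symm
        · exact this
    have := eq_of_isKnot hK g hup (fun i => by rw [ht, ht, hup]) a a true false
    simp [g, hab.ne] at this
  by_contra h
  rw [Int.not_odd_iff_even] at h
  rcases hi.lt_or_gt with h1 | h1
  · exact key i e h1 h he
  · exact key e i h1 he h

/-- Compatible directions of the upper ends of the strands of the bands give an orientation. -/
def orientationOfTop (d : Fin n → Bool → Bool)
    (hup : ∀ i, d (finRotate n i) false = !d i true)
    (hlow : ∀ i, d (finRotate n i) (topSide (q (finRotate n i)).natAbs false) =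
      !d i (topSide (q i).natAbs true)) : (pretzelDiagram q).Orientation :=
  let P : PretzelEdge q × Bool → Prop := fun x => d x.1.1 (topSide x.1.2.1 x.1.2.2) = x.2
  have key : ∀ (i : Fin n) (j : Fin (q i).natAbs) (k : Fin 4),
      P (pretzelCorner q i j k) ↔ ¬ P (pretzelCorner q i j (k + 2)) := by
    intro i j k
    fin_cases k <;> simp [P, pretzelCorner, topSide_succ]
  { head := fun x : PretzelEdge q => d x.1 (topSide x.2.1 x.2.2)
    lower := fun c => (key c.1 c.2 _).trans
      (not_congr (iff_of_eq (congrArg P (pretzelCorner_opposite c 0).symm)))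
    upper := fun c => (key c.1 c.2 _).trans
      (not_congr (iff_of_eq (congrArg P (pretzelCorner_opposite c 1).symm)))
    joint := fun ⟨i, b⟩ => by
      cases b
      · change d i true = false ↔ d (finRotate n i) false ≠ false
        rw [hup]
        cases d i true <;> simp
      · change d i (topSide (q i).natAbs true) = true ↔
          d (finRotate n i) (topSide (q (finRotate n i)).natAbs false) ≠ true
        rw [hlow]
        cases d i (topSide (q i).natAbs true) <;> simp }

theorem nonempty_orientation_of_odd (hq : ∀ i, Odd (q i)) :
    Nonempty (pretzelDiagram q).Orientation := by
  have ht : ∀ i s, topSide (q i).natAbs s = !s := fun i s => by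
    rw [topSide, if_neg]
    rw [Int.natAbs_even, Int.not_even_iff_odd]
    exact hq i
  -- In every band the upper left end points up and the upper right end down.
  exact ⟨orientationOfTop (fun _ s => s) (fun _ => rfl) fun i => by rw [ht, ht]; rfl⟩

/-- The directions `r` alternate from band to band, starting at `e`, with parallel strands in the
odd bands. Closing the cycle fixes the upper left end of band `e` by the parity of n. -/
theorem nonempty_orientation_of_even {e : Fin n} (he : Even (q e))
    (hq : ∀ i, i ≠ e → Odd (q i)) : Nonempty (pretzelDiagram q).Orientation := by
  obtain _ | m := n
  · exact e.elim0
  let r : Fin (m + 1) → Bool := fun i => decide (Even (i - e).val)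
  let d : Fin (m + 1) → Bool → Bool := fun i s =>
    if i = e ∧ s = false then decide (Even (m + 1)) else r i
  have hstep : ∀ i, finRotate _ i ≠ e → r (finRotate _ i) = !r i := by
    intro i hi
    rw [finRotate_apply] at hi ⊢
    have h1 : i + 1 - e = i - e + 1 := add_sub_right_comm _ _ _
    have h2 : i - e ≠ Fin.last m := fun h => hi (by
      rw [← sub_eq_zero, h1, h, Fin.last_add_one])
    simp only [r]
    rw [h1, Fin.val_add_one, if_neg h2]
    exact decide_even_succ _
  have hlast : ∀ i, finRotate _ i = e → decide (Even (m + 1)) = !r i := by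
    intro i hi
    rw [finRotate_apply] at hi
    have h1 : i - e = Fin.last m := by
      rw [← hi, sub_add_cancel_left]
      exact (eq_neg_of_add_eq_zero_left (Fin.last_add_one m)).symm
    simp only [r]
    rw [h1]
    exact decide_even_succ m
  have hte : ∀ s, topSide (q e).natAbs s = s := fun s => if_pos (Int.natAbs_even.2 he)
  have ht : ∀ i, i ≠ e → ∀ s, d i (topSide (q i).natAbs s) = r i := fun i hi s => by
    simp [d, hi]
  have hup : ∀ i, d (finRotate _ i) false = !r i := fun i => by
    by_cases h : finRotate _ i = e
    · simp only [d, h, true_and, if_true]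
      exact hlast i h
    · simp only [d, h, false_and, if_false]
      exact hstep i h
  have hr : ∀ i, d i (topSide (q i).natAbs true) = r i := fun i => by
    by_cases h : i = e
    · rw [h, hte]
      simp [d]
    · exact ht i h _
  refine ⟨orientationOfTop d (fun i => by rw [hup]; simp [d]) fun i => ?_⟩
  rw [hr]
  by_cases h : finRotate _ i = e
  · rw [h, hte, ← h, hup]
  · rw [ht _ h, hstep i h]

end Knots

theorem mainTheorem3 {n : ℕ} (q : Fin n → ℤ) (hK : (pretzelDiagram q).IsKnot) :
    Nonempty (pretzelDiagram q).Orientation ∧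
    ∀ o : (pretzelDiagram q).Orientation,
      ((∀ i, Odd (q i)) →
        (spanDegree o.alexanderPolynomial = (((n : ℤ) - 1 : ℤ) : WithBot ℤ) ↔
          ∑ k ∈ Finset.range ((n - 1) / 2 + 1), sigmaSymm q (2 * k) ≠ 0) ∧
        (EqUpToUnit o.alexanderPolynomial 1 ↔
          ∀ k ≤ (n - 1) / 2, sigmaSymm q (2 * k) = (-1) ^ k * (((n - 1) / 2).choose k : ℤ))) ∧
      (∀ e, Even (q e) → (EqUpToUnit o.alexanderPolynomial 1 ↔ IsDegenerateEven q e)) := by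
  refine ⟨?_, fun o => ⟨fun hq => ?_, fun e he => ?_⟩⟩
  · by_cases hq : ∀ i, Odd (q i)
    · exact nonempty_orientation_of_odd hq
    · push Not at hq
      obtain ⟨e, he⟩ := hq
      rw [Int.not_odd_iff_even] at he
      exact nonempty_orientation_of_even he (odd_of_isKnot_of_ne hK he)
  · obtain ⟨p, rfl⟩ := odd_of_isKnot hK hq
    obtain ⟨D, hD, hD4⟩ := exists_associated_odd hq o
    have hp : (2 * p + 1 - 1) / 2 = p := by omega
    have hn : ((2 * p + 1 : ℕ) : ℤ) - 1 = ((2 * p : ℕ) : ℤ) := by push_cast; ring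
    rw [hp, hn]
    refine ⟨spanDegree_odd_iff hD.symm hD4, ?_⟩
    rw [eqUpToUnit_one_iff, hD.isUnit_iff]
    exact isUnit_odd_iff (by simp [sigmaSymm]) hD4
  · obtain _ | m := n
    · exact e.elim0
    rw [eqUpToUnit_one_iff]
    exact isUnit_alexanderPolynomial_iff_of_even o he (odd_of_isKnot_of_ne hK he)
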